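/- Let $n,m,N\ge 0$ be integers. A $\mathfrak{gl}_k$-crystal is a finite set $B$ with maps $\mathrm{wt}:B\to\mathbb Z^k$, $e_i,f_i:B\to B\sqcup\{0\}$, $\varepsilon_i,\varphi_i:B\to\mathbb Z$ ($1\le i\le k-1$) satisfying the usual axioms. Tensor products follow the convention that $e_i(b_1\otimes\cdots\otimes b_d)$ applies $e_i$ to the factor $b_s$ with $s$ smallest such that $\varepsilon_i^s=\max(0,\max_t\varepsilon_i^t)$, where $\varepsilon_i^t=\varepsilon_i(b_t)-\langle\alpha_i^\vee,\mathrm{wt}(b_1)+\cdots+\mathrm{wt}(b_{t-1})\rangle$, and $f_i$ applies $f_i$ to the factor $b_s$ with $s$ largest such that $\varphi_i^s=\max(0,\max_t\varphi_i^t)$, where $\varphi_i^t=\varphi_i(b_t)+\langle\alpha_i^\vee,\mathrm{wt}(b_{t+1})+\cdots+\mathrm{wt}(b_d)\rangle$. Let $V_k=\bigsqcup_{l=0}^k\mathcal B_{\varpi_l}^{\mathfrak{gl}_k}$ be the crystal of $0/1$-vectors of length $k$ ($\mathcal B_{\varpi_l}$ consists of those with $l$ ones; $e_i$ moves a one from position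 $i+1$ to a free position $i$, and $f_i$ does the reverse). For a $\mathfrak{gl}_k$-crystal $B$ and $1\le p<q\le k$ let $\xi_{p,q}:B\to B$ be the Schützenberger involution of the restriction $B_J$ of $B$ to the nodes $J=\{p,\dots,q-1\}$: the map preserving each connected component of $B_J$ with $e_i\xi=\xi f_{p+q-1-i}$ and $f_i\xi=\xi e_{p+q-1-i}$ for $i\in J$ (where $\xi(0)=0$), and $\mathrm{wt}(\xi(b))=w_0^J\,\mathrm{wt}(b)$, where $w_0^J$ reverses the coordinates $p,\dots,q$. Let $\xi=\xi_{1,k}$ be the involution for the whole diagram (the identity if $k\le 1$). Let $\Lambda^NB_{n,m}$ be the set of $n\times m$ matrices with entries in $\{0,1\}$ and exactly $N$ ones. It is a $\mathfrak{gl}_m$-crystal by reading $M$ as $r_1\otimes\cdots\otimes r_n\in V_m^{\otimes n}$ (its rows) and a $\mathfrak{gl}_n$-crystal by reading $M$ as $c_m\otimes\cdots\otimes c_1\in V_n^{\otimes m}$ (its columns from right to left). Let $C_n$ be the cactus group, with generators $s_{p,q}$, $1\le p<q\le n$, and relations $s_{p,q}^2=1$; $s_{p,q}s_{p',q'}=s_{p+q-q',\,p+q-p'}s_{p,q}$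 if $p\le p'<q'\le q$; $s_{p,q}s_{p',q'}=s_{p',q'}s_{p,q}$ if $q<p'$. For $p<q$ define the outer map $$s^{o}_{p,q}(r_1\otimes\cdots\otimes r_n)=r_1\otimes\cdots\otimes r_{p-1}\otimes\xi\bigl(\xi(r_q)\otimes\cdots\otimes\xi(r_p)\bigr)\otimes r_{q+1}\otimes\cdots\otimes r_n,$$ formed with $\mathfrak{gl}_m$-crystals, and the inner map $s^{i}_{p,q}=\xi_{p,q}$ of the $\mathfrak{gl}_n$-crystal $\Lambda^NB_{n,m}$. **Theorem.** Both structures on $\Lambda^NB_{n,m}$ are crystals, and the Schützenberger involutions used here (those of $V_m$ and of all its tensor powers, the $\xi_{p,q}$ of the $\mathfrak{gl}_n$-crystal $\Lambda^NB_{n,m}$, and the $\xi_{p,q}$ of the tableau crystals $\mathcal B^{\mathfrak{gl}_n}_\lambda$ below) exist and are unique. The assignments $s_{p,q}\mapsto s^{o}_{p,q}$ and $s_{p,q}\mapsto s^{i}_{p,q}$ both define actions of $C_n$ on $\Lambda^NB_{n,m}$, and these actions agree: $$s^{o}_{p,q}(M)=s^{i}_{p,q}(M)\qquad\text{for all }1\le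 p<q\le n,\ M\in\Lambda^NB_{n,m}.$$ Moreover, let $\mathcal B^{\mathfrak{gl}_k}_\mu$ be the crystal of semistandard Young tableaux of shape $\mu$ with entries in $\{1,\dots,k\}$, a tableau being read as the tensor product of its columns from right to left. Then there is an isomorphism of $\mathfrak{gl}_n\times\mathfrak{gl}_m$-crystals (crystal skew Howe duality) $$\Lambda^NB_{n,m}\;\cong\bigsqcup_{\lambda\subset n\times m,\ |\lambda|=N}\mathcal B^{\mathfrak{gl}_n}_\lambda\otimes\mathcal B^{\mathfrak{gl}_m}_{\lambda^{\mathrm{tr}}},\qquad M\mapsto T_P\otimes T_Q,$$ where $\mathfrak{gl}_n$ acts on the first and $\mathfrak{gl}_m$ on the second factor, $P$ is the $\mathfrak{gl}_m$-highest weight matrix reached from $M$ by row raising operators, $Q$ is the $\mathfrak{gl}_n$-lowest weight matrix reached from $M$ by column lowering operators, $a$ lies in column $j$ of $T_P$ iff $P_{a,j}=1$, and $a$ lies in column $j$ of $T_Q$ iff $Q_{n+1-j,a}=1$. Under this isomorphism the above action of $s_{p,q}$ becomes $b\otimes c\mapsto\xi_{p,q}(b)\otimes c$. -/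

import Mathlib

/-! ## Crystals for `gl_k`

Nodes of the Dynkin diagram of `gl_k` are numbered `0, …, k-2` (so `Fin (k-1)`), coordinates of
weights `0, …, k-1`; the element `0 ∉ B` of the usual convention is `none`. -/

namespace GLCrystal

/-- First coordinate of the simple root `α_i = ε_i - ε_{i+1}`. -/
def fstIdx {k : ℕ} (i : Fin (k - 1)) : Fin k := ⟨i.1, by omega⟩

/-- Second coordinate of the simple root `α_i = ε_i - ε_{i+1}`. -/
def sndIdx {k : ℕ} (i : Fin (k - 1)) : Fin k := ⟨i.1 + 1, by omega⟩

/-- The simple root `α_i = ε_i - ε_{i+1}`. -/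
def root {k : ℕ} (i : Fin (k - 1)) : Fin k → ℤ :=
  Pi.single (fstIdx i) 1 - Pi.single (sndIdx i) 1

/-- The pairing `⟨w, α_i^∨⟩`. -/
def corootPairing {k : ℕ} (w : Fin k → ℤ) (i : Fin (k - 1)) : ℤ :=
  w (fstIdx i) - w (sndIdx i)

/-- The maps `wt, e_i, f_i, ε_i, φ_i` of a `gl_k`-crystal with underlying set `B`. -/
structure CrystalData (k : ℕ) (B : Type*) where
  wt : B → Fin k → ℤ
  e : Fin (k - 1) → B → Option B
  f : Fin (k - 1) → B → Option B
  eps : Fin (k - 1) → B → ℤ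
  phi : Fin (k - 1) → B → ℤ

variable {k : ℕ} {A B : Type*}

/-- The axioms of a `gl_k`-crystal. -/
structure IsCrystal (C : CrystalData k B) : Prop where
  finite : Finite B
  f_iff_e : ∀ i b c, C.f i b = some c ↔ C.e i c = some b
  wt_e : ∀ i b c, C.e i b = some c → C.wt c = C.wt b + root i
  wt_f : ∀ i b c, C.f i b = some c → C.wt c = C.wt b - root i
  eps_max : ∀ i b,
    IsGreatest {z : ℤ | ∃ j : ℕ, z = j ∧ (fun x => x.bind (C.e i))^[j] (some b) ≠ none} (C.eps i b)
  phi_max : ∀ i b,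
    IsGreatest {z : ℤ | ∃ j : ℕ, z = j ∧ (fun x => x.bind (C.f i))^[j] (some b) ≠ none} (C.phi i b)
  phi_sub_eps : ∀ i b, C.phi i b - C.eps i b = corootPairing (C.wt b) i

/-- A bijection that is an isomorphism of `gl_k`-crystals. -/
structure IsCrystalIso (C : CrystalData k A) (D : CrystalData k B) (F : A ≃ B) : Prop where
  wt : ∀ a, D.wt (F a) = C.wt a
  eps : ∀ i a, D.eps i (F a) = C.eps i a
  phi : ∀ i a, D.phi i (F a) = C.phi i a
  e : ∀ i a, D.e i (F a) = (C.e i a).map F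
  f : ∀ i a, D.f i (F a) = (C.f i a).map F

/-- `b` and `c` lie in the same connected component of the restriction of the crystal to the
nodes `p, …, q-1`. -/
def Connected (C : CrystalData k B) (p q : ℕ) (b c : B) : Prop :=
  Relation.EqvGen (fun x y => ∃ i : Fin (k - 1), p ≤ i.1 ∧ i.1 < q ∧ C.f i x = some y) b c

/-- `ξ` is the Schützenberger involution of the restriction `C_J` of the crystal to the subdiagram
`J = {p, …, q-1}`, whose diagram automorphism is `θ_J(i) = p + q - 1 - i` and whose longest Weyl
group element `w_0^J` reverses the coordinates `p, …, q`: it preserves each connected component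
of `C_J`, and `e_i ξ = ξ f_{θ_J(i)}`, `f_i ξ = ξ e_{θ_J(i)}` for `i ∈ J`, `wt ∘ ξ = w_0^J ∘ wt`. -/
structure IsSchutzenberger (C : CrystalData k B) (p q : ℕ) (ξ : B → B) : Prop where
  connected : ∀ b, Connected C p q b (ξ b)
  e_comm : ∀ i j : Fin (k - 1), p ≤ i.1 → i.1 < q → i.1 + j.1 + 1 = p + q →
    ∀ b, C.e i (ξ b) = (C.f j b).map ξ
  f_comm : ∀ i j : Fin (k - 1), p ≤ i.1 → i.1 < q → i.1 + j.1 + 1 = p + q →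
    ∀ b, C.f i (ξ b) = (C.e j b).map ξ
  wt_inside : ∀ x y : Fin k, p ≤ x.1 → x.1 ≤ q → x.1 + y.1 = p + q →
    ∀ b, C.wt (ξ b) x = C.wt b y
  wt_outside : ∀ x : Fin k, (x.1 < p ∨ q < x.1) → ∀ b, C.wt (ξ b) x = C.wt b x

open Classical in
/-- The Schützenberger involution `ξ_{C_J}`, `J = {p, …, q-1}` (the identity if there is none). -/
noncomputable def partialXi (C : CrystalData k B) (p q : ℕ) : B → B :=
  if h : ∃ ξ, IsSchutzenberger C p q ξ then h.choose else id

/-- The Schützenberger involution `ξ_C` for the whole Dynkin diagram of `gl_k`. -/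
noncomputable def xi (C : CrystalData k B) : B → B := partialXi C 0 (k - 1)

/-- `c` is a highest weight element obtained from `b` by a sequence of raising operators. -/
def IsEMax (C : CrystalData k B) (b c : B) : Prop :=
  Relation.ReflTransGen (fun x y => ∃ i, C.e i x = some y) b c ∧ ∀ i, C.e i c = none

/-- `c` is a lowest weight element obtained from `b` by a sequence of lowering operators. -/
def IsFMax (C : CrystalData k B) (b c : B) : Prop :=
  Relation.ReflTransGen (fun x y => ∃ i, C.f i x = some y) b c ∧ ∀ i, C.f i c = none

/-! ### Tensor products -/

/-- `ε_i^s(b_1 ⊗ ⋯ ⊗ b_d) = ε_i(b_s) - ⟨α_i^∨, wt(b_1) + ⋯ + wt(b_{s-1})⟩`. -/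
def tensorEpsAt (C : CrystalData k B) {d : ℕ} (i : Fin (k - 1)) (b : Fin d → B) (s : Fin d) : ℤ :=
  C.eps i (b s) - corootPairing (∑ t with t < s, C.wt (b t)) i

/-- `φ_i^s(b_1 ⊗ ⋯ ⊗ b_d) = φ_i(b_s) + ⟨α_i^∨, wt(b_{s+1}) + ⋯ + wt(b_d)⟩`. -/
def tensorPhiAt (C : CrystalData k B) {d : ℕ} (i : Fin (k - 1)) (b : Fin d → B) (s : Fin d) : ℤ :=
  C.phi i (b s) + corootPairing (∑ t with s < t, C.wt (b t)) i

/-- `max_s {ε_i^s, 0}`. -/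
def tensorEps (C : CrystalData k B) {d : ℕ} (i : Fin (k - 1)) (b : Fin d → B) : ℤ :=
  Finset.univ.fold max 0 (tensorEpsAt C i b)

/-- `max_s {φ_i^s, 0}`. -/
def tensorPhi (C : CrystalData k B) {d : ℕ} (i : Fin (k - 1)) (b : Fin d → B) : ℤ :=
  Finset.univ.fold max 0 (tensorPhiAt C i b)

/-- The tensor power `C ⊗ ⋯ ⊗ C` (`d` factors): `e_i` acts in the smallest position `s` with
`ε_i^s = ε_i`, and `f_i` in the largest position `s` with `φ_i^s = φ_i`. -/
def tensorPow (C : CrystalData k B) (d : ℕ) : CrystalData k (Fin d → B) where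
  wt b := ∑ s, C.wt (b s)
  e i b := ((List.finRange d).find? fun s => decide (tensorEpsAt C i b s = tensorEps C i b)).bind
    fun s => (C.e i (b s)).map (Function.update b s)
  f i b :=
    ((List.finRange d).reverse.find? fun s => decide (tensorPhiAt C i b s = tensorPhi C i b)).bind
      fun s => (C.f i (b s)).map (Function.update b s)
  eps := tensorEps C
  phi := tensorPhi C

open Classical in
/-- The crystal structure that a set `A` inherits from `C` through an injection `r` of `A` onto a
set of elements of `C` that is stable under the Kashiwara operators. -/
noncomputable def pullback (C : CrystalData k B) (r : A → B) : CrystalData k A where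
  wt a := C.wt (r a)
  e i a := (C.e i (r a)).bind fun x => if h : ∃ a', r a' = x then some h.choose else none
  f i a := (C.f i (r a)).bind fun x => if h : ∃ a', r a' = x then some h.choose else none
  eps i a := C.eps i (r a)
  phi i a := C.phi i (r a)

/-! ### Fundamental crystals -/

/-- The direct sum `⨆_l B_{ϖ_l}`, `0 ≤ l ≤ k`, of the crystals of the fundamental representations
`Λ^l ℂ^k`. The elements of `B_{ϖ_l}` are the 0/1-vectors of length `k` with `l` ones; `e_i` moves
a one from position `i+1` to the free position `i`, and `f_i` moves it back. -/
def vecCrystal (k : ℕ) : CrystalData k (Fin k → Bool) where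
  wt b j := if b j then 1 else 0
  e i b := if b (fstIdx i) = false ∧ b (sndIdx i) = true then
    some (Function.update (Function.update b (fstIdx i) true) (sndIdx i) false) else none
  f i b := if b (fstIdx i) = true ∧ b (sndIdx i) = false then
    some (Function.update (Function.update b (fstIdx i) false) (sndIdx i) true) else none
  eps i b := if b (fstIdx i) = false ∧ b (sndIdx i) = true then 1 else 0
  phi i b := if b (fstIdx i) = true ∧ b (sndIdx i) = false then 1 else 0

/-! ### 0/1-matrices -/

/-- `Λ^N B_{n,m}`: the `n × m` matrices with entries in `{0, 1}` (`false`, `true`) and exactly `N`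
ones. -/
def LambdaB (N n m : ℕ) : Type :=
  {M : Matrix (Fin n) (Fin m) Bool // (Finset.univ.filter fun x : Fin n × Fin m => M x.1 x.2).card = N}

/-- The `gl_m`-crystal structure: `M` is read as `r_1 ⊗ ⋯ ⊗ r_n`, the tensor product of its rows. -/
noncomputable def rowCrystal (N n m : ℕ) : CrystalData m (LambdaB N n m) :=
  pullback (tensorPow (vecCrystal m) n) fun M i => M.1 i

/-- The `gl_n`-crystal structure: `M` is read as `c_m ⊗ ⋯ ⊗ c_1`, the tensor product of its columns
from right to left. -/
noncomputable def colCrystal (N n m : ℕ) : CrystalData n (LambdaB N n m) :=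
  pullback (tensorPow (vecCrystal n) m) fun M j i => M.1 i j.rev

/-! ### The two actions -/

/-- The Henriques–Kamnitzer map
`s^o_{p,q}(b_1 ⊗ ⋯ ⊗ b_n) = b_1 ⊗ ⋯ ⊗ b_{p-1} ⊗ ξ(ξ(b_q) ⊗ ⋯ ⊗ ξ(b_p)) ⊗ b_{q+1} ⊗ ⋯ ⊗ b_n`. -/
noncomputable def tensorOuter (C : CrystalData k B) {n : ℕ} (p q : Fin n) (b : Fin n → B) :
    Fin n → B :=
  fun r => if h : p ≤ r ∧ r ≤ q then
      xi (tensorPow C (q.1 - p.1 + 1)) (fun j => xi C (b ⟨q.1 - j.1, by omega⟩))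
        ⟨r.1 - p.1, by have := h.1; have := h.2; omega⟩
    else b r

/-- The outer map `s^o_{p,q}` on 0/1-matrices, read as tensor products of their rows. -/
noncomputable def sOuter {n m : ℕ} (p q : Fin n) (M : Matrix (Fin n) (Fin m) Bool) :
    Matrix (Fin n) (Fin m) Bool :=
  tensorOuter (vecCrystal m) p q M

/-- The inner map `s^i_{p,q}`: the Schützenberger involution of the `gl_n`-crystal `Λ^N B_{n,m}`
restricted to the nodes `p, …, q-1`. -/
noncomputable def sInner {N n m : ℕ} (p q : Fin n) : LambdaB N n m → LambdaB N n m :=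
  partialXi (colCrystal N n m) p.1 q.1

/-- The generators `s_{p,q}`, `p < q`, of the cactus group; `s_{p,q}` belongs to the connected
subdiagram `{p, …, q-1}` of the Dynkin diagram of `gl_n`. -/
def CactusGen (n : ℕ) : Type := {x : Fin n × Fin n // x.1 < x.2}

/-- The defining relations of the cactus group `C_n`. -/
inductive CactusRel (n : ℕ) : FreeGroup (CactusGen n) → Prop
  /-- `s_J² = 1` -/
  | invol (a : CactusGen n) : CactusRel n (FreeGroup.of a * FreeGroup.of a)
  /-- `s_J s_{J'} = s_{θ_J(J')} s_J` for `J' ⊆ J` -/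
  | nested (a b c : CactusGen n) (h₁ : a.1.1 ≤ b.1.1) (h₂ : b.1.2 ≤ a.1.2)
      (h₃ : b.1.1.1 + c.1.2.1 = a.1.1.1 + a.1.2.1) (h₄ : b.1.2.1 + c.1.1.1 = a.1.1.1 + a.1.2.1) :
      CactusRel n (FreeGroup.of a * FreeGroup.of b * (FreeGroup.of c * FreeGroup.of a)⁻¹)
  /-- `s_J s_{J'} = s_{J'} s_J` if `J ∪ J'` is not connected -/
  | disjoint (a b : CactusGen n) (h : a.1.2 < b.1.1) :
      CactusRel n (FreeGroup.of a * FreeGroup.of b * (FreeGroup.of b * FreeGroup.of a)⁻¹)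

/-- The cactus group `C_n = C_{gl_n}`. -/
abbrev CactusGroup (n : ℕ) : Type := PresentedGroup {r | CactusRel n r}

/-- The element `s_{p,q}` of `C_n`. -/
def cactusS {n : ℕ} (p q : Fin n) (h : p < q) : CactusGroup n :=
  PresentedGroup.of ⟨(p, q), h⟩

/-! ### Tableaux and skew Howe duality -/

/-- Semistandard Young tableaux of shape `μ` with entries in the alphabet `{0, …, k-1}`. -/
def Tableau (k : ℕ) (μ : YoungDiagram) : Type :=
  {T : SemistandardYoungTableau μ // ∀ i j, (i, j) ∈ μ → T i j < k}

/-- The letter `a` occurs in column `j` of `T`. -/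
def Tableau.InCol {k : ℕ} {μ : YoungDiagram} (T : Tableau k μ) (j a : ℕ) : Prop :=
  ∃ i, (i, j) ∈ μ ∧ T.1 i j = a

open Classical in
/-- The crystal `B_μ` of the irreducible `gl_k`-representation with highest weight `μ`:
a tableau is read as the tensor product of its columns from right to left. -/
noncomputable def tabCrystal (k : ℕ) (μ : YoungDiagram) : CrystalData k (Tableau k μ) :=
  pullback (tensorPow (vecCrystal k) (μ.rowLen 0)) fun T j a => decide (T.InCol j.rev.1 a.1)

/-- Partitions `λ ⊆ n × m` (at most `n` rows, at most `m` columns) with `|λ| = N`. -/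
def BoxPartition (N n m : ℕ) : Type :=
  {μ : YoungDiagram // μ.colLen 0 ≤ n ∧ μ.rowLen 0 ≤ m ∧ μ.card = N}

/-- The underlying set of `⨆_λ B^{gl_n}_λ ⊗ B^{gl_m}_{λ^tr}`. -/
def Howe (N n m : ℕ) : Type :=
  Σ μ : BoxPartition N n m, Tableau n μ.1 × Tableau m μ.1.transpose

/-- The `gl_n`-crystal structure on `⨆_λ B^{gl_n}_λ ⊗ B^{gl_m}_{λ^tr}` (on the first factors). -/
noncomputable def howeFst (N n m : ℕ) : CrystalData n (Howe N n m) where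
  wt x := (tabCrystal n x.1.1).wt x.2.1
  e i x := ((tabCrystal n x.1.1).e i x.2.1).map fun T => ⟨x.1, T, x.2.2⟩
  f i x := ((tabCrystal n x.1.1).f i x.2.1).map fun T => ⟨x.1, T, x.2.2⟩
  eps i x := (tabCrystal n x.1.1).eps i x.2.1
  phi i x := (tabCrystal n x.1.1).phi i x.2.1

/-- The `gl_m`-crystal structure on `⨆_λ B^{gl_n}_λ ⊗ B^{gl_m}_{λ^tr}` (on the second factors). -/
noncomputable def howeSnd (N n m : ℕ) : CrystalData m (Howe N n m) where
  wt x := (tabCrystal m x.1.1.transpose).wt x.2.2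
  e i x := ((tabCrystal m x.1.1.transpose).e i x.2.2).map fun T => ⟨x.1, x.2.1, T⟩
  f i x := ((tabCrystal m x.1.1.transpose).f i x.2.2).map fun T => ⟨x.1, x.2.1, T⟩
  eps i x := (tabCrystal m x.1.1.transpose).eps i x.2.2
  phi i x := (tabCrystal m x.1.1.transpose).phi i x.2.2

/-- The inner action on `⨆_λ B^{gl_n}_λ ⊗ B^{gl_m}_{λ^tr}`: `b ⊗ c ↦ ξ_{p,q}(b) ⊗ c`. -/
noncomputable def howeInner {N n m : ℕ} (p q : Fin n) (x : Howe N n m) : Howe N n m :=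
  ⟨x.1, partialXi (tabCrystal n x.1.1) p.1 q.1 x.2.1, x.2.2⟩

/-- `F` is crystal skew Howe duality: an isomorphism of `gl_n × gl_m`-crystals, sending `M` to the
pair of tableaux `(T_P, T_Q)`, where `P` is the `gl_m`-highest weight matrix reached from `M` by row
raising operators and `Q` the `gl_n`-lowest weight matrix reached by column lowering operators;
`a` lies in column `j` of `T_P` iff `P_{a,j} = 1`, and `a` lies in column `j` of `T_Q` iff
`Q_{n+1-j,a} = 1` (in 1-based numbering). -/
structure IsSkewHoweDuality {N n m : ℕ} (F : LambdaB N n m ≃ Howe N n m) : Prop where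
  iso_fst : IsCrystalIso (colCrystal N n m) (howeFst N n m) F
  iso_snd : IsCrystalIso (rowCrystal N n m) (howeSnd N n m) F
  exists_P : ∀ M, ∃ P, IsEMax (rowCrystal N n m) M P ∧
    ∀ (a : Fin n) (j : Fin m), P.1 a j = true ↔ (F M).2.1.InCol j.1 a.1
  exists_Q : ∀ M, ∃ Q, IsFMax (colCrystal N n m) M Q ∧
    ∀ (a : Fin m) (j : Fin n), Q.1 j.rev a = true ↔ (F M).2.2.InCol j.1 a.1

end GLCrystal

/-! For a node i, walk down the rows and add (entry in column i+1) − (entry in column i). The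
lowering operator moves a one in the row that follows the last maximum of this path, and the raising
operator undoes this at the first maximum. From this signature rule the row and the column operators
on 0/1-matrices commute (`lower_square`; the other sign combinations follow by quarter turns).

The second input is `bottomLeft`: a matrix that is highest for rows and lowest for columns is a
Young diagram pushed into the bottom left corner. It is therefore known from its row sums or from
its column sums, and each of these is invariant under one of the two structures. These two facts,
axiomatized in `DoubleCrystal`, give everything else about components. Each row component has a
single highest element hi M, each column component a single lowest element lo M, lo (hi M) = hi (lo
M), and M ↦ (hi M, lo M) is a bijection onto the pairs (P, Q) of a row-highest P and a column-lowest
Q with lo P = hi Q. Column operators change only the first coordinate, row operators only the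
second. Row-highest matrices are semistandard tableaux written column by column, and lo P = hi Q
says that the two shapes are transposed, so this bijection is skew Howe duality.

Rotation by 180 degrees reverses the arrows of both structures and fixes the corner lo (hi M)
(`loMat_hiMat_rot`). Hence some matrix `schutzMat M` has the hi of M and the lo of `rot M`; it is
the row involution of M. Then `schutzMat (rot M)` has the lo of M and the hi of `rot M`, and is the
column involution. On a single 0/1-vector ξ is reversal, so `rot M` is ξ(r_n) ⊗ ⋯ ⊗ ξ(r_1), and
`schutzMat (rot M)` is the outer map for the full range. For general p < q the same identity is
applied to the rows p, …, q, the only ones seen by the nodes p, …, q-1 of the column structure.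

The cactus relations are split between the two descriptions: involutivity and the nested relation
follow from uniqueness of Schützenberger involutions, while the disjoint relation is visible on the
outer maps. Uniqueness also carries the action through the Howe isomorphism. -/

namespace GLCrystal

variable {k : ℕ} {A B : Type*}

/-! ## Generalities on crystals -/

/-- Connected components for the nodes `p, …, q-1` contain at most one highest weight element. -/
def UniqueHighest (C : CrystalData k B) (p q : ℕ) : Prop :=
  ∀ b c, Connected C p q b c →
    (∀ i : Fin (k - 1), p ≤ i.1 → i.1 < q → C.e i b = none) →
    (∀ i : Fin (k - 1), p ≤ i.1 → i.1 < q → C.e i c = none) → b = c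

/-! ### Induction along the operators; uniqueness of Schützenberger involutions -/

/-- A linear statistic on weights that decreases by one along each simple root. -/
def wtStat (w : Fin k → ℤ) : ℤ := ∑ x : Fin k, (x.1 : ℤ) * w x

theorem wtStat_root (i : Fin (k - 1)) : wtStat (root i) = -1 := by
  simp [wtStat, root, mul_sub, Finset.sum_sub_distrib, Pi.single_apply, fstIdx, sndIdx]

theorem wtStat_add (v w : Fin k → ℤ) : wtStat (v + w) = wtStat v + wtStat w := by
  simp [wtStat, mul_add, Finset.sum_add_distrib]

theorem wtStat_sub (v w : Fin k → ℤ) : wtStat (v - w) = wtStat v - wtStat w := by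
  simp [wtStat, mul_sub, Finset.sum_sub_distrib]

theorem induction_of_stat [Finite B] (g : B → ℤ) {motive : B → Prop}
    (h : ∀ b, (∀ c, g c < g b → motive c) → motive b) (b : B) : motive b := by
  have hwf : WellFounded (InvImage (· < ·) g) := by
    have : IsTrans B (InvImage (· < ·) g) := ⟨fun _ _ _ h₁ h₂ => lt_trans h₁ h₂⟩
    have : Std.Irrefl (InvImage (· < ·) g) := ⟨fun _ h => lt_irrefl _ h⟩
    exact Finite.wellFounded_of_trans_of_irrefl _
  exact hwf.induction b h

/-- Every raising operator lowers `wtStat` of the weight by one, and the crystal is finite, so the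
climb towards highest weight elements is well founded. -/
theorem IsCrystal.e_induction {C : CrystalData k B} (hC : IsCrystal C) {motive : B → Prop}
    (h : ∀ b, (∀ i c, C.e i b = some c → motive c) → motive b) (b : B) : motive b := by
  have := hC.finite
  refine induction_of_stat (fun b => wtStat (C.wt b)) (fun b ih => h b fun i c hc => ih c ?_) b
  simp only [hC.wt_e i b c hc, wtStat_add, wtStat_root]
  omega

theorem IsCrystal.f_induction {C : CrystalData k B} (hC : IsCrystal C) {motive : B → Prop}
    (h : ∀ b, (∀ i c, C.f i b = some c → motive c) → motive b) (b : B) : motive b := by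
  have := hC.finite
  refine induction_of_stat (fun b => -wtStat (C.wt b)) (fun b ih => h b fun i c hc => ih c ?_) b
  simp only [hC.wt_f i b c hc, wtStat_sub, wtStat_root]
  omega

/-- Induct down the lowering arrows. An element that is lowest for the subdiagram is sent to the
only highest element of its component. If f_j b = c, then raising ξ b by the reflected node gives ξ
c, so ξ b is recovered from ξ c. -/
theorem IsSchutzenberger.unique {C : CrystalData k B} {p q : ℕ} (hC : IsCrystal C)
    (hU : UniqueHighest C p q) (hq : q ≤ k - 1) {ξ ξ' : B → B} (h : IsSchutzenberger C p q ξ)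
    (h' : IsSchutzenberger C p q ξ') : ξ = ξ' := by
  funext b
  refine hC.f_induction (motive := fun b => ξ b = ξ' b) (fun b ih => ?_) b
  by_cases hb : ∀ j : Fin (k - 1), p ≤ j.1 → j.1 < q → C.f j b = none
  · refine hU _ _ (.trans _ _ _ (.symm _ _ (h.connected b)) (h'.connected b)) ?_ ?_
    all_goals
      intro i hi₁ hi₂
      have hj : C.f ⟨p + q - 1 - i.1, by omega⟩ b = none := hb _ (by simp; omega) (by simp; omega)
    · rw [h.e_comm i ⟨p + q - 1 - i.1, by omega⟩ hi₁ hi₂ (by simp; omega), hj]; rfl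
    · rw [h'.e_comm i ⟨p + q - 1 - i.1, by omega⟩ hi₁ hi₂ (by simp; omega), hj]; rfl
  · push Not at hb
    obtain ⟨j, hj₁, hj₂, hj⟩ := hb
    obtain ⟨c, hc⟩ := Option.ne_none_iff_exists'.1 hj
    have hi₁ : p ≤ (⟨p + q - 1 - j.1, by omega⟩ : Fin (k - 1)).1 := by simp; omega
    have hi₂ : (⟨p + q - 1 - j.1, by omega⟩ : Fin (k - 1)).1 < q := by simp; omega
    have e₁ := h.e_comm _ j hi₁ hi₂ (by simp; omega) b
    have e₂ := h'.e_comm _ j hi₁ hi₂ (by simp; omega) b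
    rw [hc, Option.map_some] at e₁ e₂
    rw [← hC.f_iff_e] at e₁ e₂
    rw [ih j c hc] at e₁
    exact Option.some_injective _ (e₁.symm.trans e₂)

/-- Rigidity: such a map fixes the highest elements, since they are unique in their components, and
every other element is reached from a fixed one by a lowering operator. -/
theorem eq_self_of_commute {C : CrystalData k B} {p q : ℕ} (hC : IsCrystal C)
    (hU : UniqueHighest C p q) {g : B → B} (hg : ∀ b, Connected C p q b (g b))
    (he : ∀ i : Fin (k - 1), p ≤ i.1 → i.1 < q → ∀ b, C.e i (g b) = (C.e i b).map g) (b : B) :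
    g b = b := by
  refine hC.e_induction (motive := fun b => g b = b) (fun b ih => ?_) b
  by_cases hb : ∀ j : Fin (k - 1), p ≤ j.1 → j.1 < q → C.e j b = none
  · refine hU _ _ (.symm _ _ (hg b)) (fun i hi₁ hi₂ => ?_) hb
    rw [he i hi₁ hi₂, hb i hi₁ hi₂]; rfl
  · push Not at hb
    obtain ⟨j, hj₁, hj₂, hj⟩ := hb
    obtain ⟨c, hc⟩ := Option.ne_none_iff_exists'.1 hj
    have e₁ := he j hj₁ hj₂ b
    rw [hc, Option.map_some, ih j c hc, ← hC.f_iff_e] at e₁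
    rw [← hC.f_iff_e] at hc
    exact Option.some_injective _ (e₁.symm.trans hc)

/-- Applying ξ twice exchanges raising and lowering twice, so ξ ∘ ξ commutes with the raising
operators and rigidity applies. -/
theorem IsSchutzenberger.involutive {C : CrystalData k B} {p q : ℕ} (hC : IsCrystal C)
    (hU : UniqueHighest C p q) (hq : q ≤ k - 1) {ξ : B → B} (h : IsSchutzenberger C p q ξ) (b : B) :
    ξ (ξ b) = b := by
  refine eq_self_of_commute (g := fun b => ξ (ξ b)) hC hU
    (fun b => .trans _ _ _ (h.connected b) (h.connected _)) (fun i hi₁ hi₂ b => ?_) b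
  have hj : p + q - 1 - i.1 < k - 1 := by omega
  rw [h.e_comm i ⟨p + q - 1 - i.1, hj⟩ hi₁ hi₂ (by simp; omega),
    h.f_comm ⟨p + q - 1 - i.1, hj⟩ i (by simp; omega) (by simp; omega) (by simp; omega),
    Option.map_map]
  rfl

theorem partialXi_eq {C : CrystalData k B} {p q : ℕ} (hC : IsCrystal C)
    (hU : UniqueHighest C p q) (hq : q ≤ k - 1) {ξ : B → B} (h : IsSchutzenberger C p q ξ) :
    partialXi C p q = ξ := by
  have hex : ∃ ξ, IsSchutzenberger C p q ξ := ⟨ξ, h⟩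
  rw [partialXi, dif_pos hex]
  exact hex.choose_spec.unique hC hU hq h

theorem existsUnique_schutzenberger {C : CrystalData k B} {p q : ℕ} (hC : IsCrystal C)
    (hU : UniqueHighest C p q) (hq : q ≤ k - 1) (h : ∃ ξ, IsSchutzenberger C p q ξ) :
    ∃! ξ, IsSchutzenberger C p q ξ := by
  obtain ⟨ξ, hξ⟩ := h
  exact ⟨ξ, hξ, fun ξ' h' => h'.unique hC hU hq hξ⟩

/-- The involution of a diagram conjugates the involution of a subdiagram to the involution of the
reflected subdiagram. -/
theorem IsSchutzenberger.conj {C : CrystalData k B} {p q p' q' p'' q'' : ℕ} (hC : IsCrystal C)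
    (hU : UniqueHighest C p q) (hq : q ≤ k - 1) {ξ η : B → B} (h : IsSchutzenberger C p q ξ)
    (h' : IsSchutzenberger C p' q' η) (h₁ : p ≤ p') (h₂ : q' ≤ q)
    (h₃ : p' + q'' = p + q) (h₄ : q' + p'' = p + q) (h₅ : p' ≤ q') :
    IsSchutzenberger C p'' q'' (fun b => ξ (η (ξ b))) := by
  have hinv := h.involutive hC hU hq
  -- An arrow for a node of the subdiagram becomes, under ξ, a reversed arrow for the reflected
  -- node, so components go to components.
  have key : ∀ x y, Connected C p' q' x y → Connected C p'' q'' (ξ x) (ξ y) := by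
    intro x y hxy
    induction hxy with
    | refl x => exact .refl _
    | symm x y _ ih => exact ih.symm
    | trans x y z _ _ ih₁ ih₂ => exact ih₁.trans _ _ _ ih₂
    | rel x y hxy =>
      obtain ⟨i, hi₁, hi₂, hi⟩ := hxy
      refine .symm _ _ (.rel _ _ ⟨⟨p + q - 1 - i.1, by omega⟩, by simp; omega, by simp; omega, ?_⟩)
      rw [hC.f_iff_e, h.e_comm _ i (by simp; omega) (by simp; omega) (by simp; omega), hi]
      rfl
  constructor
  · intro b
    have := key _ _ (h'.connected (ξ b))
    rwa [hinv] at this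
  · intro i j hi₁ hi₂ hij b
    rw [h.e_comm i ⟨p + q - 1 - i.1, by omega⟩ (by omega) (by omega) (by simp; omega),
      h'.f_comm _ ⟨p + q - 1 - j.1, by omega⟩ (by simp; omega) (by simp; omega) (by simp; omega),
      h.e_comm _ j (by simp; omega) (by simp; omega) (by simp; omega)]
    simp [Option.map_map, Function.comp_def]
  · intro i j hi₁ hi₂ hij b
    rw [h.f_comm i ⟨p + q - 1 - i.1, by omega⟩ (by omega) (by omega) (by simp; omega),
      h'.e_comm _ ⟨p + q - 1 - j.1, by omega⟩ (by simp; omega) (by simp; omega) (by simp; omega),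
      h.f_comm _ j (by simp; omega) (by simp; omega) (by simp; omega)]
    simp [Option.map_map, Function.comp_def]
  · intro x y hx₁ hx₂ hxy b
    rw [h.wt_inside x ⟨p + q - x.1, by omega⟩ (by omega) (by omega) (by simp; omega),
      h'.wt_inside _ ⟨p + q - y.1, by omega⟩ (by simp; omega) (by simp; omega) (by simp; omega),
      h.wt_inside _ y (by simp; omega) (by simp; omega) (by simp; omega)]
  · intro x hx b
    -- Inside the large interval the two outer reversals cancel because the inner map does not touch
    -- the reflected coordinate; outside it all three maps leave the coordinate alone.
    by_cases hx' : p ≤ x.1 ∧ x.1 ≤ q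
    · rw [h.wt_inside x ⟨p + q - x.1, by omega⟩ (by omega) (by omega) (by simp; omega),
        h'.wt_outside _ (by simp; omega),
        h.wt_inside _ x (by simp; omega) (by simp; omega) (by simp; omega)]
    · rw [h.wt_outside x (by omega), h'.wt_outside x (by omega), h.wt_outside x (by omega)]

/-! ### String lengths -/

theorem iterate_bind_none (g : B → Option B) (j : ℕ) :
    (fun x : Option B => x.bind g)^[j] none = none := by
  induction j with
  | zero => rfl
  | succ j ih => rw [Function.iterate_succ_apply]; exact ih

/-- A nonnegative statistic that is zero where `g` is undefined and drops by one at each step counts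
the remaining steps. This is how the axioms `eps_max` and `phi_max` are checked. -/
theorem iterate_bind_ne_none_iff (g : B → Option B) (ε : B → ℤ) (h₀ : ∀ b, 0 ≤ ε b)
    (hn : ∀ b, g b = none → ε b = 0) (hs : ∀ b c, g b = some c → ε c = ε b - 1) (j : ℕ) (b : B) :
    (fun x : Option B => x.bind g)^[j] (some b) ≠ none ↔ (j : ℤ) ≤ ε b := by
  induction j generalizing b with
  | zero => simpa using h₀ b
  | succ j ih =>
    rw [Function.iterate_succ_apply]
    rcases hg : g b with _ | c
    · have := hn b hg
      simp only [Option.bind_some, hg, iterate_bind_none, ne_eq, not_true_eq_false, false_iff]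
      push_cast; omega
    · have := hs b c hg
      simp only [Option.bind_some, hg]
      rw [ih c]
      push_cast; omega

theorem isGreatest_iterate (g : B → Option B) (ε : B → ℤ) (h₀ : ∀ b, 0 ≤ ε b)
    (hn : ∀ b, g b = none → ε b = 0) (hs : ∀ b c, g b = some c → ε c = ε b - 1) (b : B) :
    IsGreatest {z : ℤ | ∃ j : ℕ, z = j ∧ (fun x : Option B => x.bind g)^[j] (some b) ≠ none}
      (ε b) := by
  constructor
  · refine ⟨(ε b).toNat, ?_, ?_⟩
    · have := h₀ b; omega
    · rw [iterate_bind_ne_none_iff g ε h₀ hn hs]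
      have := h₀ b; omega
  · rintro z ⟨j, rfl, hj⟩
    exact (iterate_bind_ne_none_iff g ε h₀ hn hs j b).1 hj

theorem iterate_bind_map {g : A → Option A} {g' : B → Option B} {r : A → B}
    (h : ∀ a, g' (r a) = (g a).map r) (j : ℕ) (a : A) :
    (fun x : Option B => x.bind g')^[j] (some (r a)) =
      ((fun x : Option A => x.bind g)^[j] (some a)).map r := by
  induction j generalizing a with
  | zero => rfl
  | succ j ih =>
    rw [Function.iterate_succ_apply, Function.iterate_succ_apply]
    rcases hg : g a with _ | c
    · simp [h, hg, iterate_bind_none]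
    · simp only [Option.bind_some, h, hg, Option.map_some]
      exact ih c

theorem iterate_bind_map_ne_none_iff {g : A → Option A} {g' : B → Option B} {r : A → B}
    (h : ∀ a, g' (r a) = (g a).map r) (j : ℕ) (a : A) :
    (fun x : Option B => x.bind g')^[j] (some (r a)) ≠ none ↔
      (fun x : Option A => x.bind g)^[j] (some a) ≠ none := by
  rw [iterate_bind_map h]; simp

/-! ### Isomorphisms -/

/-- In a crystal the lowering operators are the partial inverses of the raising ones, and ε, φ are
string lengths, so only the weight and the raising operators have to be compared. -/
theorem isCrystalIso_of_e {C : CrystalData k A} {D : CrystalData k B} (hC : IsCrystal C)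
    (hD : IsCrystal D) {F : A ≃ B} (hwt : ∀ a, D.wt (F a) = C.wt a)
    (he : ∀ i a, D.e i (F a) = (C.e i a).map F) : IsCrystalIso C D F := by
  have hf : ∀ i a, D.f i (F a) = (C.f i a).map F := by
    intro i a
    ext y
    obtain ⟨c, rfl⟩ := F.surjective y
    rw [hD.f_iff_e, he, Option.map_eq_some_iff, Option.map_eq_some_iff]
    simp only [EmbeddingLike.apply_eq_iff_eq, exists_eq_right, hC.f_iff_e]
  refine ⟨hwt, fun i a => ?_, fun i a => ?_, he, hf⟩
  · have h₁ := hD.eps_max i (F a)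
    simp only [iterate_bind_map_ne_none_iff (he i)] at h₁
    exact h₁.unique (hC.eps_max i a)
  · have h₁ := hD.phi_max i (F a)
    simp only [iterate_bind_map_ne_none_iff (hf i)] at h₁
    exact h₁.unique (hC.phi_max i a)

theorem IsSchutzenberger.of_iso {C : CrystalData k A} {D : CrystalData k B} {F : A ≃ B}
    (hF : IsCrystalIso C D F) {p q : ℕ} {ξ : B → B} (h : IsSchutzenberger D p q ξ) :
    IsSchutzenberger C p q (fun a => F.symm (ξ (F a))) := by
  have hcon : ∀ x y, Connected D p q x y → Connected C p q (F.symm x) (F.symm y) := by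
    intro x y hxy
    induction hxy with
    | refl x => exact .refl _
    | symm x y _ ih => exact ih.symm
    | trans x y z _ _ ih₁ ih₂ => exact ih₁.trans _ _ _ ih₂
    | rel x y hxy =>
      obtain ⟨i, hi₁, hi₂, hi⟩ := hxy
      refine .rel _ _ ⟨i, hi₁, hi₂, ?_⟩
      obtain ⟨a, rfl⟩ := F.surjective x
      obtain ⟨c, rfl⟩ := F.surjective y
      rw [hF.f, Option.map_eq_some_iff] at hi
      obtain ⟨c', h₁, h₂⟩ := hi
      rw [F.symm_apply_apply, F.symm_apply_apply, h₁, F.injective h₂]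
  have hinj : Function.Injective (Option.map F) := Option.map_injective F.injective
  constructor
  · intro b
    simpa using hcon _ _ (h.connected (F b))
  · intro i j hi₁ hi₂ hij b
    apply hinj
    rw [← hF.e, F.apply_symm_apply, h.e_comm i j hi₁ hi₂ hij, hF.f]
    simp [Option.map_map, Function.comp_def]
  · intro i j hi₁ hi₂ hij b
    apply hinj
    rw [← hF.f, F.apply_symm_apply, h.f_comm i j hi₁ hi₂ hij, hF.e]
    simp [Option.map_map, Function.comp_def]
  · intro x y hx₁ hx₂ hxy b
    rw [← hF.wt, F.apply_symm_apply, h.wt_inside x y hx₁ hx₂ hxy, hF.wt]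
  · intro x hx b
    rw [← hF.wt, F.apply_symm_apply, h.wt_outside x hx, hF.wt]

/-! ### Subcrystals -/

theorem pullback_e_iff (C : CrystalData k B) {r : A → B} (hr : Function.Injective r)
    (i : Fin (k - 1)) (a a' : A) :
    (pullback C r).e i a = some a' ↔ C.e i (r a) = some (r a') := by
  simp only [pullback, Option.bind_eq_some_iff]
  constructor
  · rintro ⟨x, hx, h⟩
    split_ifs at h with hex
    cases h
    rw [hex.choose_spec]; exact hx
  · intro h
    have hex : ∃ a'', r a'' = r a' := ⟨a', rfl⟩
    exact ⟨r a', h, by rw [dif_pos hex, hr hex.choose_spec]⟩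

theorem pullback_f_iff (C : CrystalData k B) {r : A → B} (hr : Function.Injective r)
    (i : Fin (k - 1)) (a a' : A) :
    (pullback C r).f i a = some a' ↔ C.f i (r a) = some (r a') := by
  simp only [pullback, Option.bind_eq_some_iff]
  constructor
  · rintro ⟨x, hx, h⟩
    split_ifs at h with hex
    cases h
    rw [hex.choose_spec]; exact hx
  · intro h
    have hex : ∃ a'', r a'' = r a' := ⟨a', rfl⟩
    exact ⟨r a', h, by rw [dif_pos hex, hr hex.choose_spec]⟩

/-- The image of `r` is stable under the Kashiwara operators. -/
structure IsStable (C : CrystalData k B) (r : A → B) : Prop where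
  inj : Function.Injective r
  e_mem : ∀ i a x, C.e i (r a) = some x → ∃ a', r a' = x
  f_mem : ∀ i a x, C.f i (r a) = some x → ∃ a', r a' = x

namespace IsStable

variable {C : CrystalData k B} {r : A → B}

theorem map_e (h : IsStable C r) (i : Fin (k - 1)) (a : A) :
    C.e i (r a) = ((pullback C r).e i a).map r := by
  ext x
  rw [Option.map_eq_some_iff]
  constructor
  · intro hx
    obtain ⟨a', rfl⟩ := h.e_mem i a x hx
    exact ⟨a', (pullback_e_iff C h.inj i a a').2 hx, rfl⟩
  · rintro ⟨a', ha', rfl⟩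
    exact (pullback_e_iff C h.inj i a a').1 ha'

theorem map_f (h : IsStable C r) (i : Fin (k - 1)) (a : A) :
    C.f i (r a) = ((pullback C r).f i a).map r := by
  ext x
  rw [Option.map_eq_some_iff]
  constructor
  · intro hx
    obtain ⟨a', rfl⟩ := h.f_mem i a x hx
    exact ⟨a', (pullback_f_iff C h.inj i a a').2 hx, rfl⟩
  · rintro ⟨a', ha', rfl⟩
    exact (pullback_f_iff C h.inj i a a').1 ha'

theorem isCrystal (h : IsStable C r) (hC : IsCrystal C) : IsCrystal (pullback C r) := by
  have := hC.finite
  constructor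
  · exact Finite.of_injective r h.inj
  · intro i b c
    rw [pullback_e_iff C h.inj, pullback_f_iff C h.inj, hC.f_iff_e]
  · intro i b c hc
    exact hC.wt_e i _ _ ((pullback_e_iff C h.inj _ _ _).1 hc)
  · intro i b c hc
    exact hC.wt_f i _ _ ((pullback_f_iff C h.inj _ _ _).1 hc)
  · intro i b
    have := hC.eps_max i (r b)
    simp only [iterate_bind_map_ne_none_iff (h.map_e i)] at this
    exact this
  · intro i b
    have := hC.phi_max i (r b)
    simp only [iterate_bind_map_ne_none_iff (h.map_f i)] at this
    exact this
  · intro i b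
    exact hC.phi_sub_eps i (r b)

theorem connected_map (h : IsStable C r) {p q : ℕ} {a a' : A}
    (hc : Connected (pullback C r) p q a a') : Connected C p q (r a) (r a') := by
  induction hc with
  | refl x => exact .refl _
  | symm x y _ ih => exact ih.symm
  | trans x y z _ _ ih₁ ih₂ => exact ih₁.trans _ _ _ ih₂
  | rel x y hxy =>
    obtain ⟨i, hi₁, hi₂, hi⟩ := hxy
    exact .rel _ _ ⟨i, hi₁, hi₂, (pullback_f_iff C h.inj _ _ _).1 hi⟩

/-- A stable image is a union of connected components, so a path that starts in it lifts. Both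
directions are carried through the induction because the symmetry case exchanges them. -/
theorem connected_lift (h : IsStable C r) (hC : IsCrystal C) {p q : ℕ} {x y : B}
    (hc : Connected C p q x y) :
    (∀ a, r a = x → ∃ a', r a' = y ∧ Connected (pullback C r) p q a a') ∧
    (∀ a, r a = y → ∃ a', r a' = x ∧ Connected (pullback C r) p q a a') := by
  induction hc with
  | refl x => exact ⟨fun a ha => ⟨a, ha, .refl _⟩, fun a ha => ⟨a, ha, .refl _⟩⟩
  | symm x y _ ih => exact ih.symm
  | trans x y z _ _ ih₁ ih₂ =>
    constructor
    · intro a ha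
      obtain ⟨a', ha', h₁⟩ := ih₁.1 a ha
      obtain ⟨a'', ha'', h₂⟩ := ih₂.1 a' ha'
      exact ⟨a'', ha'', h₁.trans _ _ _ h₂⟩
    · intro a ha
      obtain ⟨a', ha', h₁⟩ := ih₂.2 a ha
      obtain ⟨a'', ha'', h₂⟩ := ih₁.2 a' ha'
      exact ⟨a'', ha'', h₁.trans _ _ _ h₂⟩
  | rel x y hxy =>
    obtain ⟨i, hi₁, hi₂, hi⟩ := hxy
    constructor
    · rintro a rfl
      obtain ⟨a', rfl⟩ := h.f_mem i a y hi
      exact ⟨a', rfl, .rel _ _ ⟨i, hi₁, hi₂, (pullback_f_iff C h.inj _ _ _).2 hi⟩⟩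
    · rintro a rfl
      obtain ⟨a', rfl⟩ := h.e_mem i a x ((hC.f_iff_e _ _ _).1 hi)
      exact ⟨a', rfl, .symm _ _ (.rel _ _ ⟨i, hi₁, hi₂, (pullback_f_iff C h.inj _ _ _).2 hi⟩)⟩

theorem uniqueHighest (h : IsStable C r) {p q : ℕ} (hU : UniqueHighest C p q) :
    UniqueHighest (pullback C r) p q := by
  intro b c hbc hb hc
  refine h.inj (hU _ _ (h.connected_map hbc) (fun i hi₁ hi₂ => ?_) (fun i hi₁ hi₂ => ?_))
  · rw [h.map_e, hb i hi₁ hi₂]; rfl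
  · rw [h.map_e, hc i hi₁ hi₂]; rfl

theorem isSchutzenberger (h : IsStable C r) (hC : IsCrystal C) {p q : ℕ} {Ξ : B → B}
    (hΞ : IsSchutzenberger C p q Ξ) {ξ : A → A} (hξ : ∀ a, r (ξ a) = Ξ (r a)) :
    IsSchutzenberger (pullback C r) p q ξ := by
  have hinj : Function.Injective (Option.map r) := Option.map_injective h.inj
  constructor
  · intro b
    obtain ⟨a', ha', hc⟩ := (h.connected_lift hC (hΞ.connected (r b))).1 b rfl
    rwa [h.inj (ha'.trans (hξ b).symm)] at hc
  · intro i j hi₁ hi₂ hij b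
    apply hinj
    rw [← h.map_e, hξ, hΞ.e_comm i j hi₁ hi₂ hij, h.map_f, Option.map_map, Option.map_map]
    congr 1; funext a; exact (hξ a).symm
  · intro i j hi₁ hi₂ hij b
    apply hinj
    rw [← h.map_f, hξ, hΞ.f_comm i j hi₁ hi₂ hij, h.map_e, Option.map_map, Option.map_map]
    congr 1; funext a; exact (hξ a).symm
  · intro x y hx₁ hx₂ hxy b
    change C.wt (r (ξ b)) x = C.wt (r b) y
    rw [hξ, hΞ.wt_inside x y hx₁ hx₂ hxy]
  · intro x hx b
    change C.wt (r (ξ b)) x = C.wt (r b) x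
    rw [hξ, hΞ.wt_outside x hx]

/-- An involution that preserves components restricts to any union of components. -/
theorem exists_schutzenberger (h : IsStable C r) (hC : IsCrystal C) {p q : ℕ} {Ξ : B → B}
    (hΞ : IsSchutzenberger C p q Ξ) :
    ∃ ξ : A → A, (∀ a, r (ξ a) = Ξ (r a)) ∧ IsSchutzenberger (pullback C r) p q ξ := by
  have : ∀ a, ∃ a', r a' = Ξ (r a) := fun a => by
    obtain ⟨a', ha', _⟩ := (h.connected_lift hC (hΞ.connected (r a))).1 a rfl
    exact ⟨a', ha'⟩
  choose ξ hξ using this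
  exact ⟨ξ, hξ, h.isSchutzenberger hC hΞ hξ⟩

end IsStable

end GLCrystal

namespace GLCrystal

/-! ## Signature rule for tensor powers of the crystal of 0/1-vectors -/

/-- Elements of the tensor power `V_k^{⊗ d}`, i.e. 0/1-matrices with `d` rows and `k` columns. -/
abbrev Mat (d k : ℕ) : Type := Fin d → Fin k → Bool

variable {d k : ℕ}

/-- The integer `0` or `1` of a matrix entry. -/
def bz (b : Bool) : ℤ := if b then 1 else 0

@[simp] theorem bz_true : bz true = 1 := rfl

@[simp] theorem bz_false : bz false = 0 := rfl

theorem bz_nonneg (b : Bool) : 0 ≤ bz b := by cases b <;> simp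

theorem bz_le_one (b : Bool) : bz b ≤ 1 := by cases b <;> simp

/-- The number of ones in column `x` in the first `t` rows. -/
def cnt (b : Mat d k) (x : Fin k) (t : ℕ) : ℤ := ∑ s : Fin d with s.1 < t, bz (b s x)

theorem cnt_zero (b : Mat d k) (x : Fin k) : cnt b x 0 = 0 := by simp [cnt]

theorem cnt_succ (b : Mat d k) (x : Fin k) (s : Fin d) :
    cnt b x (s.1 + 1) = cnt b x s.1 + bz (b s x) := by
  have : (Finset.univ.filter fun r : Fin d => r.1 < s.1 + 1) =
      insert s (Finset.univ.filter fun r : Fin d => r.1 < s.1) := by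
    ext r; simp [Fin.ext_iff]; omega
  rw [cnt, this, Finset.sum_insert (by simp), add_comm]; rfl

theorem cnt_eq_sum (b : Mat d k) (x : Fin k) : cnt b x d = ∑ s, bz (b s x) := by simp [cnt]

theorem cnt_congr {b b' : Mat d k} {x : Fin k} {t : ℕ} (h : ∀ s : Fin d, s.1 < t → b s x = b' s x) :
    cnt b x t = cnt b' x t := by
  refine Finset.sum_congr rfl fun s hs => ?_
  rw [h s (by simpa using hs)]

theorem cnt_of_eq_off {b b' : Mat d k} {s : Fin d} (h : ∀ r, r ≠ s → b' r = b r) (x : Fin k)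
    (t : ℕ) : cnt b' x t = cnt b x t + if s.1 < t then bz (b' s x) - bz (b s x) else 0 := by
  rw [← sub_eq_iff_eq_add', cnt, cnt, ← Finset.sum_sub_distrib, Finset.sum_filter,
    Finset.sum_eq_single s]
  · intro r _ hr
    rw [h r hr]; simp
  · simp

/-- The height function whose argmax positions determine the operators `e_i` and `f_i`. -/
def ht (b : Mat d k) (i : Fin (k - 1)) (t : ℕ) : ℤ := cnt b (sndIdx i) t - cnt b (fstIdx i) t

theorem ht_zero (b : Mat d k) (i : Fin (k - 1)) : ht b i 0 = 0 := by simp [ht, cnt_zero]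

theorem ht_succ (b : Mat d k) (i : Fin (k - 1)) (s : Fin d) :
    ht b i (s.1 + 1) = ht b i s.1 + bz (b s (sndIdx i)) - bz (b s (fstIdx i)) := by
  simp only [ht, cnt_succ]; ring

theorem fstIdx_ne_sndIdx (i : Fin (k - 1)) : fstIdx i ≠ sndIdx i := by
  simp [fstIdx, sndIdx, Fin.ext_iff]

/-- Row `s` with its one moved from column `i` to column `i+1`. -/
def moveAt (i : Fin (k - 1)) (s : Fin d) (b : Mat d k) : Mat d k :=
  Function.update b s (Function.update (Function.update (b s) (fstIdx i) false) (sndIdx i) true)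

theorem moveAt_apply (i : Fin (k - 1)) (s : Fin d) (b : Mat d k) (r : Fin d) (x : Fin k) :
    moveAt i s b r x = if r = s then
      (if x = sndIdx i then true else if x = fstIdx i then false else b r x) else b r x := by
  by_cases h : r = s
  · subst h; simp [moveAt, Function.update_apply]
  · simp [moveAt, h]

theorem moveAt_of_ne (i : Fin (k - 1)) {s r : Fin d} (h : r ≠ s) (b : Mat d k) :
    moveAt i s b r = b r := by simp [moveAt, h]

/-! ### Lowering as a move at the last maximum of the height path -/

/-- The lowering operator `f_i` acts on the first matrix in row `s`; the second is the result. -/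
structure LowerAt (i : Fin (k - 1)) (s : Fin d) (b b' : Mat d k) : Prop where
  fst_eq : b s (fstIdx i) = true
  snd_eq : b s (sndIdx i) = false
  eq_move : b' = moveAt i s b
  le : ∀ t, t ≤ s.1 → ht b i t ≤ ht b i s.1
  lt : ∀ t, s.1 < t → t ≤ d → ht b i t < ht b i s.1

/-- The lowering operator `f_i` sends the first matrix to the second. -/
def Lower (i : Fin (k - 1)) (b b' : Mat d k) : Prop := ∃ s, LowerAt i s b b'

/-- The step of row s changes from −1 to +1, which lifts every later height by 2. Hence a last
maximum at s before the move turns into a first maximum at s + 1 after it, the key to inverting the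
operator. -/
theorem ht_moveAt {i : Fin (k - 1)} {s : Fin d} {b : Mat d k} (h₁ : b s (fstIdx i) = true)
    (h₂ : b s (sndIdx i) = false) (t : ℕ) :
    ht (moveAt i s b) i t = ht b i t + if s.1 < t then 2 else 0 := by
  have hne := fstIdx_ne_sndIdx i
  simp only [ht, cnt_of_eq_off (fun r hr => moveAt_of_ne i hr b), moveAt_apply, h₁, h₂]
  split_ifs <;> simp_all; ring

theorem Lower.unique_right {i : Fin (k - 1)} {b b' b'' : Mat d k} (h : Lower i b b')
    (h' : Lower i b b'') : b' = b'' := by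
  obtain ⟨s, h⟩ := h
  obtain ⟨s', h'⟩ := h'
  have : s = s' := by
    rcases lt_trichotomy s.1 s'.1 with hs | hs | hs
    · exact absurd (h.lt _ hs s'.2.le) (not_lt.2 (h'.le _ hs.le))
    · exact Fin.ext hs
    · exact absurd (h'.lt _ hs s.2.le) (not_lt.2 (h.le _ hs.le))
  subst this
  rw [h.eq_move, h'.eq_move]

namespace LowerAt

variable {i : Fin (k - 1)} {s : Fin d} {b b' : Mat d k}

theorem ht_right (h : LowerAt i s b b') (t : ℕ) :
    ht b' i t = ht b i t + if s.1 < t then 2 else 0 := by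
  rw [h.eq_move, ht_moveAt h.fst_eq h.snd_eq]

theorem ht_succ_left (h : LowerAt i s b b') : ht b i (s.1 + 1) = ht b i s.1 - 1 := by
  rw [ht_succ, h.fst_eq, h.snd_eq]; simp

theorem ht_succ_right (h : LowerAt i s b b') : ht b' i (s.1 + 1) = ht b i s.1 + 1 := by
  rw [h.ht_right, h.ht_succ_left]; simp; ring

theorem right_le (h : LowerAt i s b b') (t : ℕ) (ht' : t ≤ d) :
    ht b' i t ≤ ht b' i (s.1 + 1) := by
  rw [h.ht_succ_right, h.ht_right]
  split_ifs with hs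
  · have := h.lt t hs ht'; omega
  · have := h.le t (by omega); omega

theorem right_lt (h : LowerAt i s b b') (t : ℕ) (ht' : t ≤ s.1) :
    ht b' i t < ht b' i (s.1 + 1) := by
  rw [h.ht_succ_right, h.ht_right, if_neg (by omega)]
  have := h.le t (by omega); omega

theorem right_fst (h : LowerAt i s b b') : b' s (fstIdx i) = false := by
  rw [h.eq_move, moveAt_apply]; simp [fstIdx_ne_sndIdx]

theorem right_snd (h : LowerAt i s b b') : b' s (sndIdx i) = true := by
  rw [h.eq_move, moveAt_apply]; simp

theorem right_of_ne (h : LowerAt i s b b') {r : Fin d} (hr : r ≠ s) : b' r = b r := by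
  rw [h.eq_move, moveAt_of_ne i hr]

theorem right_of_ne_of_ne (h : LowerAt i s b b') {x : Fin k} (h₁ : x ≠ fstIdx i)
    (h₂ : x ≠ sndIdx i) (r : Fin d) : b' r x = b r x := by
  rw [h.eq_move, moveAt_apply]; simp [h₁, h₂]

theorem left_eq (h : LowerAt i s b b') : b = Function.update b' s
    (Function.update (Function.update (b' s) (fstIdx i) true) (sndIdx i) false) := by
  have hne := fstIdx_ne_sndIdx i
  funext r
  by_cases hr : r = s
  · subst hr
    funext x
    rw [h.eq_move]
    by_cases h₁ : x = sndIdx i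
    · subst h₁; simp [h.snd_eq]
    · by_cases h₂ : x = fstIdx i
      · subst h₂; simp [h.fst_eq, hne]
      · simp [h₁, h₂, moveAt_apply]
  · simp [hr, h.right_of_ne hr]

/-- Description of the lowering operator in terms of its result. -/
theorem of_right (h₁ : b' s (fstIdx i) = false) (h₂ : b' s (sndIdx i) = true)
    (hb : b = Function.update b' s
      (Function.update (Function.update (b' s) (fstIdx i) true) (sndIdx i) false))
    (hle : ∀ t, t ≤ d → ht b' i t ≤ ht b' i (s.1 + 1))
    (hlt : ∀ t, t ≤ s.1 → ht b' i t < ht b' i (s.1 + 1)) : LowerAt i s b b' := by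
  have hne := fstIdx_ne_sndIdx i
  have e₁ : b s (fstIdx i) = true := by rw [hb]; simp [hne]
  have e₂ : b s (sndIdx i) = false := by rw [hb]; simp
  have e₃ : b' = moveAt i s b := by
    funext r x
    rw [moveAt_apply, hb]
    by_cases hr : r = s
    · subst hr
      by_cases h₃ : x = sndIdx i
      · subst h₃; simp [h₂]
      · by_cases h₄ : x = fstIdx i
        · subst h₄; simp [h₁, hne]
        · simp [h₃, h₄]
    · simp [hr]
  have e₄ : ∀ t, ht b' i t = ht b i t + if s.1 < t then 2 else 0 := by
    intro t; rw [e₃, ht_moveAt e₁ e₂]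
  have e₅ := ht_succ b i s
  rw [e₁, e₂] at e₅
  simp only [bz_true, bz_false] at e₅
  have e₆ := e₄ (s.1 + 1)
  rw [if_pos (by omega)] at e₆
  refine ⟨e₁, e₂, e₃, fun t htt => ?_, fun t htt htd => ?_⟩
  · have := hlt t htt
    rw [e₄ t, if_neg (by omega)] at this; omega
  · have := hle t htd
    rw [e₄ t, if_pos htt] at this; omega

end LowerAt

/-- The row that was changed can be read off the result: the first maximum of its height path sits
right after that row. -/
theorem Lower.unique_left {i : Fin (k - 1)} {b b' b'' : Mat d k} (h : Lower i b b'')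
    (h' : Lower i b' b'') : b = b' := by
  obtain ⟨s, h⟩ := h
  obtain ⟨s', h'⟩ := h'
  have : s = s' := by
    rcases lt_trichotomy s.1 s'.1 with hs | hs | hs
    · exact absurd (h'.right_lt (s.1 + 1) hs) (not_lt.2 (h.right_le _ s'.2))
    · exact Fin.ext hs
    · exact absurd (h.right_lt (s'.1 + 1) hs) (not_lt.2 (h'.right_le _ s.2))
  subst this
  rw [h.left_eq, h'.left_eq]

/-! ### Comparison with the tensor power -/

theorem sum_wt_lt (b : Mat d k) (s : Fin d) (x : Fin k) :
    (∑ t with t < s, (vecCrystal k).wt (b t)) x = cnt b x s.1 := by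
  rw [Finset.sum_apply]; rfl

theorem sum_wt_gt (b : Mat d k) (s : Fin d) (x : Fin k) :
    (∑ t with s < t, (vecCrystal k).wt (b t)) x = cnt b x d - cnt b x (s.1 + 1) := by
  have h : (Finset.univ.filter fun r : Fin d => s < r) =
      Finset.univ \ (Finset.univ.filter fun r : Fin d => r.1 < s.1 + 1) := by
    ext r; simp
  rw [Finset.sum_apply, h, cnt_eq_sum, eq_sub_iff_add_eq]
  exact Finset.sum_sdiff (Finset.subset_univ _)

/-- Here ε of a single factor is 1 exactly when the step of that row goes up, so the statistic is
the larger of the heights at the two ends of the step. -/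
theorem tensorEpsAt_eq (i : Fin (k - 1)) (b : Mat d k) (s : Fin d) :
    tensorEpsAt (vecCrystal k) i b s = max (ht b i s.1) (ht b i (s.1 + 1)) := by
  rw [ht_succ]
  rw [tensorEpsAt, corootPairing, sum_wt_lt, sum_wt_lt]
  simp only [vecCrystal, ht]
  cases b s (fstIdx i) <;> cases b s (sndIdx i) <;> simp
  ring

theorem tensorPhiAt_eq (i : Fin (k - 1)) (b : Mat d k) (s : Fin d) :
    tensorPhiAt (vecCrystal k) i b s = max (ht b i s.1) (ht b i (s.1 + 1)) - ht b i d := by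
  have h := ht_succ b i s
  simp only [ht] at h
  rw [tensorPhiAt, corootPairing, sum_wt_gt, sum_wt_gt]
  simp only [vecCrystal, ht]
  cases h₁ : b s (fstIdx i) <;> cases h₂ : b s (sndIdx i) <;> simp [h₁, h₂] at h ⊢ <;> omega

theorem ht_le_tensorEps (i : Fin (k - 1)) (b : Mat d k) (t : ℕ) (h : t ≤ d) :
    ht b i t ≤ tensorEps (vecCrystal k) i b := by
  rw [tensorEps, Finset.le_fold_max]
  rcases t with _ | t
  · left; rw [ht_zero]
  · right
    refine ⟨⟨t, h⟩, Finset.mem_univ _, ?_⟩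
    rw [tensorEpsAt_eq]
    exact le_max_right _ _

theorem tensorEps_le {i : Fin (k - 1)} {b : Mat d k} {z : ℤ} (h : ∀ t ≤ d, ht b i t ≤ z) :
    tensorEps (vecCrystal k) i b ≤ z := by
  rw [tensorEps, Finset.fold_max_le]
  refine ⟨by simpa [ht_zero] using h 0 (Nat.zero_le _), fun s _ => ?_⟩
  rw [tensorEpsAt_eq]
  exact max_le (h _ s.2.le) (h _ s.2)

theorem tensorEps_eq {i : Fin (k - 1)} {b : Mat d k} {t : ℕ} (htd : t ≤ d)
    (h : ∀ t' ≤ d, ht b i t' ≤ ht b i t) : tensorEps (vecCrystal k) i b = ht b i t :=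
  le_antisymm (tensorEps_le h) (ht_le_tensorEps i b t htd)

theorem exists_ht_eq_tensorEps (i : Fin (k - 1)) (b : Mat d k) :
    ∃ t ≤ d, ht b i t = tensorEps (vecCrystal k) i b := by
  obtain ⟨t, ht₁, ht₂⟩ := Finset.exists_max_image (Finset.range (d + 1)) (ht b i) ⟨0, by simp⟩
  have htd : t ≤ d := by simpa [Nat.lt_succ_iff] using ht₁
  refine ⟨t, htd, (tensorEps_eq htd fun t' h => ht₂ t' ?_).symm⟩
  simpa [Nat.lt_succ_iff] using h

theorem tensorPhi_eq (i : Fin (k - 1)) (b : Mat d k) :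
    tensorPhi (vecCrystal k) i b = tensorEps (vecCrystal k) i b - ht b i d := by
  apply le_antisymm
  · rw [tensorPhi, Finset.fold_max_le]
    refine ⟨by have := ht_le_tensorEps i b d le_rfl; omega, fun s _ => ?_⟩
    rw [tensorPhiAt_eq]
    have h₁ := ht_le_tensorEps i b s.1 s.2.le
    have h₂ := ht_le_tensorEps i b (s.1 + 1) s.2
    omega
  · obtain ⟨t, htd, h⟩ := exists_ht_eq_tensorEps i b
    rw [tensorPhi, Finset.le_fold_max, ← h]
    rcases htd.eq_or_lt with rfl | htd
    · left; omega
    · right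
      refine ⟨⟨t, htd⟩, Finset.mem_univ _, ?_⟩
      rw [tensorPhiAt_eq]
      have := le_max_left (ht b i t) (ht b i (t + 1))
      simp only; omega

theorem find?_finRange_eq_some_iff (P : Fin d → Bool) (s : Fin d) :
    (List.finRange d).find? P = some s ↔ P s = true ∧ ∀ t < s, P t = false := by
  have hs := List.pairwise_lt_finRange d
  rw [List.find?_eq_some_iff_append]
  refine and_congr_right fun _ => ⟨?_, fun h => ?_⟩
  · rintro ⟨l₁, l₂, h, hl⟩ t hts
    have ht := List.mem_finRange t
    rw [h] at ht hs
    rw [List.pairwise_append, List.pairwise_cons] at hs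
    rcases List.mem_append.1 ht with h₁ | h₁
    · simpa using hl t h₁
    · rcases List.mem_cons.1 h₁ with rfl | h₁
      · exact absurd hts (lt_irrefl _)
      · exact absurd hts (not_lt.2 (hs.2.1.1 t h₁).le)
  · obtain ⟨l₁, l₂, hl⟩ := List.append_of_mem (List.mem_finRange s)
    refine ⟨l₁, l₂, hl, fun a ha => ?_⟩
    rw [hl, List.pairwise_append] at hs
    simp [h a (hs.2.2 a ha s (by simp))]

theorem find?_finRange_reverse_eq_some_iff (P : Fin d → Bool) (s : Fin d) :
    (List.finRange d).reverse.find? P = some s ↔ P s = true ∧ ∀ t, s < t → P t = false := by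
  have hs := List.pairwise_lt_finRange d
  rw [← List.pairwise_reverse] at hs
  rw [List.find?_eq_some_iff_append]
  refine and_congr_right fun _ => ⟨?_, fun h => ?_⟩
  · rintro ⟨l₁, l₂, h, hl⟩ t hts
    have ht := List.mem_reverse.2 (List.mem_finRange t)
    rw [h] at ht hs
    rw [List.pairwise_append, List.pairwise_cons] at hs
    rcases List.mem_append.1 ht with h₁ | h₁
    · simpa using hl t h₁
    · rcases List.mem_cons.1 h₁ with rfl | h₁
      · exact absurd hts (lt_irrefl _)
      · exact absurd hts (not_lt.2 (hs.2.1.1 t h₁).le)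
  · obtain ⟨l₁, l₂, hl⟩ := List.append_of_mem (List.mem_reverse.2 (List.mem_finRange s))
    refine ⟨l₁, l₂, hl, fun a ha => ?_⟩
    rw [hl, List.pairwise_append] at hs
    simp [h a (hs.2.2 a ha s (by simp))]

/-- The last factor whose step touches the maximal height begins at the last maximum and goes down,
unless the last maximum is at the very end `d`. In that case the step does not go down and the
factor has no lowering. -/
theorem tensorPow_f_iff (i : Fin (k - 1)) (b b' : Mat d k) :
    (tensorPow (vecCrystal k) d).f i b = some b' ↔ Lower i b b' := by
  simp only [tensorPow, Option.bind_eq_some_iff, find?_finRange_reverse_eq_some_iff,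
    decide_eq_true_eq, decide_eq_false_iff_not, tensorPhiAt_eq, tensorPhi_eq]
  constructor
  · rintro ⟨s, ⟨h₁, h₂⟩, h₃⟩
    simp only [vecCrystal] at h₃
    split_ifs at h₃ with hc
    · refine ⟨s, hc.1, hc.2, ?_, ?_, ?_⟩
      · simpa [moveAt] using h₃.symm
      all_goals
        have h₄ := ht_succ b i s
        rw [hc.1, hc.2] at h₄
        simp only [bz_true, bz_false] at h₄
        have h₅ : ht b i s.1 = tensorEps (vecCrystal k) i b := by omega
      · intro t hts
        rw [h₅]
        exact ht_le_tensorEps i b t (by omega)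
      · intro t hst htd
        rw [h₅]
        refine lt_of_le_of_ne (ht_le_tensorEps i b t htd) fun heq => ?_
        -- The step that ends at `t` touches the maximum and must lie after row s; `t = s + 1` is
        -- impossible, as the height there is one below the maximum.
        have h₆ := h₂ ⟨t - 1, by omega⟩ (by rw [Fin.lt_def]; simp only; by_contra hcon
                                            have : t = s.1 + 1 := by omega
                                            rw [this] at heq; omega)
        apply h₆
        have h₇ := ht_le_tensorEps i b (t - 1) (by omega)
        have h₈ : t - 1 + 1 = t := by omega
        simp only [h₈]; omega
    · simp at h₃
  · rintro ⟨s, h⟩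
    have h₀ : tensorEps (vecCrystal k) i b = ht b i s.1 := tensorEps_eq s.2.le fun t htd => by
      rcases le_or_gt t s.1 with hts | hts
      · exact h.le t hts
      · exact (h.lt t hts htd).le
    refine ⟨s, ⟨?_, fun t hst => ?_⟩, ?_⟩
    · rw [h₀, h.ht_succ_left]; omega
    · rw [h₀]
      have h₁ := h.lt t.1 hst t.2.le
      have h₂ := h.lt (t.1 + 1) (by have := Fin.lt_def.1 hst; omega) t.2
      omega
    · simp [vecCrystal, h.fst_eq, h.snd_eq, h.eq_move, moveAt]

/-- Mirror image of the lowering case: the first factor whose step touches the maximum must be the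
up step that ends at the first maximum. -/
theorem tensorPow_e_iff (i : Fin (k - 1)) (b b' : Mat d k) :
    (tensorPow (vecCrystal k) d).e i b = some b' ↔ Lower i b' b := by
  simp only [tensorPow, Option.bind_eq_some_iff, find?_finRange_eq_some_iff,
    decide_eq_true_eq, decide_eq_false_iff_not, tensorEpsAt_eq]
  constructor
  · rintro ⟨s, ⟨h₁, h₂⟩, h₃⟩
    simp only [vecCrystal] at h₃
    split_ifs at h₃ with hc
    · have h₄ := ht_succ b i s
      rw [hc.1, hc.2] at h₄
      simp only [bz_true, bz_false] at h₄
      have h₅ : ht b i (s.1 + 1) = tensorEps (vecCrystal k) i b := by omega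
      refine ⟨s, LowerAt.of_right hc.1 hc.2 (by simpa using h₃.symm) (fun t htd => ?_)
        (fun t hts => ?_)⟩
      · rw [h₅]
        exact ht_le_tensorEps i b t (by omega)
      · rw [h₅]
        refine lt_of_le_of_ne (ht_le_tensorEps i b t (by omega)) fun heq => ?_
        have hts' : t < s.1 := by
          by_contra hcon
          have : t = s.1 := by omega
          rw [this] at heq; omega
        apply h₂ ⟨t, by omega⟩ hts'
        have h₇ := ht_le_tensorEps i b (t + 1) (by omega)
        simp only; omega
    · simp at h₃
  · rintro ⟨s, h⟩
    have h₀ : tensorEps (vecCrystal k) i b = ht b i (s.1 + 1) :=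
      tensorEps_eq s.2 fun t htd => h.right_le t htd
    refine ⟨s, ⟨?_, fun t hst => ?_⟩, ?_⟩
    · rw [h₀]; exact max_eq_right (h.right_le _ s.2.le)
    · rw [h₀]
      have h₁ := h.right_lt t.1 hst.le
      have h₂ := h.right_lt (t.1 + 1) (Fin.lt_def.1 hst)
      omega
    · simp [vecCrystal, h.right_fst, h.right_snd, ← h.left_eq]

theorem exists_lower_of_pos {i : Fin (k - 1)} {b : Mat d k} {t : ℕ} (h : 0 < ht b i t) (htd : t ≤ d) :
    ∃ b', Lower i b' b := by
  classical
  -- `Nat.find` produces the first maximum. It is not at 0, where the height is 0, so the step into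
  -- it goes strictly up.
  have hex : ∃ t, t ≤ d ∧ ht b i t = tensorEps (vecCrystal k) i b := exists_ht_eq_tensorEps i b
  obtain ⟨h₁, h₂⟩ := Nat.find_spec hex
  have hmin := fun t => Nat.find_min hex (m := t)
  have hpos := ht_le_tensorEps i b t htd
  rcases hs : Nat.find hex with _ | s
  · rw [hs, ht_zero] at h₂; omega
  · rw [hs] at h₁ h₂ hmin
    have h₃ : ∀ t ≤ s, ht b i t < ht b i (s + 1) := fun t hts => by
      have h₄ := hmin t (by omega)
      have h₅ := ht_le_tensorEps i b t (by omega)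
      rw [h₂]
      exact lt_of_le_of_ne h₅ fun h => h₄ ⟨by omega, h⟩
    have h₄ := h₃ s le_rfl
    have h₅ := ht_succ b i ⟨s, h₁⟩
    simp only at h₅
    refine ⟨_, ⟨s, h₁⟩, LowerAt.of_right ?_ ?_ rfl (fun t htd => ?_) h₃⟩
    · cases hx : b ⟨s, h₁⟩ (fstIdx i) with
      | false => rfl
      | true =>
        rw [hx] at h₅
        have := bz_le_one (b ⟨s, h₁⟩ (sndIdx i))
        simp only [bz_true] at h₅; omega
    · cases hx : b ⟨s, h₁⟩ (sndIdx i) with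
      | true => rfl
      | false =>
        rw [hx] at h₅
        have := bz_nonneg (b ⟨s, h₁⟩ (fstIdx i))
        simp only [bz_false] at h₅; omega
    · rw [h₂]; exact ht_le_tensorEps i b t htd

theorem exists_lower_of_lt {i : Fin (k - 1)} {b : Mat d k} {t : ℕ} (h : ht b i d < ht b i t)
    (htd : t ≤ d) : ∃ b', Lower i b b' := by
  classical
  -- Positions are counted from the end so that the minimal `u` marks the last maximum.
  have hex : ∃ u, u ≤ d ∧ ht b i (d - u) = tensorEps (vecCrystal k) i b := by
    obtain ⟨t, h₁, h₂⟩ := exists_ht_eq_tensorEps i b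
    exact ⟨d - t, by omega, by rw [Nat.sub_sub_self h₁]; exact h₂⟩
  obtain ⟨h₁, h₂⟩ := Nat.find_spec hex
  have hmin := fun t => Nat.find_min hex (m := t)
  have hpos := ht_le_tensorEps i b t htd
  set u := Nat.find hex with hu
  rcases Nat.eq_zero_or_pos u with h0 | hupos
  · rw [h0, Nat.sub_zero] at h₂; omega
  · have h₃ : ∀ t, d - u < t → t ≤ d → ht b i t < ht b i (d - u) := fun t hts htd => by
      have h₄ := hmin (d - t) (by omega)
      have h₅ := ht_le_tensorEps i b t (by omega)
      rw [h₂]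
      refine lt_of_le_of_ne h₅ fun h => h₄ ⟨by omega, ?_⟩
      rw [Nat.sub_sub_self htd]; exact h
    have h₄ := h₃ (d - u + 1) (by omega) (by omega)
    have h₅ := ht_succ b i ⟨d - u, by omega⟩
    simp only at h₅
    refine ⟨_, ⟨d - u, by omega⟩, ?_, ?_, rfl, fun t htd => ?_, h₃⟩
    · cases hx : b ⟨d - u, by omega⟩ (fstIdx i) with
      | true => rfl
      | false =>
        rw [hx] at h₅
        have := bz_nonneg (b ⟨d - u, by omega⟩ (sndIdx i))
        simp only [bz_false] at h₅; omega
    · cases hx : b ⟨d - u, by omega⟩ (sndIdx i) with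
      | false => rfl
      | true =>
        rw [hx] at h₅
        have := bz_le_one (b ⟨d - u, by omega⟩ (fstIdx i))
        simp only [bz_true] at h₅; omega
    · simp only [h₂]; exact ht_le_tensorEps i b t (by simp at htd; omega)

/-! ### Weights, the crystal axioms and the ballot conditions for tensor powers -/

theorem cnt_moveAt {i : Fin (k - 1)} {s : Fin d} {b : Mat d k} (h₁ : b s (fstIdx i) = true)
    (h₂ : b s (sndIdx i) = false) (x : Fin k) (t : ℕ) :
    cnt (moveAt i s b) x t = cnt b x t - if s.1 < t then root i x else 0 := by
  have hne := fstIdx_ne_sndIdx i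
  rw [cnt_of_eq_off (fun r hr => moveAt_of_ne i hr b), moveAt_apply, if_pos rfl]
  by_cases h₃ : x = sndIdx i
  · subst h₃; simp [root, hne.symm, h₂]; split_ifs <;> ring
  · by_cases h₄ : x = fstIdx i
    · subst h₄; simp [root, hne, h₁]; split_ifs <;> ring
    · simp [root, h₃, h₄]

theorem tensorPow_wt (b : Mat d k) (x : Fin k) :
    (tensorPow (vecCrystal k) d).wt b x = cnt b x d := by
  rw [cnt_eq_sum]
  change (∑ s, (vecCrystal k).wt (b s)) x = _
  rw [Finset.sum_apply]; rfl

theorem Lower.wt {i : Fin (k - 1)} {b b' : Mat d k} (h : Lower i b b') (x : Fin k) :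
    cnt b' x d = cnt b x d - root i x := by
  obtain ⟨s, h⟩ := h
  rw [h.eq_move, cnt_moveAt h.fst_eq h.snd_eq, if_pos s.2]

/-- ε is the maximum of the height path and φ is that maximum minus the final height. Lowering
raises the maximum by 1 and the final height by 2, so ε grows by one and φ drops by one. -/
theorem isCrystal_tensorPow (d k : ℕ) : IsCrystal (tensorPow (vecCrystal k) d) := by
  have hεnn : ∀ i (b : Mat d k), 0 ≤ tensorEps (vecCrystal k) i b := fun i b => by
    have := ht_le_tensorEps i b 0 (Nat.zero_le _)
    rwa [ht_zero] at this
  have hφnn : ∀ i (b : Mat d k), 0 ≤ tensorPhi (vecCrystal k) i b := fun i b => by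
    have := ht_le_tensorEps i b d le_rfl
    rw [tensorPhi_eq]; omega
  have hε : ∀ i (b b' : Mat d k), Lower i b b' →
      tensorEps (vecCrystal k) i b' = tensorEps (vecCrystal k) i b + 1 ∧ ht b' i d = ht b i d + 2 := by
    rintro i b b' ⟨s, h⟩
    have h₀ : tensorEps (vecCrystal k) i b = ht b i s.1 := tensorEps_eq s.2.le fun t htd => by
      rcases le_or_gt t s.1 with hts | hts
      · exact h.le t hts
      · exact (h.lt t hts htd).le
    have h₁ : tensorEps (vecCrystal k) i b' = ht b' i (s.1 + 1) :=
      tensorEps_eq s.2 fun t htd => h.right_le t htd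
    rw [h₁, h.ht_succ_right, h₀, h.ht_right, if_pos s.2]
    exact ⟨rfl, rfl⟩
  constructor
  · infer_instance
  · intro i b c
    rw [tensorPow_f_iff, tensorPow_e_iff]
  · intro i b c h
    funext x
    have := ((tensorPow_e_iff i b c).1 h).wt x
    rw [Pi.add_apply, tensorPow_wt, tensorPow_wt]; omega
  · intro i b c h
    funext x
    have := ((tensorPow_f_iff i b c).1 h).wt x
    rw [Pi.sub_apply, tensorPow_wt, tensorPow_wt]; omega
  · intro i b
    refine isGreatest_iterate _ (tensorEps (vecCrystal k) i) (hεnn i) (fun b hb => ?_)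
      (fun b c hc => ?_) b
    · by_contra hne
      obtain ⟨t, htd, h⟩ := exists_ht_eq_tensorEps i b
      obtain ⟨b', hb'⟩ := exists_lower_of_pos (i := i) (b := b) (t := t)
        (by have := hεnn i b; omega) htd
      rw [← tensorPow_e_iff, hb] at hb'
      cases hb'
    · have := (hε i _ _ ((tensorPow_e_iff i b c).1 hc)).1; omega
  · intro i b
    refine isGreatest_iterate _ (tensorPhi (vecCrystal k) i) (hφnn i) (fun b hb => ?_)
      (fun b c hc => ?_) b
    · by_contra hne
      obtain ⟨t, htd, h⟩ := exists_ht_eq_tensorEps i b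
      obtain ⟨b', hb'⟩ := exists_lower_of_lt (i := i) (b := b) (t := t)
        (by have := hφnn i b; rw [tensorPhi_eq] at this hne; omega) htd
      rw [← tensorPow_f_iff, hb] at hb'
      cases hb'
    · have := hε i _ _ ((tensorPow_f_iff i b c).1 hc)
      rw [tensorPhi_eq, tensorPhi_eq]; omega
  · intro i b
    change tensorPhi (vecCrystal k) i b - tensorEps (vecCrystal k) i b = _
    rw [tensorPhi_eq, corootPairing, tensorPow_wt, tensorPow_wt, ht]; ring

theorem tensorPow_e_eq_none_iff (i : Fin (k - 1)) (b : Mat d k) :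
    (tensorPow (vecCrystal k) d).e i b = none ↔ ∀ b', ¬ Lower i b' b := by
  rw [Option.eq_none_iff_forall_ne_some]
  simp only [ne_eq, tensorPow_e_iff]

/-- This is the ballot (lattice word) condition: raising is impossible iff the height path never
becomes positive. -/
theorem not_lower_left_iff (i : Fin (k - 1)) (b : Mat d k) :
    (∀ b', ¬ Lower i b' b) ↔ ∀ t ≤ d, cnt b (sndIdx i) t ≤ cnt b (fstIdx i) t := by
  constructor
  · intro h t htd
    by_contra hlt
    obtain ⟨b', hb'⟩ := exists_lower_of_pos (i := i) (b := b) (t := t) (by rw [ht]; omega) htd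
    exact h b' hb'
  · rintro h b' ⟨s, hs⟩
    have h₁ := hs.right_lt 0 (Nat.zero_le _)
    have h₂ := h (s.1 + 1) s.2
    rw [ht_zero, ht] at h₁; omega

theorem not_lower_right_iff (i : Fin (k - 1)) (b : Mat d k) :
    (∀ b', ¬ Lower i b b') ↔ ∀ t ≤ d, ht b i t ≤ ht b i d := by
  constructor
  · intro h t htd
    by_contra hlt
    obtain ⟨b', hb'⟩ := exists_lower_of_lt (i := i) (b := b) (t := t) (by omega) htd
    exact h b' hb'
  · rintro h b' ⟨s, hs⟩
    have h₁ := hs.lt d s.2 le_rfl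
    have h₂ := h s.1 s.2.le
    omega

end GLCrystal

namespace GLCrystal

variable {d k n m : ℕ}

/-! ## Symmetries and commutation -/

/-- The columns of a matrix from right to left, as rows (rotation by 90 degrees). -/
def tau (M : Mat d k) : Mat k d := fun j i => M i j.rev

/-- Rotation by 180 degrees. -/
def rot (M : Mat d k) : Mat d k := fun s x => M s.rev x.rev

theorem tau_tau (M : Mat d k) : tau (tau M) = rot M := rfl

theorem tau_rot (M : Mat d k) : tau (rot M) = rot (tau M) := rfl

@[simp] theorem rot_rot (M : Mat d k) : rot (rot M) = M := by
  funext s x; simp [rot]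

@[simp] theorem tau_tau_rot (M : Mat d k) : tau (tau (rot M)) = M := by
  rw [tau_tau, rot_rot]

@[simp] theorem tau_rot_tau (M : Mat d k) : tau (rot (tau M)) = M := by
  rw [← tau_rot, tau_tau_rot]

theorem tau_injective : Function.Injective (tau : Mat d k → Mat k d) := fun M M' h => by
  rw [← rot_rot M, ← rot_rot M', ← tau_tau M, ← tau_tau M', h]

theorem tau_surjective (M : Mat k d) : ∃ M' : Mat d k, tau M' = M := ⟨tau (rot M), by simp⟩

theorem fstIdx_rev (i : Fin (k - 1)) : (fstIdx i).rev = sndIdx i.rev := by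
  ext; simp [fstIdx, sndIdx]; omega

theorem sndIdx_rev (i : Fin (k - 1)) : (sndIdx i).rev = fstIdx i.rev := by
  ext; simp [fstIdx, sndIdx]; omega

theorem cnt_rot (b : Mat d k) (x : Fin k) {t : ℕ} (htd : t ≤ d) :
    cnt (rot b) x t = cnt b x.rev d - cnt b x.rev (d - t) := by
  induction t with
  | zero => simp [cnt_zero]
  | succ t ih =>
    have h₁ := cnt_succ (rot b) x ⟨t, htd⟩
    have h₂ := cnt_succ b x.rev (Fin.rev ⟨t, htd⟩)
    have h₃ : (Fin.rev (⟨t, htd⟩ : Fin d)).1 = d - (t + 1) := by simp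
    have h₄ : d - (t + 1) + 1 = d - t := by omega
    rw [h₃, h₄] at h₂
    simp only at h₁
    rw [h₁, ih (by omega), h₂, rot]; ring

theorem ht_rot (b : Mat d k) (i : Fin (k - 1)) {t : ℕ} (htd : t ≤ d) :
    ht (rot b) i t = ht b i.rev (d - t) - ht b i.rev d := by
  rw [ht, ht, ht, cnt_rot _ _ htd, cnt_rot _ _ htd, fstIdx_rev, sndIdx_rev]; ring

/-- Rotation traverses the height path of the reflected node backwards, up to a constant (`ht_rot`).
Last maxima become first maxima, so lowering becomes raising. -/
theorem LowerAt.rot {i : Fin (k - 1)} {s : Fin d} {b b' : Mat d k} (h : LowerAt i.rev s b b') :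
    LowerAt i s.rev (rot b') (rot b) := by
  have hne := fstIdx_ne_sndIdx i
  have hs : d - (s.rev.1 + 1) = s.1 := by simp; omega
  refine LowerAt.of_right ?_ ?_ ?_ (fun t htd => ?_) (fun t hts => ?_)
  · simp [GLCrystal.rot, fstIdx_rev, h.snd_eq]
  · simp [GLCrystal.rot, sndIdx_rev, h.fst_eq]
  · funext r x
    by_cases hr : r = s.rev
    · subst hr
      by_cases h₁ : x = sndIdx i
      · subst h₁; simp [GLCrystal.rot, sndIdx_rev, h.right_fst]
      · by_cases h₂ : x = fstIdx i
        · subst h₂; simp [GLCrystal.rot, fstIdx_rev, h.right_snd, hne]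
        · have h₃ : x.rev ≠ fstIdx i.rev := fun h => h₁ (by rw [← sndIdx_rev] at h; exact Fin.rev_injective h)
          have h₄ : x.rev ≠ sndIdx i.rev := fun h => h₂ (by rw [← fstIdx_rev] at h; exact Fin.rev_injective h)
          simp [GLCrystal.rot, h₁, h₂, h.right_of_ne_of_ne h₃ h₄]
    · have : r.rev ≠ s := fun h => hr (by rw [← h, Fin.rev_rev])
      simp [GLCrystal.rot, hr, h.right_of_ne this]
  · rw [ht_rot _ _ htd, ht_rot _ _ s.rev.2, hs]
    have : ht b i.rev (d - t) ≤ ht b i.rev s.1 := by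
      rcases le_or_gt (d - t) s.1 with h₁ | h₁
      · exact h.le _ h₁
      · exact (h.lt _ h₁ (by omega)).le
    omega
  · rw [ht_rot _ _ (by have := s.rev.2; omega), ht_rot _ _ s.rev.2, hs]
    have := h.lt (d - t) (by simp at hts; omega) (by omega)
    omega

theorem lower_rot_iff {i : Fin (k - 1)} {b b' : Mat d k} :
    Lower i (rot b') (rot b) ↔ Lower i.rev b b' := by
  constructor
  · rintro ⟨s, h⟩
    have h' : LowerAt i.rev.rev s (rot b') (rot b) := by rwa [Fin.rev_rev]
    exact ⟨s.rev, by simpa using h'.rot⟩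
  · rintro ⟨s, h⟩
    exact ⟨s.rev, h.rot⟩

/-- In right-to-left reading the move is visible in the partial row sums only at the cut between
columns i+1 and i, which is `t = k - 1 - i`; there the one has already been counted. -/
theorem cnt_tau_moveAt {i : Fin (k - 1)} {s : Fin d} {b : Mat d k} (h₁ : b s (fstIdx i) = true)
    (h₂ : b s (sndIdx i) = false) (r : Fin d) (t : ℕ) :
    cnt (tau (moveAt i s b)) r t =
      cnt (tau b) r t + if r = s ∧ t + i.1 + 1 = k then 1 else 0 := by
  have hne := fstIdx_ne_sndIdx i
  have key : ∀ j : Fin k, bz (moveAt i s b r j.rev) = bz (b r j.rev) +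
      if r = s then (if j = (sndIdx i).rev then 1 else 0) - (if j = (fstIdx i).rev then 1 else 0)
        else 0 := by
    intro j
    rw [moveAt_apply]
    by_cases hr : r = s
    · subst hr
      by_cases h₃ : j = (sndIdx i).rev
      · subst h₃; simp [h₂, hne.symm]
      · by_cases h₄ : j = (fstIdx i).rev
        · subst h₄; simp [h₁, hne]
        · have h₅ : j.rev ≠ sndIdx i := fun h => h₃ (by rw [← h, Fin.rev_rev])
          have h₆ : j.rev ≠ fstIdx i := fun h => h₄ (by rw [← h, Fin.rev_rev])
          simp [h₃, h₄, h₅, h₆]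
    · simp [hr]
  simp only [cnt, tau, key, Finset.sum_add_distrib]
  congr 1
  by_cases hr : r = s
  · simp only [hr, if_true, Finset.sum_sub_distrib, Finset.sum_ite_eq', Finset.mem_filter,
      Finset.mem_univ, true_and]
    have e₁ : (sndIdx i).rev.1 = k - 2 - i.1 := by simp [sndIdx]; omega
    have e₂ : (fstIdx i).rev.1 = k - 1 - i.1 := by simp [fstIdx]; omega
    rw [e₁, e₂]
    have := i.2
    split_ifs <;> omega
  · simp [hr]

/-- The column move takes a one from row p to row p+1, so the partial column sums change only at the
cut `t = p + 1`, where that one is not yet counted. -/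
theorem cnt_of_tau_eq_moveAt {p : Fin (n - 1)} {u : Fin m} {M Y : Mat n m}
    (h₁ : M (fstIdx p) u.rev = true) (h₂ : M (sndIdx p) u.rev = false)
    (hY : tau Y = moveAt p u (tau M)) (x : Fin m) (t : ℕ) :
    cnt Y x t = cnt M x t - if x = u.rev ∧ t = p.1 + 1 then 1 else 0 := by
  have hne := fstIdx_ne_sndIdx p
  have hY' : ∀ r, Y r x = moveAt p u (tau M) x.rev r := fun r => by
    rw [← hY]; simp [tau]
  have key : ∀ r, bz (Y r x) = bz (M r x) -
      if x = u.rev then (if r = fstIdx p then 1 else 0) - (if r = sndIdx p then 1 else 0)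
        else 0 := by
    intro r
    rw [hY', moveAt_apply]
    by_cases hx : x = u.rev
    · subst hx
      by_cases h₃ : r = sndIdx p
      · subst h₃; simp [h₂, hne.symm]
      · by_cases h₄ : r = fstIdx p
        · subst h₄; simp [h₁, hne]
        · simp [h₃, h₄, tau]
    · have : x.rev ≠ u := fun h => hx (by rw [← h, Fin.rev_rev])
      simp [hx, this, tau]
  simp only [cnt, key, Finset.sum_sub_distrib]
  congr 1
  by_cases hx : x = u.rev
  · simp only [hx, if_true, Finset.sum_sub_distrib, Finset.sum_ite_eq', Finset.mem_filter,
      Finset.mem_univ, true_and]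
    simp only [fstIdx, sndIdx]
    split_ifs <;> omega
  · simp [hx]

/-! ### The commuting squares of row and column operators -/

set_option maxHeartbeats 1000000 in
/-- The operators on rows and on columns commute: both lowering operators defined. -/
theorem lower_square {i : Fin (m - 1)} {p : Fin (n - 1)} {M X Y : Mat n m} (hT : Lower i M X)
    (hS : Lower p (tau M) (tau Y)) : ∃ W, Lower i Y W ∧ Lower p (tau X) (tau W) := by
  obtain ⟨s, T⟩ := hT
  obtain ⟨u, S⟩ := hS
  have hi := fstIdx_ne_sndIdx i
  have hp := fstIdx_ne_sndIdx p
  have hiv : (fstIdx i).1 = i.1 := rfl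
  have hiv' : (sndIdx i).1 = i.1 + 1 := rfl
  have hpv : (fstIdx p).1 = p.1 := rfl
  have hpv' : (sndIdx p).1 = p.1 + 1 := rfl
  have hi2 := i.2
  have hp2 := p.2
  have S1 : M (fstIdx p) u.rev = true := S.fst_eq
  have S2 : M (sndIdx p) u.rev = false := S.snd_eq
  have T1 := T.fst_eq
  have T2 := T.snd_eq
  have eX : ∀ r x, X r x = if r = s then
      (if x = sndIdx i then true else if x = fstIdx i then false else M r x) else M r x := by
    intro r x; rw [T.eq_move, moveAt_apply]
  have eY : ∀ r x, Y r x = if x = u.rev then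
      (if r = sndIdx p then true else if r = fstIdx p then false else M r x) else M r x := by
    intro r x
    have : Y r x = tau Y x.rev r := by simp [tau]
    rw [this, S.eq_move, moveAt_apply]
    simp [tau, Fin.rev_eq_iff]
  have hY : ∀ t, ht Y i t = ht M i t
      - (if sndIdx i = u.rev ∧ t = p.1 + 1 then 1 else 0)
      + (if fstIdx i = u.rev ∧ t = p.1 + 1 then 1 else 0) := by
    intro t
    rw [ht, ht, cnt_of_tau_eq_moveAt S1 S2 S.eq_move, cnt_of_tau_eq_moveAt S1 S2 S.eq_move]; ring
  have hX : ∀ t, ht (tau X) p t = ht (tau M) p t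
      + (if sndIdx p = s ∧ t + i.1 + 1 = m then 1 else 0)
      - (if fstIdx p = s ∧ t + i.1 + 1 = m then 1 else 0) := by
    intro t
    rw [ht, ht, T.eq_move, cnt_tau_moveAt T1 T2, cnt_tau_moveAt T1 T2]; ring
  have r1 : ht M i (p.1 + 1) = ht M i p.1 + bz (M (fstIdx p) (sndIdx i))
    - bz (M (fstIdx p) (fstIdx i)) := ht_succ M i (fstIdx p)
  have r2 : ht M i (p.1 + 2) = ht M i (p.1 + 1) + bz (M (sndIdx p) (sndIdx i))
    - bz (M (sndIdx p) (fstIdx i)) := ht_succ M i (sndIdx p)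
  have e₁ : (sndIdx i).rev.1 = m - 2 - i.1 := by simp [sndIdx]; omega
  have e₂ : (fstIdx i).rev.1 = m - 1 - i.1 := by simp [fstIdx]; omega
  have c1 := ht_succ (tau M) p (sndIdx i).rev
  have c2 := ht_succ (tau M) p (fstIdx i).rev
  simp only [tau, Fin.rev_rev] at c1 c2
  change ht (tau M) p _ = ht (tau M) p _ + _ - _ at c1
  change ht (tau M) p _ = ht (tau M) p _ + _ - _ at c2
  rw [e₁, show m - 2 - i.1 + 1 = m - 1 - i.1 by omega] at c1
  rw [e₂] at c2
  have hsp : s = fstIdx p ↔ s.1 = p.1 := by rw [Fin.ext_iff, hpv]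
  have hsp' : s = sndIdx p ↔ s.1 = p.1 + 1 := by rw [Fin.ext_iff, hpv']
  have hui : u.rev = fstIdx i ↔ u.1 = m - 1 - i.1 := by
    rw [Fin.rev_eq_iff, Fin.ext_iff, e₂]
  have hui' : u.rev = sndIdx i ↔ u.1 = m - 2 - i.1 := by
    rw [Fin.rev_eq_iff, Fin.ext_iff, e₁]
  -- it suffices to find the rows and columns where the operators act next
  suffices key : ∃ (s' : Fin n) (u' : Fin m),
      (Y s' (fstIdx i) = true ∧ Y s' (sndIdx i) = false ∧
        (∀ t, t ≤ s'.1 → ht Y i t ≤ ht Y i s'.1) ∧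
        ∀ t, s'.1 < t → t ≤ n → ht Y i t < ht Y i s'.1) ∧
      (X (fstIdx p) u'.rev = true ∧ X (sndIdx p) u'.rev = false ∧
        (∀ t, t ≤ u'.1 → ht (tau X) p t ≤ ht (tau X) p u'.1) ∧
        ∀ t, u'.1 < t → t ≤ m → ht (tau X) p t < ht (tau X) p u'.1) ∧
      ∀ r x, (if r = s' then
        (if x = sndIdx i then true else if x = fstIdx i then false else Y r x) else Y r x) =
        if x = u'.rev then
        (if r = sndIdx p then true else if r = fstIdx p then false else X r x) else X r x by
    obtain ⟨s', u', ⟨a1, a2, a3, a4⟩, ⟨b1, b2, b3, b4⟩, hW⟩ := key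
    refine ⟨moveAt i s' Y, ⟨s', a1, a2, rfl, a3, a4⟩, ⟨u', b1, b2, ?_, b3, b4⟩⟩
    funext y r
    have := hW r y.rev
    rw [moveAt_apply]
    change moveAt i s' Y r y.rev = _
    rw [moveAt_apply, this]
    simp [tau]
  have hs2 := s.2
  have hu2 := u.2
  -- The operators interfere only in the 2 × 2 block of rows p, p+1 and columns i, i+1. If one of
  -- the two moves takes place outside this block, both positions persist.
  by_cases hout : (s ≠ fstIdx p ∧ s ≠ sndIdx p) ∨ (u.rev ≠ fstIdx i ∧ u.rev ≠ sndIdx i)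
  · refine ⟨s, u, ⟨?_, ?_, ?_⟩, ⟨?_, ?_, ?_⟩, ?_⟩
    · grind
    · grind
    · by_cases hu : u.rev = fstIdx i
      · have hs : s ≠ fstIdx p ∧ s ≠ sndIdx p := by tauto
        have hu' := hui.1 hu
        rw [hu] at S1 S2
        -- Maximality of the column path at the preceding cut shows that the entry at (p, i+1) is at
        -- most the entry at (p+1, i+1). Hence the row height at cut p+1, after growing by one, does
        -- not exceed both of its old neighbours, so no new maximum appears.
        have g1 := S.le (m - 2 - i.1) (by omega)
        rw [hu'] at g1
        simp only [S1, S2, bz_true, bz_false] at r1 r2 c1 c2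
        have hs' : s.1 ≠ p.1 + 1 := fun h => hs.2 (hsp'.2 h)
        have hs'' : s.1 ≠ p.1 := fun h => hs.1 (hsp.2 h)
        simp only [hY, hu, hi.symm, hs', false_and, and_false, if_false, true_and]
        have b1 := bz_le_one (M (fstIdx p) (sndIdx i))
        have b2 := bz_nonneg (M (fstIdx p) (sndIdx i))
        constructor
        · intro t hts
          have q1 := T.le t hts
          by_cases htp : t = p.1 + 1
          · subst htp
            have q2 := T.le p.1 (by omega)
            have q3 := T.le (p.1 + 2) (by omega)
            simp; omega
          · simp [htp]; omega
        · intro t hts htn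
          have q1 := T.lt t hts htn
          by_cases htp : t = p.1 + 1
          · subst htp
            have q2 := T.lt p.1 (by omega) (by omega)
            have q3 := T.lt (p.1 + 2) (by omega) (by omega)
            simp; omega
          · simp [htp]; omega
      · by_cases hu' : u.rev = sndIdx i
        · have hs : s ≠ fstIdx p ∧ s ≠ sndIdx p := by tauto
          have hs' : s.1 ≠ p.1 + 1 := fun h => hs.2 (hsp'.2 h)
          simp only [hY, hu', hi, hs', false_and, and_false, if_false, true_and]
          -- Here a single height decreases, and not the one at the maximum, because s is not p + 1.
          exact ⟨fun t hts => by have := T.le t hts; split_ifs <;> omega,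
            fun t hts htn => by have := T.lt t hts htn; split_ifs <;> omega⟩
        · simp only [hY, Ne.symm hu, Ne.symm hu', false_and, if_false, sub_zero, add_zero]
          exact ⟨T.le, T.lt⟩
    · grind
    · grind
    · by_cases hs : s = sndIdx p
      · have hu : u.rev ≠ fstIdx i ∧ u.rev ≠ sndIdx i := by tauto
        have hs' := hsp'.1 hs
        rw [hs] at T1 T2
        -- The same argument with rows and columns exchanged: the entry at (p, i) is at most the
        -- entry at (p, i+1), so the column height that grows stays bounded by an old neighbour.
        have g1 := T.le p.1 (by omega)
        rw [hs'] at g1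
        simp only [T1, T2, bz_true, bz_false] at r1 r2 c1 c2
        have hu' : u.1 ≠ m - 1 - i.1 := fun h => hu.1 (hui.2 h)
        have hu'' : u.1 ≠ m - 2 - i.1 := fun h => hu.2 (hui'.2 h)
        have hu3 : ¬ (u.1 + i.1 + 1 = m) := by omega
        simp only [hX, hs, hp, hu3, false_and, and_false, if_false, true_and]
        have b1 := bz_le_one (M (fstIdx p) (fstIdx i))
        have b2 := bz_nonneg (M (fstIdx p) (fstIdx i))
        constructor
        · intro t hts
          have q1 := S.le t hts
          by_cases htp : t = m - 1 - i.1
          · subst htp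
            have q2 := S.le (m - 2 - i.1) (by omega)
            have q3 := S.le (m - 1 - i.1 + 1) (by omega)
            split_ifs <;> omega
          · rw [if_neg (by omega)]; omega
        · intro t hts htn
          have q1 := S.lt t hts htn
          by_cases htp : t = m - 1 - i.1
          · subst htp
            have q2 := S.lt (m - 2 - i.1) (by omega) (by omega)
            have q3 := S.lt (m - 1 - i.1 + 1) (by omega) (by omega)
            split_ifs <;> omega
          · rw [if_neg (by omega)]; omega
      · by_cases hs' : s = fstIdx p
        · have hu : u.rev ≠ fstIdx i ∧ u.rev ≠ sndIdx i := by tauto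
          have hu' : u.1 ≠ m - 1 - i.1 := fun h => hu.1 (hui.2 h)
          have hu3 : ¬ (u.1 + i.1 + 1 = m) := by omega
          simp only [hX, hs', hp.symm, hu3, false_and, and_false, if_false, true_and]
          exact ⟨fun t hts => by have := S.le t hts; split_ifs <;> omega,
            fun t hts htn => by have := S.lt t hts htn; split_ifs <;> omega⟩
        · simp only [hX, Ne.symm hs, Ne.symm hs', false_and, if_false, sub_zero, add_zero]
          exact ⟨S.le, S.lt⟩
    · grind
  · have hs : s = fstIdx p ∨ s = sndIdx p := by tauto
    have hu : u.rev = fstIdx i ∨ u.rev = sndIdx i := by tauto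
    rcases hs with hs | hs <;> rcases hu with hu | hu
    -- Both operators want to move the one at (p, i). The cell (p+1, i+1) turns out to be empty, and
    -- in either order the one ends up there.
    · have hs' := hsp.1 hs
      have hu' := hui.1 hu
      rw [hu] at S1 S2
      rw [hs] at T1 T2
      have g1 := T.lt (p.1 + 2) (by omega) (by omega)
      rw [hs'] at g1
      simp only [S1, S2, T2, bz_true, bz_false] at r1 r2 c1 c2
      have hD : M (sndIdx p) (sndIdx i) = false := by
        cases hD : M (sndIdx p) (sndIdx i) with
        | false => rfl
        | true => rw [hD] at r2; simp only [bz_true] at r2; omega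
      simp only [hD, bz_false] at r1 r2 c1 c2
      have hTle := T.le
      have hTlt := T.lt
      have hSle := S.le
      have hSlt := S.lt
      rw [hs'] at hTle hTlt
      rw [hu'] at hSle hSlt
      -- After the column move the one sits in row p+1, so the row operator now acts there; after
      -- the row move it sits in column i+1, so the column operator acts there.
      refine ⟨sndIdx p, (sndIdx i).rev, ⟨?_, ?_, ?_, ?_⟩, ⟨?_, ?_, ?_, ?_⟩, ?_⟩
      · grind
      · grind
      · intro t htt
        simp only [hpv'] at htt ⊢
        simp only [hY, hu, hi.symm, false_and, if_false, true_and]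
        by_cases htp : t = p.1 + 1
        · simp [htp]
        · have := hTle t (by omega)
          simp [htp]; omega
      · intro t htt htn
        simp only [hpv'] at htt ⊢
        simp only [hY, hu, hi.symm, false_and, if_false, true_and]
        have := hTlt t (by omega) htn
        simp [show t ≠ p.1 + 1 by omega]; omega
      · grind
      · grind
      · intro t htt
        simp only [e₁] at htt ⊢
        simp only [hX, hs, hp.symm, false_and, if_false, true_and]
        have := hSle t (by omega)
        rw [if_neg (by omega), if_neg (by omega)]; omega
      · intro t htt htn
        simp only [e₁] at htt ⊢
        simp only [hX, hs, hp.symm, false_and, if_false, true_and]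
        rw [if_neg (show ¬ (m - 2 - i.1 + i.1 + 1 = m) by omega)]
        by_cases htp : t = m - 1 - i.1
        · rw [htp, if_pos (by omega)]; omega
        · have := hSlt t (by omega) htn
          rw [if_neg (by omega)]; omega
      · grind
    -- In the two mixed cases the operators would need the same entry to be both one and zero.
    · grind
    · grind
    -- Both operators want to fill the empty cell (p+1, i+1). Then (p, i) is occupied, and whichever
    -- operator comes second moves that one instead.
    · have hs' := hsp'.1 hs
      have hu' := hui'.1 hu
      rw [hu] at S1 S2
      rw [hs] at T1 T2
      have g1 := S.lt (m - 1 - i.1 + 1) (by omega) (by omega)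
      rw [hu'] at g1
      simp only [S1, S2, T1, bz_true, bz_false] at r1 r2 c1 c2
      have hA : M (fstIdx p) (fstIdx i) = true := by
        cases hA : M (fstIdx p) (fstIdx i) with
        | true => rfl
        | false => rw [hA] at c2; simp only [bz_false] at c2; omega
      simp only [hA, bz_true] at r1 r2 c1 c2
      have hTle := T.le
      have hTlt := T.lt
      have hSle := S.le
      have hSlt := S.lt
      rw [hs'] at hTle hTlt
      rw [hu'] at hSle hSlt
      refine ⟨fstIdx p, (fstIdx i).rev, ⟨?_, ?_, ?_, ?_⟩, ⟨?_, ?_, ?_, ?_⟩, ?_⟩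
      · grind
      · grind
      · intro t htt
        simp only [hpv] at htt ⊢
        simp only [hY, hu, hi, false_and, if_false, true_and]
        have := hTle t (by omega)
        simp [show t ≠ p.1 + 1 by omega]; omega
      · intro t htt htn
        simp only [hpv] at htt ⊢
        simp only [hY, hu, hi, false_and, if_false, true_and]
        by_cases htp : t = p.1 + 1
        · rw [htp]; simp; omega
        · have := hTlt t (by omega) htn
          simp [htp]; omega
      · grind
      · grind
      · intro t htt
        simp only [e₂] at htt ⊢
        simp only [hX, hs, hp, false_and, if_false, true_and]
        rw [if_pos (show m - 1 - i.1 + i.1 + 1 = m by omega)]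
        by_cases htp : t = m - 1 - i.1
        · rw [htp, if_pos (by omega)]
        · have := hSle t (by omega)
          rw [if_neg (by omega)]; omega
      · intro t htt htn
        simp only [e₂] at htt ⊢
        simp only [hX, hs, hp, false_and, if_false, true_and]
        have := hSlt t (by omega) htn
        rw [if_neg (by omega), if_pos (by omega)]; omega
      · grind

/-- A quarter turn sends the column structure to the row structure, and the row structure to the
column structure with arrows reversed, because two quarter turns are `rot`. Each further turn of the
basic square gives another of the mixed squares. -/
theorem lower_square_raise_row {i : Fin (m - 1)} {p : Fin (n - 1)} {M X Y : Mat n m}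
    (hT : Lower i X M) (hS : Lower p (tau M) (tau Y)) :
    ∃ W, Lower i W Y ∧ Lower p (tau X) (tau W) := by
  have h : Lower i.rev (tau (tau M)) (tau (tau X)) := by
    rw [tau_tau, tau_tau, lower_rot_iff, Fin.rev_rev]; exact hT
  obtain ⟨W', h₁, h₂⟩ := lower_square hS h
  obtain ⟨W, rfl⟩ := tau_surjective W'
  rw [tau_tau, tau_tau, lower_rot_iff, Fin.rev_rev] at h₂
  exact ⟨W, h₂, h₁⟩

theorem lower_square_raise_both {i : Fin (m - 1)} {p : Fin (n - 1)} {M X Y : Mat n m}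
    (hT : Lower i X M) (hS : Lower p (tau Y) (tau M)) :
    ∃ W, Lower i W Y ∧ Lower p (tau W) (tau X) := by
  have h : Lower i.rev (tau (tau M)) (tau (tau X)) := by
    rw [tau_tau, tau_tau, lower_rot_iff, Fin.rev_rev]; exact hT
  obtain ⟨W', h₁, h₂⟩ := lower_square_raise_row hS h
  obtain ⟨W, rfl⟩ := tau_surjective W'
  rw [tau_tau, tau_tau, lower_rot_iff, Fin.rev_rev] at h₂
  exact ⟨W, h₂, h₁⟩

theorem lower_square_raise_col {i : Fin (m - 1)} {p : Fin (n - 1)} {M X Y : Mat n m}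
    (hT : Lower i M X) (hS : Lower p (tau Y) (tau M)) :
    ∃ W, Lower i Y W ∧ Lower p (tau W) (tau X) := by
  have h : Lower i.rev (tau (tau X)) (tau (tau M)) := by
    rw [tau_tau, tau_tau, lower_rot_iff, Fin.rev_rev]; exact hT
  obtain ⟨W', h₁, h₂⟩ := lower_square_raise_both hS h
  obtain ⟨W, rfl⟩ := tau_surjective W'
  rw [tau_tau, tau_tau, lower_rot_iff, Fin.rev_rev] at h₂
  exact ⟨W, h₂, h₁⟩

end GLCrystal

namespace GLCrystal

/-! ## Abstract double crystals -/

variable {X I J α β : Type*}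

/-- No arrow ends in `x`. -/
def IsHigh (r : I → X → X → Prop) (x : X) : Prop := ∀ i z, ¬ r i z x

/-- No arrow starts in `x`. -/
def IsLow (r : I → X → X → Prop) (x : X) : Prop := ∀ i z, ¬ r i x z

/-- Connected components of a coloured graph. -/
def Conn (r : I → X → X → Prop) (x y : X) : Prop := Relation.EqvGen (fun a b => ∃ i, r i a b) x y

/-- Two commuting crystal graphs with lowering arrows `r` (rows) and `c` (columns), in which the
elements that are highest for `r` and lowest for `c` are determined by either of their weights. -/
structure DoubleCrystal (r : I → X → X → Prop) (c : J → X → X → Prop) (wr : X → α) (wc : X → β) :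
    Prop where
  r_fun : ∀ {i x y y'}, r i x y → r i x y' → y = y'
  r_inj : ∀ {i x x' y}, r i x y → r i x' y → x = x'
  c_fun : ∀ {j x y y'}, c j x y → c j x y' → y = y'
  c_inj : ∀ {j x x' y}, c j x y → c j x' y → x = x'
  sq_ll : ∀ {i j x y z}, r i x y → c j x z → ∃ w, r i z w ∧ c j y w
  sq_rl : ∀ {i j x y z}, r i y x → c j x z → ∃ w, r i w z ∧ c j y w
  sq_lr : ∀ {i j x y z}, r i x y → c j z x → ∃ w, r i z w ∧ c j w y
  sq_rr : ∀ {i j x y z}, r i y x → c j z x → ∃ w, r i w z ∧ c j w y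
  r_grade : ∃ g : X → ℤ, ∀ i x y, r i x y → g x < g y
  c_grade : ∃ g : X → ℤ, ∀ j x y, c j x y → g x < g y
  wc_r : ∀ {i x y}, r i x y → wc x = wc y
  wr_c : ∀ {j x y}, c j x y → wr x = wr y
  ext_c : ∀ {x y}, IsHigh r x → IsLow c x → IsHigh r y → IsLow c y → wc x = wc y → x = y
  ext_r : ∀ {x y}, IsHigh r x → IsLow c x → IsHigh r y → IsLow c y → wr x = wr y → x = y

theorem conn_flip {r : I → X → X → Prop} {x y : X} :
    Conn (fun i a b => r i b a) x y ↔ Conn r x y := by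
  constructor
  all_goals
    intro h
    induction h with
    | refl x => exact .refl _
    | symm x y _ ih => exact ih.symm
    | trans x y z _ _ ih₁ ih₂ => exact ih₁.trans _ _ _ ih₂
    | rel x y h => exact .symm _ _ (.rel _ _ h)

theorem Conn.single {r : I → X → X → Prop} {i : I} {x y : X} (h : r i x y) : Conn r x y :=
  .rel _ _ ⟨i, h⟩

theorem Conn.symm {r : I → X → X → Prop} {x y : X} (h : Conn r x y) : Conn r y x :=
  Relation.EqvGen.symm _ _ h

theorem Conn.trans {r : I → X → X → Prop} {x y z : X} (h : Conn r x y) (h' : Conn r y z) :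
    Conn r x z := Relation.EqvGen.trans _ _ _ h h'

theorem Conn.apply_eq {γ : Type*} {r : I → X → X → Prop} {x y : X} (h : Conn r x y) {w : X → γ}
    (hw : ∀ i x y, r i x y → w x = w y) : w x = w y := by
  induction h with
  | refl x => rfl
  | symm x y _ ih => exact ih.symm
  | trans x y z _ _ ih₁ ih₂ => exact ih₁.trans ih₂
  | rel x y h => obtain ⟨i, h⟩ := h; exact hw i x y h

theorem conn_of_raise {r : I → X → X → Prop} {x y : X}
    (h : Relation.ReflTransGen (fun a b => ∃ i, r i b a) x y) : Conn r x y := by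
  induction h with
  | refl => exact .refl _
  | tail _ h ih => obtain ⟨i, h⟩ := h; exact ih.trans (Conn.single h).symm

namespace DoubleCrystal

variable {r : I → X → X → Prop} {c : J → X → X → Prop} {wr : X → α} {wc : X → β}

/-- Exchange the two structures and reverse all arrows. -/
theorem dual (h : DoubleCrystal r c wr wc) :
    DoubleCrystal (fun j x y => c j y x) (fun i x y => r i y x) wc wr where
  r_fun h₁ h₂ := h.c_inj h₁ h₂
  r_inj h₁ h₂ := h.c_fun h₁ h₂
  c_fun h₁ h₂ := h.r_inj h₁ h₂
  c_inj h₁ h₂ := h.r_fun h₁ h₂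
  sq_ll h₁ h₂ := by obtain ⟨w, a, b⟩ := h.sq_rr h₂ h₁; exact ⟨w, b, a⟩
  sq_rl h₁ h₂ := by obtain ⟨w, a, b⟩ := h.sq_rl h₂ h₁; exact ⟨w, b, a⟩
  sq_lr h₁ h₂ := by obtain ⟨w, a, b⟩ := h.sq_lr h₂ h₁; exact ⟨w, b, a⟩
  sq_rr h₁ h₂ := by obtain ⟨w, a, b⟩ := h.sq_ll h₂ h₁; exact ⟨w, b, a⟩
  r_grade := by
    obtain ⟨g, hg⟩ := h.c_grade
    exact ⟨fun x => -g x, fun j x y hxy => neg_lt_neg (hg j y x hxy)⟩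
  c_grade := by
    obtain ⟨g, hg⟩ := h.r_grade
    exact ⟨fun x => -g x, fun j x y hxy => neg_lt_neg (hg j y x hxy)⟩
  wc_r h₁ := (h.wr_c h₁).symm
  wr_c h₁ := (h.wc_r h₁).symm
  ext_c h₁ h₂ h₃ h₄ := h.ext_r h₂ h₁ h₄ h₃
  ext_r h₁ h₂ h₃ h₄ := h.ext_c h₂ h₁ h₄ h₃

/-- The commuting squares transport a column arrow along a chain of row arrows, in either direction:
a column operator is defined on all of a row component or on none of it. -/
theorem conn_lower (h : DoubleCrystal r c wr wc) {x y : X} (hxy : Conn r x y) (j : J) :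
    (∀ x', c j x x' → ∃ y', c j y y' ∧ Conn r x' y') ∧
    (∀ y', c j y y' → ∃ x', c j x x' ∧ Conn r x' y') := by
  induction hxy with
  | refl x => exact ⟨fun x' hx' => ⟨x', hx', .refl _⟩, fun x' hx' => ⟨x', hx', .refl _⟩⟩
  | symm x y _ ih =>
    refine ⟨fun x' hx' => ?_, fun x' hx' => ?_⟩
    · obtain ⟨w, a, b⟩ := ih.2 x' hx'; exact ⟨w, a, b.symm⟩
    · obtain ⟨w, a, b⟩ := ih.1 x' hx'; exact ⟨w, a, b.symm⟩
  | trans x y z _ _ ih₁ ih₂ =>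
    refine ⟨fun x' hx' => ?_, fun x' hx' => ?_⟩
    · obtain ⟨w, a, b⟩ := ih₁.1 x' hx'
      obtain ⟨w', a', b'⟩ := ih₂.1 w a
      exact ⟨w', a', b.trans b'⟩
    · obtain ⟨w, a, b⟩ := ih₂.2 x' hx'
      obtain ⟨w', a', b'⟩ := ih₁.2 w a
      exact ⟨w', a', b'.trans b⟩
  | rel x y hr =>
    obtain ⟨i, hr⟩ := hr
    refine ⟨fun x' hx' => ?_, fun x' hx' => ?_⟩
    · obtain ⟨w, a, b⟩ := h.sq_ll hr hx'; exact ⟨w, b, .single a⟩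
    · obtain ⟨w, a, b⟩ := h.sq_rl hr hx'; exact ⟨w, b, .single a⟩

theorem conn_raise (h : DoubleCrystal r c wr wc) {x y : X} (hxy : Conn r x y) (j : J) :
    (∀ x', c j x' x → ∃ y', c j y' y ∧ Conn r x' y') ∧
    (∀ y', c j y' y → ∃ x', c j x' x ∧ Conn r x' y') := by
  induction hxy with
  | refl x => exact ⟨fun x' hx' => ⟨x', hx', .refl _⟩, fun x' hx' => ⟨x', hx', .refl _⟩⟩
  | symm x y _ ih =>
    refine ⟨fun x' hx' => ?_, fun x' hx' => ?_⟩
    · obtain ⟨w, a, b⟩ := ih.2 x' hx'; exact ⟨w, a, b.symm⟩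
    · obtain ⟨w, a, b⟩ := ih.1 x' hx'; exact ⟨w, a, b.symm⟩
  | trans x y z _ _ ih₁ ih₂ =>
    refine ⟨fun x' hx' => ?_, fun x' hx' => ?_⟩
    · obtain ⟨w, a, b⟩ := ih₁.1 x' hx'
      obtain ⟨w', a', b'⟩ := ih₂.1 w a
      exact ⟨w', a', b.trans b'⟩
    · obtain ⟨w, a, b⟩ := ih₂.2 x' hx'
      obtain ⟨w', a', b'⟩ := ih₁.2 w a
      exact ⟨w', a', b'.trans b⟩
  | rel x y hr =>
    obtain ⟨i, hr⟩ := hr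
    refine ⟨fun x' hx' => ?_, fun x' hx' => ?_⟩
    · obtain ⟨w, a, b⟩ := h.sq_lr hr hx'; exact ⟨w, b, .single a⟩
    · obtain ⟨w, a, b⟩ := h.sq_rr hr hx'; exact ⟨w, b, .single a⟩

theorem isLow_of_conn (h : DoubleCrystal r c wr wc) {x y : X} (hxy : Conn r x y) (hx : IsLow c x) :
    IsLow c y := fun j z hz => by
  obtain ⟨w, hw, _⟩ := (h.conn_lower hxy j).2 z hz
  exact hx j w hw

theorem isHigh_of_conn (h : DoubleCrystal r c wr wc) {x y : X} (hxy : Conn c x y)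
    (hx : IsHigh r x) : IsHigh r y :=
  h.dual.isLow_of_conn (conn_flip.2 hxy) hx

theorem isHigh_col_of_conn (h : DoubleCrystal r c wr wc) {x y : X} (hxy : Conn r x y)
    (hx : IsHigh c x) : IsHigh c y := fun j z hz => by
  obtain ⟨w, hw, _⟩ := (h.conn_raise hxy j).2 z hz
  exact hx j w hw

theorem wc_conn (h : DoubleCrystal r c wr wc) {x y : X} (hxy : Conn r x y) : wc x = wc y :=
  hxy.apply_eq fun _ _ _ h₁ => h.wc_r h₁

theorem wr_conn (h : DoubleCrystal r c wr wc) {x y : X} (hxy : Conn c x y) : wr x = wr y :=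
  hxy.apply_eq fun _ _ _ h₁ => h.wr_c h₁

/-! ### Highest and lowest representatives, and reconstruction from them -/

variable [Finite X]

theorem c_induction (h : DoubleCrystal r c wr wc) {motive : X → Prop}
    (H : ∀ x, (∀ j y, c j x y → motive y) → motive x) (x : X) : motive x := by
  obtain ⟨g, hg⟩ := h.c_grade
  exact induction_of_stat (fun x => -g x)
    (fun x ih => H x fun j y hy => ih y (neg_lt_neg (hg j x y hy))) x

theorem r_induction (h : DoubleCrystal r c wr wc) {motive : X → Prop}
    (H : ∀ x, (∀ i y, r i y x → motive y) → motive x) (x : X) : motive x :=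
  h.dual.c_induction H x

/-- Induct along the column lowering arrows. If x is column-lowest, so is y, and `ext_c` applies as
`wc` is constant on row components. Otherwise the same column operator lowers both; the results are
again row-highest and connected, hence equal, and the operator is injective. -/
theorem high_unique (h : DoubleCrystal r c wr wc) {x y : X} (hxy : Conn r x y) (hx : IsHigh r x)
    (hy : IsHigh r y) : x = y := by
  revert y
  refine h.c_induction (motive := fun x => IsHigh r x → ∀ {y}, Conn r x y → IsHigh r y → x = y)
    (fun x ih hx y hxy hy => ?_) x hx
  by_cases hlow : IsLow c x
  · exact h.ext_c hx hlow hy (h.isLow_of_conn hxy hlow) (h.wc_conn hxy)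
  · simp only [IsLow, not_forall, not_not] at hlow
    obtain ⟨j, x', hx'⟩ := hlow
    obtain ⟨y', hy', hxy'⟩ := (h.conn_lower hxy j).1 x' hx'
    have := ih j x' hx' (h.isHigh_of_conn (.single hx') hx) hxy'
      (h.isHigh_of_conn (.single hy') hy)
    subst this
    exact h.c_inj hx' hy'

theorem exists_high (h : DoubleCrystal r c wr wc) (x : X) :
    ∃ y, Relation.ReflTransGen (fun a b => ∃ i, r i b a) x y ∧ IsHigh r y := by
  refine h.r_induction (motive := fun x => ∃ y, Relation.ReflTransGen (fun a b => ∃ i, r i b a) x y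
    ∧ IsHigh r y) (fun x ih => ?_) x
  by_cases hx : IsHigh r x
  · exact ⟨x, .refl, hx⟩
  · simp only [IsHigh, not_forall, not_not] at hx
    obtain ⟨i, z, hz⟩ := hx
    obtain ⟨y, hy, hhigh⟩ := ih i z hz
    exact ⟨y, .head ⟨i, hz⟩ hy, hhigh⟩

/-- The highest element in the row component of `x`. -/
noncomputable def hi (h : DoubleCrystal r c wr wc) (x : X) : X := (h.exists_high x).choose

theorem raise_hi (h : DoubleCrystal r c wr wc) (x : X) :
    Relation.ReflTransGen (fun a b => ∃ i, r i b a) x (h.hi x) := (h.exists_high x).choose_spec.1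

theorem isHigh_hi (h : DoubleCrystal r c wr wc) (x : X) : IsHigh r (h.hi x) :=
  (h.exists_high x).choose_spec.2

theorem conn_hi (h : DoubleCrystal r c wr wc) (x : X) : Conn r x (h.hi x) :=
  conn_of_raise (h.raise_hi x)

/-- The lowest element in the column component of `x`. -/
noncomputable def lo (h : DoubleCrystal r c wr wc) (x : X) : X := h.dual.hi x

theorem lower_lo (h : DoubleCrystal r c wr wc) (x : X) :
    Relation.ReflTransGen (fun a b => ∃ j, c j a b) x (h.lo x) := h.dual.raise_hi x

theorem isLow_lo (h : DoubleCrystal r c wr wc) (x : X) : IsLow c (h.lo x) := h.dual.isHigh_hi x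

theorem conn_lo (h : DoubleCrystal r c wr wc) (x : X) : Conn c x (h.lo x) :=
  conn_flip.1 (h.dual.conn_hi x)

theorem hi_eq_of_conn (h : DoubleCrystal r c wr wc) {x y : X} (hxy : Conn r x y) :
    h.hi x = h.hi y :=
  h.high_unique ((h.conn_hi x).symm.trans (hxy.trans (h.conn_hi y))) (h.isHigh_hi x) (h.isHigh_hi y)

theorem lo_eq_of_conn (h : DoubleCrystal r c wr wc) {x y : X} (hxy : Conn c x y) :
    h.lo x = h.lo y := h.dual.hi_eq_of_conn (conn_flip.2 hxy)

theorem hi_eq (h : DoubleCrystal r c wr wc) {x y : X} (hxy : Conn r x y) (hy : IsHigh r y) :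
    h.hi x = y :=
  h.high_unique ((h.conn_hi x).symm.trans hxy) (h.isHigh_hi x) hy

theorem lo_eq (h : DoubleCrystal r c wr wc) {x y : X} (hxy : Conn c x y) (hy : IsLow c y) :
    h.lo x = y := h.dual.hi_eq (conn_flip.2 hxy) hy

theorem lo_self (h : DoubleCrystal r c wr wc) {x : X} (hx : IsLow c x) : h.lo x = x :=
  h.lo_eq (.refl _) hx

theorem conn_of_hi_eq (h : DoubleCrystal r c wr wc) {x y : X} (hxy : h.hi x = h.hi y) :
    Conn r x y := (h.conn_hi x).trans (hxy ▸ (h.conn_hi y).symm)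

theorem conn_of_lo_eq (h : DoubleCrystal r c wr wc) {x y : X} (hxy : h.lo x = h.lo y) :
    Conn c x y := (h.conn_lo x).trans (hxy ▸ (h.conn_lo y).symm)

theorem c_hi (h : DoubleCrystal r c wr wc) {j : J} {x y : X} (hxy : c j x y) :
    c j (h.hi x) (h.hi y) := by
  obtain ⟨z, hz, hyz⟩ := (h.conn_lower (h.conn_hi x) j).1 y hxy
  rwa [h.hi_eq hyz (h.isHigh_of_conn (.single hz) (h.isHigh_hi x))]

theorem r_lo (h : DoubleCrystal r c wr wc) {i : I} {x y : X} (hxy : r i x y) :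
    r i (h.lo x) (h.lo y) := h.dual.c_hi hxy

theorem conn_hi_hi (h : DoubleCrystal r c wr wc) {x y : X} (hxy : Conn c x y) :
    Conn c (h.hi x) (h.hi y) := by
  induction hxy with
  | refl x => exact .refl _
  | symm x y _ ih => exact ih.symm
  | trans x y z _ _ ih₁ ih₂ => exact ih₁.trans ih₂
  | rel x y hr => obtain ⟨j, hr⟩ := hr; exact .single (h.c_hi hr)

theorem isLow_hi (h : DoubleCrystal r c wr wc) {x : X} (hx : IsLow c x) : IsLow c (h.hi x) :=
  h.isLow_of_conn (h.conn_hi x) hx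

theorem isHigh_lo (h : DoubleCrystal r c wr wc) {x : X} (hx : IsHigh r x) : IsHigh r (h.lo x) :=
  h.isHigh_of_conn (h.conn_lo x) hx

/-- `hi` maps column components into column components and keeps column-lowest elements
column-lowest. -/
theorem lo_hi (h : DoubleCrystal r c wr wc) (x : X) : h.lo (h.hi x) = h.hi (h.lo x) :=
  h.lo_eq (h.conn_hi_hi (h.conn_lo x)) (h.isLow_hi (h.isLow_lo x))

/-- Lower x and y simultaneously by column operators until they are column-lowest, where each equals
its own `lo`; injectivity brings the equality back. -/
theorem ext_hi_lo (h : DoubleCrystal r c wr wc) {x y : X} (h₁ : h.hi x = h.hi y)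
    (h₂ : h.lo x = h.lo y) : x = y := by
  revert y
  refine h.c_induction (motive := fun x => ∀ {y}, h.hi x = h.hi y → h.lo x = h.lo y → x = y)
    (fun x ih y h₁ h₂ => ?_) x
  have hxy := h.conn_of_hi_eq h₁
  by_cases hlow : IsLow c x
  · rw [← h.lo_self hlow, h₂, h.lo_self (h.isLow_of_conn hxy hlow)]
  · simp only [IsLow, not_forall, not_not] at hlow
    obtain ⟨j, x', hx'⟩ := hlow
    obtain ⟨y', hy', hxy'⟩ := (h.conn_lower hxy j).1 x' hx'
    have := ih j x' hx' (h.hi_eq_of_conn hxy') (by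
      rw [← h.lo_eq_of_conn (.single hx'), ← h.lo_eq_of_conn (.single hy'), h₂])
    subst this
    exact h.c_inj hx' hy'

/-- Lower p by column operators until it is column-lowest. There the condition reads p = hi q and q
itself is the witness. Going back, each column raising of p lifts to the whole row component. -/
theorem exists_hi_lo (h : DoubleCrystal r c wr wc) {p q : X} (hp : IsHigh r p) (hq : IsLow c q)
    (hpq : h.lo p = h.hi q) : ∃ x, h.hi x = p ∧ h.lo x = q := by
  refine h.c_induction (motive := fun p => IsHigh r p → h.lo p = h.hi q →
    ∃ x, h.hi x = p ∧ h.lo x = q) (fun p ih hp hpq => ?_) p hp hpq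
  by_cases hlow : IsLow c p
  · exact ⟨q, by rw [← hpq, h.lo_self hlow], h.lo_self hq⟩
  · simp only [IsLow, not_forall, not_not] at hlow
    obtain ⟨j, p', hp'⟩ := hlow
    obtain ⟨x', hx₁, hx₂⟩ := ih j p' hp' (h.isHigh_of_conn (.single hp') hp)
      (by rw [← h.lo_eq_of_conn (.single hp'), hpq])
    obtain ⟨x, hx, hxp⟩ := (h.conn_raise (hx₁ ▸ h.conn_hi x' : Conn r x' p') j).2 p hp'
    exact ⟨x, h.hi_eq hxp hp, by rw [h.lo_eq_of_conn (.single hx), hx₂]⟩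

/-- With `c_hi`, this says that column arrows in the coordinates (hi, lo) are column arrows between
the hi with lo unchanged. -/
theorem c_of_hi (h : DoubleCrystal r c wr wc) {j : J} {x y : X} (h₁ : c j (h.hi x) (h.hi y))
    (h₂ : h.lo x = h.lo y) : c j x y := by
  obtain ⟨z, hz, hzy⟩ := (h.conn_lower (h.conn_hi x) j).2 _ h₁
  have : z = y := h.ext_hi_lo ((h.hi_eq hzy (h.isHigh_hi y)))
    (by rw [← h.lo_eq_of_conn (.single hz), h₂])
  rwa [this] at hz

theorem r_of_lo (h : DoubleCrystal r c wr wc) {i : I} {x y : X} (h₁ : r i (h.lo x) (h.lo y))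
    (h₂ : h.hi x = h.hi y) : r i x y := h.dual.c_of_hi h₁ h₂.symm

end DoubleCrystal

end GLCrystal

namespace GLCrystal

variable {d k n m : ℕ}

/-! ## The double crystal of 0/1-matrices -/

/-- The transpose of a matrix. -/
def tp (M : Mat n m) : Mat m n := fun c r => M r c

/-- Row structure: `f_i M = X`. -/
def rowR (n m : ℕ) (i : Fin (m - 1)) (M X : Mat n m) : Prop := Lower i M X

/-- Column structure: `f_p M = X`. -/
def colR (n m : ℕ) (p : Fin (n - 1)) (M X : Mat n m) : Prop := Lower p (tau M) (tau X)

/-- Column sums: the weight of the row structure. -/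
def rowWt (M : Mat n m) (x : Fin m) : ℤ := cnt M x n

/-- Row sums: the weight of the column structure. -/
def colWt (M : Mat n m) (r : Fin n) : ℤ := cnt (tau M) r m

/-! ### Extremal matrices are justified Young diagrams -/

theorem cnt_rev (b : Mat d k) (x : Fin k) {t : ℕ} (htd : t ≤ d) :
    cnt (fun s => b s.rev) x t = cnt b x d - cnt b x (d - t) := by
  have := cnt_rot (fun s y => b s y.rev) x htd
  simpa [rot, cnt] using this

theorem cnt_tau (M : Mat n m) (r : Fin n) {t : ℕ} (htm : t ≤ m) :
    cnt (tau M) r t = cnt (tp M) r m - cnt (tp M) r (m - t) := cnt_rev (tp M) r htm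

theorem cnt_tau_full (M : Mat n m) (r : Fin n) : cnt (tau M) r m = cnt (tp M) r m := by
  rw [cnt_tau M r le_rfl, Nat.sub_self, cnt_zero, sub_zero]

theorem antitone_of_snd_le_fst {f : Fin k → ℤ} (h : ∀ i, f (sndIdx i) ≤ f (fstIdx i)) :
    Antitone f := by
  have key : ∀ (j : ℕ) (a b : Fin k), b.1 = a.1 + j → f b ≤ f a := by
    intro j
    induction j with
    | zero => intro a b hab; rw [Fin.ext (a := a) (b := b) (by omega)]
    | succ j ih =>
      intro a b hab
      have h₁ := h ⟨a.1 + j, by omega⟩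
      have h₂ := ih a (fstIdx ⟨a.1 + j, by omega⟩) rfl
      have h₃ : b = sndIdx ⟨a.1 + j, by omega⟩ := Fin.ext (by simp [sndIdx]; omega)
      rw [h₃]; exact h₁.trans h₂
  intro a b hab
  exact key (b.1 - a.1) a b (by have := Fin.le_def.1 hab; omega)

theorem cnt_anti_of_high {M : Mat n m} (h : IsHigh (rowR n m) M) {x y : Fin m} (hxy : x ≤ y) {t : ℕ}
    (htn : t ≤ n) : cnt M y t ≤ cnt M x t :=
  antitone_of_snd_le_fst (f := fun x => cnt M x t)
    (fun i => (not_lower_left_iff i M).1 (h i) t htn) hxy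

theorem isHigh_iff {M : Mat n m} : IsHigh (rowR n m) M ↔
    ∀ (i : Fin (m - 1)) (t : ℕ), t ≤ n → cnt M (sndIdx i) t ≤ cnt M (fstIdx i) t := by
  simp only [← not_lower_left_iff]; rfl

theorem isHigh_col_iff {M : Mat n m} : IsHigh (colR n m) M ↔ IsHigh (rowR m n) (tau M) := by
  constructor
  · intro h p z hz
    obtain ⟨z, rfl⟩ := tau_surjective z
    exact h p z hz
  · intro h p z hz
    exact h p (tau z) hz

theorem isLow_col_iff {M : Mat n m} : IsLow (colR n m) M ↔ IsLow (rowR m n) (tau M) := by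
  constructor
  · intro h p z hz
    obtain ⟨z, rfl⟩ := tau_surjective z
    exact h p z hz
  · intro h p z hz
    exact h p (tau z) hz

theorem isHigh_rot_iff {M : Mat n m} : IsHigh (rowR n m) (rot M) ↔ IsLow (rowR n m) M := by
  constructor
  · intro h i z hz
    refine h i.rev (rot z) (lower_rot_iff.2 ?_)
    rwa [Fin.rev_rev]
  · intro h i z hz
    rw [← rot_rot z] at hz
    exact h i.rev (rot z) (lower_rot_iff.1 hz)

theorem isHigh_col_rot_iff {M : Mat n m} : IsHigh (colR n m) (rot M) ↔ IsLow (colR n m) M := by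
  rw [isHigh_col_iff, isLow_col_iff, tau_rot, isHigh_rot_iff]

theorem isLow_col_tau_iff {M : Mat n m} : IsLow (colR m n) (tau M) ↔ IsHigh (rowR n m) M := by
  rw [isLow_col_iff, ← isHigh_rot_iff, tau_tau, rot_rot]

theorem cnt_mono_of_low {M : Mat n m} (h : IsLow (colR n m) M) {x y : Fin n} (hxy : x ≤ y) {t : ℕ}
    (htm : t ≤ m) : cnt (tp M) x t ≤ cnt (tp M) y t := by
  refine neg_le_neg_iff.1 (antitone_of_snd_le_fst (f := fun x => -cnt (tp M) x t) (fun p => ?_) hxy)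
  have h₁ := (not_lower_right_iff p (tau M)).1 (isLow_col_iff.1 h p) (m - t) (by omega)
  simp only [ht, cnt_tau_full, cnt_tau M _ (Nat.sub_le m t), Nat.sub_sub_self htm] at h₁
  omega

theorem cnt_lt_cnt {b : Mat d k} {x y : Fin k} {r : Fin d}
    (h : ∀ s, s ≤ r → bz (b s x) ≤ bz (b s y)) (h₁ : b r x = false) (h₂ : b r y = true) :
    cnt b x (r.1 + 1) < cnt b y (r.1 + 1) := by
  refine Finset.sum_lt_sum (fun s hs => h s ?_) ⟨r, by simp, by simp [h₁, h₂]⟩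
  simp at hs; rw [Fin.le_def]; omega

theorem exists_of_cnt_lt {b : Mat d k} {x y : Fin k} {t : ℕ} (h : cnt b x t < cnt b y t) :
    ∃ s : Fin d, s.1 < t ∧ b s x = false ∧ b s y = true := by
  obtain ⟨s, hs, hlt⟩ := Finset.exists_lt_of_sum_lt h
  refine ⟨s, by simpa using hs, ?_⟩
  cases h₁ : b s x <;> cases h₂ : b s y <;> simp [h₁, h₂] at hlt ⊢

/-- Matrices that are highest for rows and lowest for columns are Young diagrams justified to the
bottom and to the left. -/
theorem bottomLeft {M : Mat n m} (h₁ : IsHigh (rowR n m) M) (h₂ : IsLow (colR n m) M)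
    {r r' : Fin n} {c c' : Fin m} (hr : r ≤ r') (hc : c' ≤ c) (hM : M r c = true) :
    M r' c' = true := by
  -- Columns are treated from left to right. If a one at (r, c) had a zero below it at (r', c),
  -- column-lowestness would give an earlier column c' with a zero in row r and a one in row r'. By
  -- induction c' is empty down to row r, so column c has more ones there than c', against
  -- row-highestness.
  have bottom : ∀ (c : Fin m) (r r' : Fin n), r ≤ r' → M r c = true → M r' c = true := by
    intro c
    induction c using WellFoundedLT.induction with
    | ind c ih =>
      intro r r' hr hM
      by_contra hM'
      have hlt : cnt (tp M) r c.1 < cnt (tp M) r' c.1 := by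
        have := cnt_mono_of_low h₂ hr (t := c.1 + 1) c.2
        have f₁ : tp M c r = true := hM
        have f₂ : tp M c r' = false := Bool.eq_false_of_not_eq_true hM'
        rw [cnt_succ, cnt_succ, f₁, f₂, bz_true, bz_false] at this
        omega
      obtain ⟨c', hc', e₁, e₂⟩ := exists_of_cnt_lt hlt
      refine absurd (cnt_anti_of_high h₁ (Fin.le_def.2 hc'.le) (t := r.1 + 1) r.2)
        (not_le.2 (cnt_lt_cnt (fun s hs => ?_) e₁ hM))
      have : M s c' = false := by
        by_contra hcon
        rw [Bool.not_eq_false] at hcon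
        have := ih c' hc' s r hs hcon
        rw [tp] at e₁
        rw [e₁] at this; cases this
      rw [this]; exact bz_nonneg _
  refine bottom c' r r' hr ?_
  rcases hc.eq_or_lt with rfl | hc
  · exact hM
  by_contra hM'
  rw [Bool.not_eq_true] at hM'
  -- A zero at (r, c') forces column c' to be empty in all rows up to r, as its ones are
  -- bottom-justified; then column c to its right has more ones there.
  refine absurd (cnt_anti_of_high h₁ hc.le (t := r.1 + 1) r.2)
    (not_le.2 (cnt_lt_cnt (fun s hs => ?_) hM' hM))
  have : M s c' = false := by
    by_contra hcon
    rw [Bool.not_eq_false] at hcon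
    rw [bottom c' s r hs hcon] at hM'; cases hM'
  rw [this]; exact bz_nonneg _

/-- Matrices that are highest for rows and for columns are Young diagrams justified to the top and
to the left. -/
theorem topLeft {M : Mat n m} (h₁ : IsHigh (rowR n m) M) (h₂ : IsHigh (colR n m) M)
    {r r' : Fin n} {c c' : Fin m} (hr : r' ≤ r) (hc : c' ≤ c) (hM : M r c = true) :
    M r' c' = true := by
  -- Now the induction runs from right to left, because column-highestness compares rows on their
  -- right ends.
  have top : ∀ (c : Fin m) (r r' : Fin n), r' ≤ r → M r c = true → M r' c = true := by
    intro c
    induction c using WellFoundedGT.induction with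
    | ind c ih =>
      intro r r' hr hM
      by_contra hM'
      have hlt : cnt (tau M) r c.rev.1 < cnt (tau M) r' c.rev.1 := by
        have := cnt_anti_of_high (isHigh_col_iff.1 h₂) hr (t := c.rev.1 + 1) c.rev.2
        have f₁ : tau M c.rev r = true := by simp [tau, hM]
        have f₂ : tau M c.rev r' = false := by simpa [tau] using hM'
        rw [cnt_succ, cnt_succ, f₁, f₂, bz_true, bz_false] at this
        omega
      obtain ⟨c', hc', e₁, e₂⟩ := exists_of_cnt_lt hlt
      rw [tau] at e₁ e₂
      have hc'' : c < c'.rev := by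
        rw [← Fin.lt_def] at hc'
        rw [Fin.lt_rev_iff]; exact hc'
      refine absurd (cnt_anti_of_high h₁ hc''.le (t := r'.1 + 1) r'.2)
        (not_le.2 (cnt_lt_cnt (fun s hs => ?_) (Bool.eq_false_of_not_eq_true hM') e₂))
      rw [ih c'.rev hc'' r' s hs e₂]; exact bz_le_one _
  have hM := top c r r' hr hM
  rcases hc.eq_or_lt with rfl | hc
  · exact hM
  by_contra hM'
  rw [Bool.not_eq_true] at hM'
  refine absurd (cnt_anti_of_high h₁ hc.le (t := r'.1 + 1) r'.2)
    (not_le.2 (cnt_lt_cnt (fun s hs => ?_) hM' hM))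
  rw [top c r' s hs hM]; exact bz_le_one _

theorem cnt_mono (b : Mat d k) (x : Fin k) {t t' : ℕ} (h : t ≤ t') : cnt b x t ≤ cnt b x t' := by
  refine Finset.sum_le_sum_of_subset_of_nonneg (fun s hs => ?_) fun s _ _ => bz_nonneg _
  simp at hs ⊢; omega

theorem cnt_le (b : Mat d k) (x : Fin k) (t : ℕ) (htd : t ≤ d) : cnt b x t ≤ t := by
  induction t with
  | zero => simp [cnt_zero]
  | succ t ih =>
    have h₁ := cnt_succ b x ⟨t, htd⟩
    have h₂ := bz_le_one (b ⟨t, htd⟩ x)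
    have h₃ := ih (by omega)
    simp only at h₁
    push_cast; omega

theorem eq_true_iff_lt_cnt {b : Mat d k} {x : Fin k}
    (h : ∀ s s' : Fin d, s' ≤ s → b s x = true → b s' x = true) (s : Fin d) :
    b s x = true ↔ (s.1 : ℤ) < cnt b x d := by
  constructor
  · intro hs
    have key : ∀ t, t ≤ s.1 + 1 → cnt b x t = t := by
      intro t
      induction t with
      | zero => intro _; simp [cnt_zero]
      | succ t ih =>
        intro hts
        have h₁ := cnt_succ b x ⟨t, by omega⟩
        rw [h s ⟨t, by omega⟩ (by rw [Fin.le_def]; simp; omega) hs] at h₁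
        simp only [bz_true] at h₁
        rw [h₁, ih (by omega)]; push_cast; ring
    have h₁ := key _ le_rfl
    have h₂ := cnt_mono b x (t := s.1 + 1) s.2
    push_cast at h₁; omega
  · intro hlt
    by_contra hs
    have h₁ : cnt b x d = cnt b x s.1 := by
      refine (Finset.sum_subset (fun r hr => ?_) fun r hr hr' => ?_).symm
      · simp
      · simp at hr'
        have : b r x = false := by
          by_contra hcon
          exact hs (h r s hr' (by simpa using hcon))
        rw [this]; rfl
    have h₂ := cnt_le b x s.1 s.2.le
    omega

/-- A left-justified row is known from its length, so the row sums determine the matrix;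
`bottomLeft_iff_rowWt` does the same with column sums. -/
theorem bottomLeft_iff_colWt {M : Mat n m} (h₁ : IsHigh (rowR n m) M) (h₂ : IsLow (colR n m) M)
    (r : Fin n) (c : Fin m) : M r c = true ↔ (c.1 : ℤ) < colWt M r := by
  rw [colWt, cnt_tau_full]
  exact eq_true_iff_lt_cnt (b := tp M) (x := r)
    (fun _ _ hs hM => bottomLeft h₁ h₂ le_rfl hs hM) c

theorem bottomLeft_iff_rowWt {M : Mat n m} (h₁ : IsHigh (rowR n m) M) (h₂ : IsLow (colR n m) M)
    (r : Fin n) (c : Fin m) : M r c = true ↔ (r.rev.1 : ℤ) < rowWt M c := by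
  have h := eq_true_iff_lt_cnt (b := fun s => M s.rev) (x := c)
    (fun _ _ hs hM => bottomLeft h₁ h₂ (Fin.rev_le_rev.2 hs) le_rfl hM) r.rev
  rw [cnt_rev M c le_rfl, Nat.sub_self, cnt_zero, sub_zero, Fin.rev_rev] at h
  exact h

theorem topLeft_iff_colWt {M : Mat n m} (h₁ : IsHigh (rowR n m) M) (h₂ : IsHigh (colR n m) M)
    (r : Fin n) (c : Fin m) : M r c = true ↔ (c.1 : ℤ) < colWt M r := by
  rw [colWt, cnt_tau_full]
  exact eq_true_iff_lt_cnt (b := tp M) (x := r)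
    (fun _ _ hs hM => topLeft h₁ h₂ le_rfl hs hM) c

theorem colWt_of_lower {i : Fin (m - 1)} {M X : Mat n m} (h : Lower i M X) : colWt X = colWt M := by
  obtain ⟨s, h⟩ := h
  funext r
  rw [colWt, h.eq_move, cnt_tau_moveAt h.fst_eq h.snd_eq, if_neg (by omega), add_zero]; rfl

theorem rowWt_of_lower {p : Fin (n - 1)} {M X : Mat n m} (h : Lower p (tau M) (tau X)) :
    rowWt X = rowWt M := by
  obtain ⟨u, h⟩ := h
  funext x
  rw [rowWt, cnt_of_tau_eq_moveAt h.fst_eq h.snd_eq h.eq_move, if_neg (by omega), sub_zero]; rfl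

theorem wtStat_of_lower {i : Fin (k - 1)} {b b' : Mat d k} (h : Lower i b b') :
    wtStat (fun x => cnt b x d) < wtStat (fun x => cnt b' x d) := by
  have : (fun x => cnt b' x d) = (fun x => cnt b x d) - root i := funext fun x => h.wt x
  rw [this, wtStat_sub, wtStat_root]; omega

theorem doubleCrystal (n m : ℕ) :
    DoubleCrystal (rowR n m) (colR n m) (rowWt : Mat n m → _) (colWt : Mat n m → _) where
  r_fun h₁ h₂ := Lower.unique_right h₁ h₂
  r_inj h₁ h₂ := Lower.unique_left h₁ h₂
  c_fun h₁ h₂ := tau_injective (Lower.unique_right h₁ h₂)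
  c_inj h₁ h₂ := tau_injective (Lower.unique_left h₁ h₂)
  sq_ll h₁ h₂ := lower_square h₁ h₂
  sq_rl h₁ h₂ := lower_square_raise_row h₁ h₂
  sq_lr h₁ h₂ := lower_square_raise_col h₁ h₂
  sq_rr h₁ h₂ := lower_square_raise_both h₁ h₂
  r_grade := ⟨fun M => wtStat (rowWt M), fun _ _ _ h => wtStat_of_lower h⟩
  c_grade := ⟨fun M => wtStat (colWt M), fun _ _ _ h => wtStat_of_lower h⟩
  wc_r h := (colWt_of_lower h).symm
  wr_c h := (rowWt_of_lower h).symm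
  ext_c h₁ h₂ h₃ h₄ h := by
    funext r c
    rw [Bool.eq_iff_iff, bottomLeft_iff_colWt h₁ h₂, bottomLeft_iff_colWt h₃ h₄, h]
  ext_r h₁ h₂ h₃ h₄ h := by
    funext r c
    rw [Bool.eq_iff_iff, bottomLeft_iff_rowWt h₁ h₂, bottomLeft_iff_rowWt h₃ h₄, h]

/-! ### Rotation by 180 degrees fixes the extremal corner -/

theorem rowR_rot {i : Fin (m - 1)} {M X : Mat n m} (h : rowR n m i M X) :
    rowR n m i.rev (rot X) (rot M) := by
  refine lower_rot_iff.2 ?_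
  rwa [Fin.rev_rev]

theorem colR_rot {p : Fin (n - 1)} {M X : Mat n m} (h : colR n m p M X) :
    colR n m p.rev (rot X) (rot M) := by
  rw [colR, tau_rot, tau_rot]
  refine lower_rot_iff.2 ?_
  rwa [Fin.rev_rev]

theorem conn_row_rot {M X : Mat n m} (h : Conn (rowR n m) M X) :
    Conn (rowR n m) (rot M) (rot X) := by
  induction h with
  | refl x => exact .refl _
  | symm x y _ ih => exact ih.symm
  | trans x y z _ _ ih₁ ih₂ => exact ih₁.trans ih₂
  | rel x y h => obtain ⟨i, h⟩ := h; exact (Conn.single (rowR_rot h)).symm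

theorem conn_col_rot {M X : Mat n m} (h : Conn (colR n m) M X) :
    Conn (colR n m) (rot M) (rot X) := by
  induction h with
  | refl x => exact .refl _
  | symm x y _ ih => exact ih.symm
  | trans x y z _ _ ih₁ ih₂ => exact ih₁.trans ih₂
  | rel x y h => obtain ⟨i, h⟩ := h; exact (Conn.single (colR_rot h)).symm

/-- The row-highest matrix of a row component. -/
noncomputable def hiMat (M : Mat n m) : Mat n m := (doubleCrystal n m).hi M

/-- The column-lowest matrix of a column component. -/
noncomputable def loMat (M : Mat n m) : Mat n m := (doubleCrystal n m).lo M

theorem colWt_rot (M : Mat n m) (r : Fin n) : colWt (rot M) r = colWt M r.rev := by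
  rw [colWt, tau_rot, cnt_rot _ _ le_rfl, Nat.sub_self, cnt_zero, sub_zero]; rfl

/-- The rotated diagram is pushed into the top right corner. Its row-highest representative has the
same row sums and is top-left justified, hence it is e turned upside down. This has the column sums
of e, and so has its column-lowest representative. -/
theorem loMat_hiMat_rot_of_extremal {e : Mat n m} (h₁ : IsHigh (rowR n m) e)
    (h₂ : IsLow (colR n m) e) : loMat (hiMat (rot e)) = e := by
  have D := doubleCrystal n m
  have hr : IsHigh (rowR n m) (hiMat (rot e)) := D.isHigh_hi _
  have hc : IsHigh (colR n m) (hiMat (rot e)) :=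
    D.isHigh_col_of_conn (D.conn_hi _) (isHigh_col_rot_iff.2 h₂)
  refine D.ext_r (D.isHigh_lo hr) (D.isLow_lo _) h₁ h₂ ?_
  refine (D.wr_conn (D.conn_lo (hiMat (rot e)))).symm.trans ?_
  have h : hiMat (rot e) = fun r => e r.rev := by
    funext r c
    have hw : colWt (rot e) = colWt (hiMat (rot e)) := D.wc_conn (D.conn_hi (rot e))
    rw [Bool.eq_iff_iff, topLeft_iff_colWt hr hc, bottomLeft_iff_colWt h₁ h₂, ← colWt_rot, hw]
  funext c
  rw [h, rowWt, cnt_rev e c le_rfl, Nat.sub_self, cnt_zero, sub_zero]; rfl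

theorem loMat_hiMat_rot (M : Mat n m) : loMat (hiMat (rot M)) = loMat (hiMat M) := by
  have D := doubleCrystal n m
  have h₁ : hiMat (rot M) = hiMat (rot (hiMat M)) := D.hi_eq_of_conn (conn_row_rot (D.conn_hi M))
  have h₂ : loMat (rot (hiMat M)) = loMat (rot (loMat (hiMat M))) :=
    D.lo_eq_of_conn (conn_col_rot (D.conn_lo _))
  have h₃ : ∀ M : Mat n m, loMat (hiMat M) = hiMat (loMat M) := D.lo_hi
  rw [h₁, h₃, h₂, ← h₃]
  exact loMat_hiMat_rot_of_extremal (D.isHigh_lo (D.isHigh_hi _)) (D.isLow_lo _)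

end GLCrystal

namespace GLCrystal

variable {d k n m : ℕ}

/-! ## Schützenberger involutions of tensor powers -/

theorem connected_of_conn {b b' : Mat d k} (h : Conn (rowR d k) b b') :
    Connected (tensorPow (vecCrystal k) d) 0 (k - 1) b b' := by
  induction h with
  | refl x => exact .refl _
  | symm x y _ ih => exact ih.symm
  | trans x y z _ _ ih₁ ih₂ => exact ih₁.trans _ _ _ ih₂
  | rel x y h =>
    obtain ⟨i, h⟩ := h
    exact .rel _ _ ⟨i, Nat.zero_le _, i.2, (tensorPow_f_iff i _ _).2 h⟩

theorem conn_of_connected {b b' : Mat d k} {p q : ℕ}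
    (h : Connected (tensorPow (vecCrystal k) d) p q b b') : Conn (rowR d k) b b' := by
  induction h with
  | refl x => exact .refl _
  | symm x y _ ih => exact ih.symm
  | trans x y z _ _ ih₁ ih₂ => exact ih₁.trans ih₂
  | rel x y h =>
    obtain ⟨i, _, _, h⟩ := h
    exact .single (i := i) ((tensorPow_f_iff i _ _).1 h)

theorem uniqueHighest_tensorPow (d k : ℕ) :
    UniqueHighest (tensorPow (vecCrystal k) d) 0 (k - 1) := by
  intro b c hbc hb hc
  refine (doubleCrystal d k).high_unique (conn_of_connected hbc) ?_ ?_
  · exact fun i => (tensorPow_e_eq_none_iff i b).1 (hb i (Nat.zero_le _) i.2)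
  · exact fun i => (tensorPow_e_eq_none_iff i c).1 (hc i (Nat.zero_le _) i.2)

theorem isSchutzenberger_of_involutive {ξ : Mat d k → Mat d k}
    (hconn : ∀ b, Conn (rowR d k) b (ξ b)) (hinv : ∀ b, ξ (ξ b) = b)
    (hanti : ∀ i b b', rowR d k i b b' → rowR d k i.rev (ξ b') (ξ b))
    (hwt : ∀ b x, rowWt (ξ b) x = rowWt b x.rev) :
    IsSchutzenberger (tensorPow (vecCrystal k) d) 0 (k - 1) ξ := by
  have hrev : ∀ i j : Fin (k - 1), i.1 + j.1 + 1 = 0 + (k - 1) → j = i.rev := fun i j h => by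
    ext; simp; omega
  constructor
  · exact fun b => connected_of_conn (hconn b)
  · intro i j _ _ hij b
    obtain rfl := hrev i j hij
    ext y
    rw [Option.map_eq_some_iff, tensorPow_e_iff]
    simp only [tensorPow_f_iff]
    constructor
    · intro h
      refine ⟨ξ y, ?_, hinv y⟩
      have := hanti i _ _ h
      rwa [hinv] at this
    · rintro ⟨b', h, rfl⟩
      have := hanti _ _ _ h
      rwa [Fin.rev_rev] at this
  · intro i j _ _ hij b
    obtain rfl := hrev i j hij
    ext y
    rw [Option.map_eq_some_iff, tensorPow_f_iff]
    simp only [tensorPow_e_iff]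
    constructor
    · intro h
      refine ⟨ξ y, ?_, hinv y⟩
      have := hanti i _ _ h
      rwa [hinv] at this
    · rintro ⟨b', h, rfl⟩
      have := hanti _ _ _ h
      rwa [Fin.rev_rev] at this
  · intro x y _ _ hxy b
    have : y = x.rev := by ext; simp; omega
    rw [this, tensorPow_wt, tensorPow_wt]
    exact hwt b x
  · intro x hx b
    omega

/-- The pair (hi M, lo (rot M)) is compatible precisely because rotation preserves the corner. -/
theorem exists_schutzMat (M : Mat n m) :
    ∃ x : Mat n m, hiMat x = hiMat M ∧ loMat x = loMat (rot M) := by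
  have D := doubleCrystal n m
  refine D.exists_hi_lo (D.isHigh_hi _) (D.isLow_lo _) ?_
  exact (loMat_hiMat_rot M).symm.trans (D.lo_hi (rot M))

/-- The Schützenberger involution of the row structure. -/
noncomputable def schutzMat (M : Mat n m) : Mat n m := (exists_schutzMat M).choose

theorem hiMat_schutzMat (M : Mat n m) : hiMat (schutzMat M) = hiMat M :=
  (exists_schutzMat M).choose_spec.1

theorem loMat_schutzMat (M : Mat n m) : loMat (schutzMat M) = loMat (rot M) :=
  (exists_schutzMat M).choose_spec.2

theorem ext_hiMat_loMat {M X : Mat n m} (h₁ : hiMat M = hiMat X) (h₂ : loMat M = loMat X) :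
    M = X := (doubleCrystal n m).ext_hi_lo h₁ h₂

theorem hiMat_rot_schutzMat_rot (M : Mat n m) : hiMat (rot (schutzMat (rot M))) = hiMat M := by
  have D := doubleCrystal n m
  have h := conn_row_rot (D.conn_of_hi_eq (hiMat_schutzMat (rot M)))
  rw [rot_rot] at h
  exact D.hi_eq_of_conn h

theorem loMat_rot_schutzMat (M : Mat n m) : loMat (rot (schutzMat M)) = loMat M := by
  have D := doubleCrystal n m
  have h := conn_col_rot (D.conn_of_lo_eq (loMat_schutzMat M))
  rw [rot_rot] at h
  exact D.lo_eq_of_conn h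

/-- Keeping hi keeps the row component. Row arrows are visible on lo, where the map acts as rotation
and so reverses them; weights are constant on column components and are reversed by rotation. -/
theorem isSchutzenberger_schutzMat (n m : ℕ) :
    IsSchutzenberger (tensorPow (vecCrystal m) n) 0 (m - 1) (schutzMat : Mat n m → Mat n m) := by
  have D := doubleCrystal n m
  refine isSchutzenberger_of_involutive (fun M => ?_) (fun M => ?_) (fun i M X h => ?_)
    (fun M x => ?_)
  · exact D.conn_of_hi_eq (hiMat_schutzMat M).symm
  · apply ext_hiMat_loMat
    · rw [hiMat_schutzMat, hiMat_schutzMat]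
    · rw [loMat_schutzMat, loMat_rot_schutzMat]
  · have h₁ : rowR n m i.rev (loMat (schutzMat X)) (loMat (schutzMat M)) := by
      rw [loMat_schutzMat, loMat_schutzMat]
      exact D.r_lo (rowR_rot h)
    refine D.r_of_lo h₁ ?_
    change hiMat _ = hiMat _
    rw [hiMat_schutzMat, hiMat_schutzMat]
    exact (D.hi_eq_of_conn (.single h)).symm
  · have h := D.wr_conn (D.conn_of_lo_eq (loMat_schutzMat M))
    rw [h, rowWt, cnt_rot _ _ le_rfl, Nat.sub_self, cnt_zero, sub_zero]; rfl

theorem xi_tensorPow (n m : ℕ) : xi (tensorPow (vecCrystal m) n) = schutzMat :=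
  partialXi_eq (isCrystal_tensorPow n m) (uniqueHighest_tensorPow n m) le_rfl
    (isSchutzenberger_schutzMat n m)

/-- The central identity. Since `tau ∘ rot` inverts `tau`, the map is M ↦ `schutzMat (rot M)` seen
through `tau`. Its value has the lo of M, so it lies in the same column component, and the hi of
`rot M`, on which column arrows are reversed. -/
theorem isSchutzenberger_tau_schutzMat (n m : ℕ) :
    IsSchutzenberger (tensorPow (vecCrystal n) m) 0 (n - 1)
      (fun b : Mat m n => tau (schutzMat (rot (tau (rot b))))) := by
  have D := doubleCrystal n m
  refine isSchutzenberger_of_involutive (fun b => ?_) (fun b => ?_) (fun p b b' h => ?_)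
    (fun b x => ?_)
  · obtain ⟨M, rfl⟩ := tau_surjective b
    have h : Conn (colR n m) M (schutzMat (rot M)) := D.conn_of_lo_eq (by
      have := loMat_schutzMat (rot M)
      rw [rot_rot] at this; exact this.symm)
    rw [tau_rot_tau]
    have key : ∀ {M X : Mat n m}, Conn (colR n m) M X → Conn (rowR m n) (tau M) (tau X) := by
      intro M X h
      induction h with
      | refl x => exact .refl _
      | symm x y _ ih => exact ih.symm
      | trans x y z _ _ ih₁ ih₂ => exact ih₁.trans ih₂
      | rel x y h => obtain ⟨i, h⟩ := h; exact .single (i := i) h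
    exact key h
  · obtain ⟨M, rfl⟩ := tau_surjective b
    rw [tau_rot_tau, tau_rot_tau]
    congr 1
    apply ext_hiMat_loMat
    · rw [hiMat_schutzMat, hiMat_rot_schutzMat_rot]
    · rw [loMat_schutzMat, rot_rot, loMat_schutzMat, rot_rot]
  · obtain ⟨M, rfl⟩ := tau_surjective b
    obtain ⟨X, rfl⟩ := tau_surjective b'
    rw [tau_rot_tau, tau_rot_tau]
    have h₁ : colR n m p.rev (hiMat (schutzMat (rot X))) (hiMat (schutzMat (rot M))) := by
      rw [hiMat_schutzMat, hiMat_schutzMat]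
      exact D.c_hi (colR_rot h)
    refine D.c_of_hi h₁ ?_
    change loMat _ = loMat _
    rw [loMat_schutzMat, loMat_schutzMat, rot_rot, rot_rot]
    exact (D.lo_eq_of_conn (.single (i := p) h)).symm
  · obtain ⟨M, rfl⟩ := tau_surjective b
    rw [tau_rot_tau]
    have h := D.wc_conn (D.conn_of_hi_eq (hiMat_schutzMat (rot M)))
    change colWt (schutzMat (rot M)) x = colWt M x.rev
    rw [h, colWt_rot]

/-! ### The crystal of 0/1-vectors -/

theorem tensorPow_one_f_iff (i : Fin (k - 1)) (b b' : Mat 1 k) :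
    (tensorPow (vecCrystal k) 1).f i b = some b' ↔ (vecCrystal k).f i (b 0) = some (b' 0) := by
  rw [tensorPow_f_iff]
  constructor
  · rintro ⟨s, h⟩
    obtain rfl : s = 0 := Subsingleton.elim _ _
    simp [vecCrystal, h.fst_eq, h.snd_eq, h.eq_move, moveAt]
  · intro h
    simp only [vecCrystal] at h
    split_ifs at h with hc
    refine ⟨0, hc.1, hc.2, ?_, ?_, ?_⟩
    · funext s
      obtain rfl : s = 0 := Subsingleton.elim _ _
      simpa [moveAt] using h.symm
    · intro t ht₁
      simp at ht₁
      subst ht₁; simp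
    · intro t ht₁ ht₂
      simp at ht₁
      obtain rfl : t = 1 := by omega
      have := ht_succ b i 0
      simp [hc.1, hc.2] at this ⊢
      omega

theorem vec_f_iff_e (i : Fin (k - 1)) (v w : Fin k → Bool) :
    (vecCrystal k).f i v = some w ↔ (vecCrystal k).e i w = some v := by
  have hne := fstIdx_ne_sndIdx i
  simp only [vecCrystal]
  constructor
  · intro h
    split_ifs at h with hc
    obtain rfl := Option.some_injective _ h
    rw [if_pos (by simp [hne])]
    congr 1
    funext x
    by_cases h₁ : x = sndIdx i
    · subst h₁; simp [hc.2]
    · by_cases h₂ : x = fstIdx i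
      · subst h₂; simp [hc.1, hne]
      · simp [h₁, h₂]
  · intro h
    split_ifs at h with hc
    obtain rfl := Option.some_injective _ h
    rw [if_pos (by simp [hne])]
    congr 1
    funext x
    by_cases h₁ : x = sndIdx i
    · subst h₁; simp [hc.2]
    · by_cases h₂ : x = fstIdx i
      · subst h₂; simp [hc.1, hne]
      · simp [h₁, h₂]

/-- A 0/1-vector is its own weight, so the weight condition alone forces reversal. -/
theorem vec_eq_rev {ξ : (Fin k → Bool) → Fin k → Bool}
    (h : IsSchutzenberger (vecCrystal k) 0 (k - 1) ξ) (v : Fin k → Bool) :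
    ξ v = fun x => v x.rev := by
  funext x
  have := h.wt_inside x x.rev (Nat.zero_le _) (by omega) (by simp; omega) v
  simp only [vecCrystal] at this
  cases h₁ : ξ v x <;> cases h₂ : v x.rev <;> simp [h₁, h₂] at this ⊢

/-- Transferred from matrices with one row, where connectedness of a vector and its reversal is
already known. -/
theorem isSchutzenberger_vec (k : ℕ) :
    IsSchutzenberger (vecCrystal k) 0 (k - 1) (fun v x => v x.rev) := by
  have H := isSchutzenberger_schutzMat 1 k
  have hrev : ∀ b : Mat 1 k, schutzMat b = fun s x => b s x.rev := by
    intro b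
    funext s x
    obtain rfl : s = 0 := Subsingleton.elim _ _
    have := H.wt_inside x x.rev (Nat.zero_le _) (by omega) (by simp; omega) b
    rw [tensorPow_wt, tensorPow_wt, cnt_eq_sum, cnt_eq_sum] at this
    simp only [Finset.univ_unique, Fin.default_eq_zero, Finset.sum_singleton] at this
    cases h₁ : schutzMat b 0 x <;> cases h₂ : b 0 x.rev <;> simp [h₁, h₂] at this ⊢
  have hfe := (isCrystal_tensorPow 1 k).f_iff_e
  have hf : ∀ i (v w : Fin k → Bool), (vecCrystal k).f i v = some w ↔
      (tensorPow (vecCrystal k) 1).f i (fun _ => v) = some (fun _ => w) :=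
    fun i v w => (tensorPow_one_f_iff i (fun _ => v) (fun _ => w)).symm
  have he : ∀ i (v w : Fin k → Bool), (vecCrystal k).e i v = some w ↔
      (tensorPow (vecCrystal k) 1).e i (fun _ => v) = some (fun _ => w) := fun i v w => by
    rw [← vec_f_iff_e, hf, hfe]
  have hcon : ∀ b b' : Mat 1 k, Connected (tensorPow (vecCrystal k) 1) 0 (k - 1) b b' →
      Connected (vecCrystal k) 0 (k - 1) (b 0) (b' 0) := by
    intro b b' h
    induction h with
    | refl x => exact .refl _
    | symm x y _ ih => exact ih.symm
    | trans x y z _ _ ih₁ ih₂ => exact ih₁.trans _ _ _ ih₂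
    | rel x y h =>
      obtain ⟨i, h₁, h₂, h⟩ := h
      exact .rel _ _ ⟨i, h₁, h₂, (tensorPow_one_f_iff i x y).1 h⟩
  have hconst : ∀ b : Mat 1 k, b = fun _ => b 0 := fun b => by
    funext s; rw [Subsingleton.elim s 0]
  constructor
  · intro v
    have := hcon _ _ (H.connected (fun _ => v))
    rwa [hrev] at this
  · intro i j h₁ h₂ hij v
    have := H.e_comm i j h₁ h₂ hij (fun _ => v)
    simp only [hrev] at this
    ext w
    rw [he, this, Option.map_eq_some_iff, Option.map_eq_some_iff]
    constructor
    · rintro ⟨b, hb, hbw⟩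
      exact ⟨b 0, by rw [hf, ← hconst b]; exact hb, by rw [hrev] at hbw; exact congrFun hbw 0⟩
    · rintro ⟨v', hv', rfl⟩
      exact ⟨fun _ => v', (hf _ _ _).1 hv', hrev _⟩
  · intro i j h₁ h₂ hij v
    have := H.f_comm i j h₁ h₂ hij (fun _ => v)
    simp only [hrev] at this
    ext w
    rw [hf, this, Option.map_eq_some_iff, Option.map_eq_some_iff]
    constructor
    · rintro ⟨b, hb, hbw⟩
      exact ⟨b 0, by rw [he, ← hconst b]; exact hb, by rw [hrev] at hbw; exact congrFun hbw 0⟩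
    · rintro ⟨v', hv', rfl⟩
      exact ⟨fun _ => v', (he _ _ _).1 hv', hrev _⟩
  · intro x y _ _ hxy v
    have : y = x.rev := by ext; simp; omega
    subst this
    rfl
  · intro x hx v
    omega

theorem existsUnique_schutzenberger_vec (k : ℕ) :
    ∃! ξ, IsSchutzenberger (vecCrystal k) 0 (k - 1) ξ :=
  ⟨_, isSchutzenberger_vec k, fun _ h => funext fun v => vec_eq_rev h v⟩

theorem xi_vec (v : Fin k → Bool) : xi (vecCrystal k) v = fun x => v x.rev := by
  have hex : ∃ ξ, IsSchutzenberger (vecCrystal k) 0 (k - 1) ξ := ⟨_, isSchutzenberger_vec k⟩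
  rw [xi, partialXi, dif_pos hex]
  exact vec_eq_rev hex.choose_spec v

/-! ### Subdiagrams -/

variable {K p : ℕ}

/-- The columns `p, …, p + K - 1` of a matrix. -/
def res (h : p + K ≤ k) (b : Mat d k) : Mat d K := fun s x => b s ⟨p + x.1, by omega⟩

/-- Replace the columns `p, …, p + K - 1` of a matrix. -/
def ins (p : ℕ) (b : Mat d k) (y : Mat d K) : Mat d k :=
  fun s x => if h : p ≤ x.1 ∧ x.1 < p + K then y s ⟨x.1 - p, by omega⟩ else b s x

/-- The matrices agree outside the columns `p, …, p + K - 1`. -/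
def AgreeOff (p K : ℕ) (b b' : Mat d k) : Prop :=
  ∀ s (x : Fin k), (x.1 < p ∨ p + K ≤ x.1) → b' s x = b s x

theorem res_ins (h : p + K ≤ k) (b : Mat d k) (y : Mat d K) : res h (ins p b y) = y := by
  funext s x
  simp [res, ins]

theorem agreeOff_ins (b : Mat d k) (y : Mat d K) : AgreeOff p K b (ins p b y) := by
  intro s x hx
  simp only [ins]
  rw [dif_neg (by omega)]

theorem AgreeOff.symm {b b' : Mat d k} (h : AgreeOff p K b b') : AgreeOff p K b' b :=
  fun s x hx => (h s x hx).symm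

theorem AgreeOff.trans {b b' b'' : Mat d k} (h : AgreeOff p K b b') (h' : AgreeOff p K b' b'') :
    AgreeOff p K b b'' := fun s x hx => (h' s x hx).trans (h s x hx)

theorem eq_of_res (h : p + K ≤ k) {b b' : Mat d k} (h₁ : res h b = res h b')
    (h₂ : AgreeOff p K b b') : b = b' := by
  funext s x
  by_cases hx : p ≤ x.1 ∧ x.1 < p + K
  · have := congrFun (congrFun h₁ s) ⟨x.1 - p, by omega⟩
    simp only [res] at this
    have e : p + (x.1 - p) = x.1 := by omega
    simpa only [e] using this
  · exact (h₂ s x (by omega)).symm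

theorem ins_res (h : p + K ≤ k) (b : Mat d k) : ins p b (res h b) = b :=
  eq_of_res h (res_ins h _ _) (agreeOff_ins _ _).symm

theorem ht_res (h : p + K ≤ k) (b : Mat d k) {i : Fin (k - 1)} {i' : Fin (K - 1)}
    (hi : i.1 = p + i'.1) (t : ℕ) : ht (res h b) i' t = ht b i t := by
  have h₁ : (⟨p + (fstIdx i').1, by omega⟩ : Fin k) = fstIdx i := Fin.ext hi.symm
  have h₂ : (⟨p + (sndIdx i').1, by omega⟩ : Fin k) = sndIdx i :=
    Fin.ext (by simp [sndIdx]; omega)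
  rw [ht, ht, ← h₁, ← h₂]; rfl

/-- The operators of the nodes p, …, p+K-2 read and change only the columns p, …, p+K-1, where they
are the operators of a smaller tensor power. -/
theorem lower_iff_res (h : p + K ≤ k) {b b' : Mat d k} {i : Fin (k - 1)} {i' : Fin (K - 1)}
    (hi : i.1 = p + i'.1) :
    Lower i b b' ↔ Lower i' (res h b) (res h b') ∧ AgreeOff p K b b' := by
  have h₁ : fstIdx i = (⟨p + (fstIdx i').1, by omega⟩ : Fin k) := Fin.ext hi
  have h₂ : sndIdx i = (⟨p + (sndIdx i').1, by omega⟩ : Fin k) :=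
    Fin.ext (by simp [sndIdx]; omega)
  have h₃ : ∀ (s : Fin d) (b : Mat d k), res h (moveAt i s b) = moveAt i' s (res h b) := by
    intro s b
    funext r x
    have e₁ : (⟨p + x.1, by omega⟩ : Fin k) = sndIdx i ↔ x = sndIdx i' := by
      rw [h₂, Fin.ext_iff, Fin.ext_iff]; simp
    have e₂ : (⟨p + x.1, by omega⟩ : Fin k) = fstIdx i ↔ x = fstIdx i' := by
      rw [h₁, Fin.ext_iff, Fin.ext_iff]; simp
    rw [moveAt_apply, res, moveAt_apply]
    simp only [e₁, e₂]; rfl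
  have h₄ : ∀ (s : Fin d) (b : Mat d k), AgreeOff p K b (moveAt i s b) := by
    intro s b r x hx
    have e₁ : x ≠ sndIdx i := by
      rintro rfl; simp [sndIdx] at hx; omega
    have e₂ : x ≠ fstIdx i := by
      rintro rfl; simp [fstIdx] at hx; omega
    rw [moveAt_apply]; simp [e₁, e₂]
  constructor
  · rintro ⟨s, H⟩
    refine ⟨⟨s, ?_, ?_, ?_, ?_, ?_⟩, by rw [H.eq_move]; exact h₄ s b⟩
    · have := H.fst_eq; rwa [h₁] at this
    · have := H.snd_eq; rwa [h₂] at this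
    · rw [H.eq_move, h₃]
    · simp only [ht_res h b hi]; exact H.le
    · simp only [ht_res h b hi]; exact H.lt
  · rintro ⟨⟨s, H⟩, hoff⟩
    refine ⟨s, ?_, ?_, ?_, ?_, ?_⟩
    · rw [h₁]; exact H.fst_eq
    · rw [h₂]; exact H.snd_eq
    · refine eq_of_res h (by rw [H.eq_move, h₃]) (hoff.symm.trans (h₄ s b))
    · have := H.le; simpa only [ht_res h b hi] using this
    · have := H.lt; simpa only [ht_res h b hi] using this

theorem conn_res (h : p + K ≤ k) {b b' : Mat d k}
    (hc : Connected (tensorPow (vecCrystal k) d) p (p + K - 1) b b') :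
    Conn (rowR d K) (res h b) (res h b') ∧ AgreeOff p K b b' := by
  induction hc with
  | refl x => exact ⟨.refl _, fun _ _ _ => rfl⟩
  | symm x y _ ih => exact ⟨ih.1.symm, ih.2.symm⟩
  | trans x y z _ _ ih₁ ih₂ => exact ⟨ih₁.1.trans ih₂.1, ih₁.2.trans ih₂.2⟩
  | rel x y hxy =>
    obtain ⟨i, hi₁, hi₂, hi⟩ := hxy
    have := (lower_iff_res h (i' := ⟨i.1 - p, by omega⟩) (by simp; omega)).1
      ((tensorPow_f_iff i x y).1 hi)
    exact ⟨.single this.1, this.2⟩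

theorem connected_ins (h : p + K ≤ k) (b : Mat d k) {y y' : Mat d K} (hc : Conn (rowR d K) y y') :
    Connected (tensorPow (vecCrystal k) d) p (p + K - 1) (ins p b y) (ins p b y') := by
  induction hc with
  | refl x => exact .refl _
  | symm x y _ ih => exact ih.symm
  | trans x y z _ _ ih₁ ih₂ => exact ih₁.trans _ _ _ ih₂
  | rel x y hxy =>
    obtain ⟨i, hi⟩ := hxy
    refine .rel _ _ ⟨⟨p + i.1, by omega⟩, by simp, by simp; omega, ?_⟩
    rw [tensorPow_f_iff, lower_iff_res h (i' := i) rfl, res_ins, res_ins]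
    exact ⟨hi, (agreeOff_ins _ _).symm.trans (agreeOff_ins _ _)⟩

theorem uniqueHighest_tensorPow_res (h : p + K ≤ k) :
    UniqueHighest (tensorPow (vecCrystal k) d) p (p + K - 1) := by
  intro b c hbc hb hc
  obtain ⟨h₁, h₂⟩ := conn_res h hbc
  have key : ∀ b : Mat d k, (∀ i : Fin (k - 1), p ≤ i.1 → i.1 < p + K - 1 →
      (tensorPow (vecCrystal k) d).e i b = none) → IsHigh (rowR d K) (res h b) := by
    intro b hb i z hz
    have := hb ⟨p + i.1, by omega⟩ (by simp) (by simp; omega)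
    rw [tensorPow_e_eq_none_iff] at this
    refine this (ins p b z) ((lower_iff_res h (i' := i) rfl).2 ⟨?_, (agreeOff_ins _ _).symm⟩)
    rw [res_ins]; exact hz
  exact eq_of_res h ((doubleCrystal d K).high_unique h₁ (key b hb) (key c hc)) h₂

theorem cnt_ins (h : p + K ≤ k) (b : Mat d k) (y : Mat d K) (x : Fin K) (t : ℕ) :
    cnt (ins p b y) ⟨p + x.1, by omega⟩ t = cnt y x t := by
  conv_rhs => rw [← res_ins h b y]
  rfl

/-- The involution of a subdiagram is the full involution applied inside the window of columns.
Since K is positive, the window ends at the column p + K - 1. -/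
theorem isSchutzenberger_ins (h : p + K ≤ k) (hK : 0 < K) {ζ : Mat d K → Mat d K}
    (hζ : IsSchutzenberger (tensorPow (vecCrystal K) d) 0 (K - 1) ζ) :
    IsSchutzenberger (tensorPow (vecCrystal k) d) p (p + K - 1)
      (fun b => ins p b (ζ (res h b))) := by
  have hinsins : ∀ (b : Mat d k) (y z : Mat d K), ins p (ins p b y) z = ins p b z := by
    intro b y z
    funext s x
    simp only [ins]; split_ifs <;> rfl
  have hy : ∀ (b y : Mat d k), AgreeOff p K b y → ins p b (res h y) = y := fun b y hby =>
    eq_of_res h (res_ins h _ _) ((agreeOff_ins _ _).symm.trans hby)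
  constructor
  · intro b
    have := connected_ins h b (conn_of_connected (hζ.connected (res h b)))
    rwa [ins_res] at this
  · intro i j hi₁ hi₂ hij b
    have hi : i.1 = p + (⟨i.1 - p, by omega⟩ : Fin (K - 1)).1 := by simp; omega
    have hj : j.1 = p + (⟨j.1 - p, by omega⟩ : Fin (K - 1)).1 := by simp; omega
    have H := hζ.e_comm ⟨i.1 - p, by omega⟩ ⟨j.1 - p, by omega⟩ (Nat.zero_le _) (by simp; omega)
      (by simp; omega) (res h b)
    ext y
    rw [tensorPow_e_iff, lower_iff_res h hi, res_ins, ← tensorPow_e_iff, H, Option.map_eq_some_iff,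
      Option.map_eq_some_iff]
    simp only [tensorPow_f_iff]
    constructor
    · rintro ⟨⟨c, hc, hcy⟩, hoff⟩
      refine ⟨ins p b c, ?_, ?_⟩
      · rw [lower_iff_res h hj, res_ins]
        exact ⟨hc, agreeOff_ins _ _⟩
      · rw [res_ins, hcy, hinsins]
        exact hy b y ((agreeOff_ins _ _).trans hoff.symm)
    · rintro ⟨b', hb', rfl⟩
      rw [lower_iff_res h hj] at hb'
      refine ⟨⟨res h b', hb'.1, by rw [res_ins]⟩, ?_⟩
      exact (agreeOff_ins _ _).symm.trans (hb'.2.symm.trans (agreeOff_ins _ _))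
  · intro i j hi₁ hi₂ hij b
    have hi : i.1 = p + (⟨i.1 - p, by omega⟩ : Fin (K - 1)).1 := by simp; omega
    have hj : j.1 = p + (⟨j.1 - p, by omega⟩ : Fin (K - 1)).1 := by simp; omega
    have H := hζ.f_comm ⟨i.1 - p, by omega⟩ ⟨j.1 - p, by omega⟩ (Nat.zero_le _) (by simp; omega)
      (by simp; omega) (res h b)
    ext y
    rw [tensorPow_f_iff, lower_iff_res h hi, res_ins, ← tensorPow_f_iff, H, Option.map_eq_some_iff,
      Option.map_eq_some_iff]
    simp only [tensorPow_e_iff]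
    constructor
    · rintro ⟨⟨c, hc, hcy⟩, hoff⟩
      refine ⟨ins p b c, ?_, ?_⟩
      · rw [lower_iff_res h hj, res_ins]
        exact ⟨hc, (agreeOff_ins _ _).symm⟩
      · rw [res_ins, hcy, hinsins]
        exact hy b y ((agreeOff_ins _ _).trans hoff)
    · rintro ⟨b', hb', rfl⟩
      rw [lower_iff_res h hj] at hb'
      refine ⟨⟨res h b', hb'.1, by rw [res_ins]⟩, ?_⟩
      exact (agreeOff_ins _ _).symm.trans (hb'.2.symm.trans (agreeOff_ins _ _))
  · intro x y hx₁ hx₂ hxy b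
    have hxK : x.1 - p < K := by omega
    have hyK : y.1 - p < K := by omega
    have H := hζ.wt_inside ⟨x.1 - p, hxK⟩ ⟨y.1 - p, hyK⟩ (Nat.zero_le _) (by simp; omega)
      (by simp; omega) (res h b)
    rw [tensorPow_wt, tensorPow_wt] at H ⊢
    have ex : x = ⟨p + (⟨x.1 - p, hxK⟩ : Fin K).1, by simp; omega⟩ := Fin.ext (by simp; omega)
    have ey : y = ⟨p + (⟨y.1 - p, hyK⟩ : Fin K).1, by simp; omega⟩ := Fin.ext (by simp; omega)
    rw [ex, cnt_ins h, H]
    exact congrArg (fun z => cnt b z d) ey.symm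
  · intro x hx b
    rw [tensorPow_wt, tensorPow_wt]
    exact cnt_congr fun s _ => agreeOff_ins b _ s x (by omega)

end GLCrystal

namespace GLCrystal

variable {d k n m : ℕ} {μ : YoungDiagram}

/-! ## Tableaux and highest weight matrices -/

open Classical in
/-- The `n × m`-matrix of a tableau: column `j` is the indicator vector of column `j` of `T`. -/
noncomputable def matT (m : ℕ) (T : Tableau n μ) : Mat n m :=
  fun a j => decide (T.InCol j.1 a.1)

theorem matT_eq_true_iff {T : Tableau n μ} {a : Fin n} {j : Fin m} :
    matT m T a j = true ↔ T.InCol j.1 a.1 := by simp [matT]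

theorem cnt_eq_card (b : Mat d k) (x : Fin k) (t : ℕ) :
    cnt b x t = ((Finset.univ.filter fun s : Fin d => s.1 < t ∧ b s x = true).card : ℤ) := by
  rw [cnt, ← Finset.filter_filter]
  exact Finset.sum_boole _ _

/-- Columns of a tableau are strictly increasing, so positions in a column correspond one to one to
ones of the matrix. -/
theorem cnt_matT (T : Tableau n μ) (j : Fin m) (t : ℕ) :
    cnt (matT m T) j t =
      (((Finset.range (μ.colLen j.1)).filter fun i => T.1 i j.1 < t).card : ℤ) := by
  rw [cnt_eq_card, Nat.cast_inj]
  symm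
  have hmem : ∀ i, i < μ.colLen j.1 → (i, j.1) ∈ μ := fun i hi => YoungDiagram.mem_iff_lt_colLen.2 hi
  refine Finset.card_bij (fun i hi => ⟨T.1 i j.1, T.2 i j.1 (hmem i (by simp at hi; exact hi.1))⟩)
    ?_ ?_ ?_
  · intro i hi
    simp only [Finset.mem_filter, Finset.mem_range] at hi
    simp only [Finset.mem_filter, Finset.mem_univ, true_and, matT_eq_true_iff]
    exact ⟨hi.2, i, hmem i hi.1, rfl⟩
  · intro i hi i' hi' h
    simp only [Finset.mem_filter, Finset.mem_range] at hi hi'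
    simp only [Fin.mk.injEq] at h
    rcases lt_trichotomy i i' with hlt | heq | hlt
    · exact absurd h (T.1.col_strict hlt (hmem _ hi'.1)).ne
    · exact heq
    · exact absurd h (T.1.col_strict hlt (hmem _ hi.1)).ne'
  · intro a ha
    simp only [Finset.mem_filter, Finset.mem_univ, true_and, matT_eq_true_iff] at ha
    obtain ⟨hat, i, hi, hia⟩ := ha
    refine ⟨i, ?_, Fin.ext hia⟩
    simp only [Finset.mem_filter, Finset.mem_range]
    exact ⟨YoungDiagram.mem_iff_lt_colLen.1 hi, by rw [hia]; exact hat⟩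

/-- Rows increase weakly and columns shorten to the right, so column j has at least as many entries
below any bound as column j+1. This is the ballot condition. -/
theorem isHigh_matT (T : Tableau n μ) : IsHigh (rowR n m) (matT m T) := by
  rw [isHigh_iff]
  intro i t _
  rw [cnt_matT, cnt_matT, Nat.cast_le]
  refine Finset.card_le_card fun a ha => ?_
  simp only [Finset.mem_filter, Finset.mem_range] at ha ⊢
  have hlt : (fstIdx i).1 < (sndIdx i).1 := by simp [fstIdx, sndIdx]
  exact ⟨ha.1.trans_le (μ.colLen_anti _ _ hlt.le),
    (T.1.row_weak hlt (YoungDiagram.mem_iff_lt_colLen.2 ha.1)).trans_lt ha.2⟩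

theorem rowWt_matT (T : Tableau n μ) (j : Fin m) : rowWt (matT m T) j = μ.colLen j.1 := by
  rw [rowWt, cnt_matT, Finset.filter_true_of_mem, Finset.card_range]
  intro i hi
  exact T.2 i j.1 (YoungDiagram.mem_iff_lt_colLen.2 (by simpa using hi))

theorem lt_of_mem_of_rowLen_le {i j : ℕ} (h : (i, j) ∈ μ) (hm : μ.rowLen 0 ≤ m) : j < m :=
  (YoungDiagram.mem_iff_lt_rowLen.1 h).trans_le ((μ.rowLen_anti 0 i (Nat.zero_le _)).trans hm)

theorem colLen_eq_zero_of_le (hm : μ.rowLen 0 ≤ m) {j : ℕ} (hj : m ≤ j) : μ.colLen j = 0 := by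
  by_contra h
  have : (0, j) ∈ μ := YoungDiagram.mem_iff_lt_colLen.2 (Nat.pos_of_ne_zero h)
  have := lt_of_mem_of_rowLen_le this hm
  omega

theorem youngDiagram_eq_of_colLen {μ ν : YoungDiagram} (h : ∀ j, μ.colLen j = ν.colLen j) :
    μ = ν := by
  apply YoungDiagram.ext
  ext ⟨i, j⟩
  rw [YoungDiagram.mem_cells, YoungDiagram.mem_cells, YoungDiagram.mem_iff_lt_colLen,
    YoungDiagram.mem_iff_lt_colLen, h]

theorem shape_eq_of_rowWt {μ ν : YoungDiagram} (hμ : μ.rowLen 0 ≤ m) (hν : ν.rowLen 0 ≤ m)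
    (T : Tableau n μ) (T' : Tableau n ν) (h : rowWt (matT m T) = rowWt (matT m T')) : μ = ν := by
  refine youngDiagram_eq_of_colLen fun j => ?_
  by_cases hj : j < m
  · have := congrFun h ⟨j, hj⟩
    rw [rowWt_matT, rowWt_matT] at this
    exact_mod_cast this
  · rw [colLen_eq_zero_of_le hμ (by omega), colLen_eq_zero_of_le hν (by omega)]

/-- A strictly increasing sequence of given length is determined by its set of values. -/
theorem matT_injective (hm : μ.rowLen 0 ≤ m) :
    Function.Injective (matT m : Tableau n μ → Mat n m) := by
  intro T T' h
  apply Subtype.ext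
  ext i j
  by_cases hij : (i, j) ∈ μ
  · have hj := lt_of_mem_of_rowLen_le hij hm
    have hmem : ∀ i : Fin (μ.colLen j), (i.1, j) ∈ μ := fun i =>
      YoungDiagram.mem_iff_lt_colLen.2 i.2
    have hcol : ∀ a, T.InCol j a ↔ T'.InCol j a := by
      intro a
      by_cases ha : a < n
      · have := congrFun (congrFun h ⟨a, ha⟩) ⟨j, hj⟩
        rw [Bool.eq_iff_iff, matT_eq_true_iff, matT_eq_true_iff] at this
        exact this
      · constructor
        · rintro ⟨i, hi, rfl⟩; exact absurd (T.2 i j hi) ha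
        · rintro ⟨i, hi, rfl⟩; exact absurd (T'.2 i j hi) ha
    have hmono : ∀ T : Tableau n μ, StrictMono (fun i : Fin (μ.colLen j) => T.1 i.1 j) :=
      fun T i i' hii => T.1.col_strict hii (hmem i')
    have hrange : ∀ T : Tableau n μ,
        Set.range (fun i : Fin (μ.colLen j) => T.1 i.1 j) = {a | T.InCol j a} := by
      intro T
      ext a
      constructor
      · rintro ⟨i, rfl⟩; exact ⟨i.1, hmem i, rfl⟩
      · rintro ⟨i, hi, rfl⟩; exact ⟨⟨i, YoungDiagram.mem_iff_lt_colLen.1 hi⟩, rfl⟩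
    have := (StrictMono.range_inj (hmono T) (hmono T')).1 (by
      rw [hrange, hrange]; ext a; exact hcol a)
    exact congrFun this ⟨i, YoungDiagram.mem_iff_lt_colLen.1 hij⟩
  · rw [T.1.zeros hij, T'.1.zeros hij]

theorem lt_card_of_lt_count {P : ℕ → Prop} [DecidablePred P] {i : ℕ} (h : i < Nat.count P n)
    (hf : (Set.ofPred P).Finite) : i < hf.toFinset.card := by
  refine h.trans_le ?_
  rw [Nat.count_eq_card_filter_range]
  refine Finset.card_le_card fun a ha => ?_
  rw [Set.Finite.mem_toFinset]
  exact (Finset.mem_filter.1 ha).2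

-- Converse of `isHigh_matT`: column j of the tableau lists, in increasing order, the rows in which
-- column j of the matrix has a one. The ballot condition at the full height makes the column
-- lengths a partition, and at smaller heights it makes the rows weakly increasing.
open Classical in
theorem exists_matT {M : Mat n m} (hM : IsHigh (rowR n m) M) :
    ∃ (μ : YoungDiagram) (T : Tableau n μ), μ.rowLen 0 ≤ m ∧ matT m T = M := by
  let P : ℕ → ℕ → Prop := fun j a => ∃ (ha : a < n) (hj : j < m), M ⟨a, ha⟩ ⟨j, hj⟩ = true
  have hPn : ∀ {j a}, P j a → a < n := fun h => h.1
  have hcount : ∀ (j : ℕ) (hj : j < m) (t : ℕ), t ≤ n →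
      (Nat.count (P j) t : ℤ) = cnt M ⟨j, hj⟩ t := by
    intro j hj t
    induction t with
    | zero => intro _; simp [cnt_zero]
    | succ t ih =>
      intro htn
      have h₁ := cnt_succ M ⟨j, hj⟩ ⟨t, htn⟩
      simp only at h₁
      rw [Nat.count_succ, h₁, Nat.cast_add, ih (by omega)]
      congr 1
      by_cases hP : P j t
      · rw [if_pos hP, hP.2.2]; rfl
      · have : M ⟨t, htn⟩ ⟨j, hj⟩ = false := by
          by_contra hcon
          exact hP ⟨htn, hj, by simpa using hcon⟩
        rw [if_neg hP, this]; rfl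
  have hanti : ∀ j j' t, j ≤ j' → j' < m → t ≤ n → Nat.count (P j') t ≤ Nat.count (P j) t := by
    intro j j' t hjj hj' ht
    have := cnt_anti_of_high hM (x := ⟨j, by omega⟩) (y := ⟨j', hj'⟩) hjj ht
    rw [← hcount, ← hcount] at this
    · exact_mod_cast this
    · exact ht
    · exact ht
  let cells : Finset (ℕ × ℕ) :=
    (Finset.range n ×ˢ Finset.range m).filter fun x => x.1 < Nat.count (P x.2) n
  have hcells : ∀ i j, (i, j) ∈ cells ↔ j < m ∧ i < Nat.count (P j) n := by
    intro i j
    simp only [cells, Finset.mem_filter, Finset.mem_product, Finset.mem_range]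
    have := Nat.count_le (p := P j) (n := n)
    constructor
    · rintro ⟨⟨_, h₂⟩, h₃⟩; exact ⟨h₂, h₃⟩
    · rintro ⟨h₁, h₂⟩; exact ⟨⟨by omega, h₁⟩, h₂⟩
  let μ : YoungDiagram := ⟨cells, by
    rintro ⟨i, j⟩ ⟨i', j'⟩ hle hmem
    rw [Finset.mem_coe, hcells] at hmem ⊢
    have h₁ : i' ≤ i := hle.1
    have h₂ : j' ≤ j := hle.2
    exact ⟨by omega, h₁.trans_lt (hmem.2.trans_le (hanti j' j n h₂ hmem.1 le_rfl))⟩⟩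
  have hμ : ∀ i j, (i, j) ∈ μ ↔ j < m ∧ i < Nat.count (P j) n := fun i j => by
    rw [← hcells]; exact Iff.rfl
  have hnth : ∀ {i j}, (i, j) ∈ μ → P j (Nat.nth (P j) i) := fun {i j} h =>
    Nat.nth_mem i (lt_card_of_lt_count ((hμ i j).1 h).2)
  let T : SemistandardYoungTableau μ :=
    { entry := fun i j => if (i, j) ∈ μ then Nat.nth (P j) i else 0
      row_weak' := by
        intro i j j' hjj hmem
        have hmem' : (i, j) ∈ μ := μ.up_left_mem le_rfl hjj.le hmem
        rw [if_pos hmem, if_pos hmem']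
        have h₁ := hnth hmem
        -- Up to and including the row named by entry (i, j'), column j' has i + 1 ones. Column j
        -- has at least as many there, so its entry number i is no larger.
        refine Nat.lt_succ_iff.1 (Nat.nth_lt_of_lt_count ?_)
        refine lt_of_lt_of_le ?_ (hanti j j' _ hjj.le ((hμ i j').1 hmem).1 (hPn h₁))
        rw [Nat.count_succ, if_pos h₁,
          Nat.count_nth (lt_card_of_lt_count ((hμ i j').1 hmem).2)]
        omega
      col_strict' := by
        intro i i' j hii hmem
        rw [if_pos hmem, if_pos (μ.up_left_mem hii.le le_rfl hmem)]
        exact Nat.nth_lt_nth' hii (lt_card_of_lt_count ((hμ i' j).1 hmem).2)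
      zeros' := fun h => if_neg h }
  have hT : ∀ i j, (i, j) ∈ μ → T i j = Nat.nth (P j) i := fun i j h => if_pos h
  refine ⟨μ, ⟨T, fun i j h => by rw [hT i j h]; exact hPn (hnth h)⟩, ?_, ?_⟩
  · by_contra hlt
    have := YoungDiagram.mem_iff_lt_rowLen.2 (not_le.1 hlt)
    rw [hμ] at this
    omega
  · funext a j
    refine Bool.eq_iff_iff.2 (matT_eq_true_iff.trans ?_)
    constructor
    · rintro ⟨i, hi, hia⟩
      change T i j.1 = a.1 at hia
      rw [hT i j.1 hi] at hia
      have := hnth hi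
      rw [hia] at this
      exact this.2.2
    · intro h
      have hP : P j.1 a.1 := ⟨a.2, j.2, h⟩
      have hmem : (Nat.count (P j.1) a.1, j.1) ∈ μ := by
        rw [hμ]
        exact ⟨j.2, Nat.count_strict_mono hP a.2⟩
      refine ⟨Nat.count (P j.1) a.1, hmem, ?_⟩
      change T _ _ = _
      rw [hT _ _ hmem, Nat.nth_count hP]

theorem le_entry (T : Tableau n μ) {i j : ℕ} (h : (i, j) ∈ μ) : i ≤ T.1 i j := by
  induction i with
  | zero => exact Nat.zero_le _
  | succ i ih =>
    have := ih (μ.up_left_mem (Nat.le_succ i) le_rfl h)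
    exact this.trans_lt (T.1.col_strict (Nat.lt_succ_self i) h)

theorem colLen_le (T : Tableau n μ) : μ.colLen 0 ≤ n := by
  by_contra h
  have h₁ := YoungDiagram.mem_iff_lt_colLen.2 (not_le.1 h)
  exact absurd (T.2 _ _ h₁) (not_lt.2 (le_entry T h₁))

/-- The number of ones in a matrix. -/
def ones (M : Mat n m) : ℕ := (Finset.univ.filter fun x : Fin n × Fin m => M x.1 x.2).card

theorem ones_matT (T : Tableau n μ) (hm : μ.rowLen 0 ≤ m) : ones (matT m T) = μ.card := by
  symm
  refine Finset.card_bij (fun x hx => (⟨T.1 x.1 x.2, T.2 _ _ hx⟩,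
    ⟨x.2, lt_of_mem_of_rowLen_le (i := x.1) hx hm⟩)) ?_ ?_ ?_
  · rintro ⟨i, j⟩ hx
    simp only [Finset.mem_filter, Finset.mem_univ, true_and, matT_eq_true_iff]
    exact ⟨i, hx, rfl⟩
  · rintro ⟨i, j⟩ hx ⟨i', j'⟩ hx' h
    simp only [Prod.mk.injEq, Fin.mk.injEq] at h ⊢
    obtain ⟨h, rfl⟩ := h
    refine ⟨?_, rfl⟩
    rcases lt_trichotomy i i' with hlt | heq | hlt
    · exact absurd h (T.1.col_strict hlt hx').ne
    · exact heq
    · exact absurd h (T.1.col_strict hlt hx).ne'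
  · rintro ⟨a, j⟩ ha
    simp only [Finset.mem_filter, Finset.mem_univ, true_and, matT_eq_true_iff] at ha
    obtain ⟨i, hi, hia⟩ := ha
    exact ⟨(i, j.1), hi, by simp only [Prod.mk.injEq, Fin.ext_iff]; exact ⟨hia, trivial⟩⟩

/-- Column operators preserve row-highestness and the column sums; the former yields a tableau, the
latter its shape. -/
theorem exists_matT_of_conn (hm : μ.rowLen 0 ≤ m) (T : Tableau n μ) {X : Mat n m}
    (h : Conn (colR n m) (matT m T) X) : ∃ T' : Tableau n μ, matT m T' = X := by
  have D := doubleCrystal n m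
  obtain ⟨ν, T', hν, rfl⟩ := exists_matT (D.isHigh_of_conn h (isHigh_matT T))
  obtain rfl := shape_eq_of_rowWt hm hν T T' (D.wr_conn h)
  exact ⟨T', rfl⟩

theorem isStable_tab (μ : YoungDiagram) : IsStable (tensorPow (vecCrystal n) (μ.rowLen 0))
    (fun T : Tableau n μ => tau (matT (μ.rowLen 0) T)) where
  inj := fun T T' h => matT_injective le_rfl (tau_injective h)
  e_mem i T x h := by
    obtain ⟨X, rfl⟩ := tau_surjective x
    rw [tensorPow_e_iff] at h
    obtain ⟨T', rfl⟩ := exists_matT_of_conn le_rfl T (Conn.single (r := colR _ _) h).symm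
    exact ⟨T', rfl⟩
  f_mem i T x h := by
    obtain ⟨X, rfl⟩ := tau_surjective x
    rw [tensorPow_f_iff] at h
    obtain ⟨T', rfl⟩ := exists_matT_of_conn le_rfl T (Conn.single (r := colR _ _) h)
    exact ⟨T', rfl⟩

theorem tabCrystal_eq (n : ℕ) (μ : YoungDiagram) : tabCrystal n μ =
    pullback (tensorPow (vecCrystal n) (μ.rowLen 0))
      (fun T : Tableau n μ => tau (matT (μ.rowLen 0) T)) := rfl

theorem isCrystal_tab (n : ℕ) (μ : YoungDiagram) : IsCrystal (tabCrystal n μ) := by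
  rw [tabCrystal_eq]
  exact (isStable_tab μ).isCrystal (isCrystal_tensorPow _ _)

/-! ### Padding by zero factors -/

/-- `B` consists of `e` zero rows followed by the rows of `b`. -/
structure IsPad {D : ℕ} (e : ℕ) (b : Mat d k) (B : Mat D k) : Prop where
  len : D = e + d
  zero : ∀ (s : Fin D), s.1 < e → ∀ x, B s x = false
  eq : ∀ (s : Fin d) (s' : Fin D), s'.1 = e + s.1 → B s' = b s

theorem IsPad.cnt_lt {D e : ℕ} {b : Mat d k} {B : Mat D k} (h : IsPad e b B) (x : Fin k) {t : ℕ}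
    (hte : t ≤ e) : cnt B x t = 0 := by
  refine Finset.sum_eq_zero fun s hs => ?_
  rw [h.zero s (by simp at hs; omega)]; rfl

theorem IsPad.cnt_add {D e : ℕ} {b : Mat d k} {B : Mat D k} (h : IsPad e b B) (x : Fin k) {t : ℕ}
    (htd : t ≤ d) : cnt B x (e + t) = cnt b x t := by
  induction t with
  | zero => rw [Nat.add_zero, h.cnt_lt x le_rfl, cnt_zero]
  | succ t ih =>
    have hl := h.len
    have h₁ := cnt_succ B x ⟨e + t, by omega⟩
    have h₂ := cnt_succ b x ⟨t, htd⟩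
    rw [h.eq ⟨t, htd⟩ ⟨e + t, by omega⟩ rfl] at h₁
    simp only at h₁ h₂
    rw [← add_assoc, h₁, h₂, ih (by omega)]

theorem IsPad.ht_lt {D e : ℕ} {b : Mat d k} {B : Mat D k} (h : IsPad e b B) (i : Fin (k - 1)) {t : ℕ}
    (hte : t ≤ e) : ht B i t = 0 := by
  rw [ht, h.cnt_lt _ hte, h.cnt_lt _ hte, sub_zero]

theorem IsPad.ht_add {D e : ℕ} {b : Mat d k} {B : Mat D k} (h : IsPad e b B) (i : Fin (k - 1))
    {t : ℕ} (htd : t ≤ d) : ht B i (e + t) = ht b i t := by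
  rw [ht, h.cnt_add _ htd, h.cnt_add _ htd]; rfl

/-- Leading zero rows prepend a flat stretch at height 0 to the path, which moves the last maximum
only by a shift. -/
theorem IsPad.lower_iff {D e : ℕ} {b b' : Mat d k} {B B' : Mat D k} (h : IsPad e b B)
    (h' : IsPad e b' B') (i : Fin (k - 1)) : Lower i B B' ↔ Lower i b b' := by
  have hl := h.len
  have hmove : ∀ (s : Fin d) (s' : Fin D), s'.1 = e + s.1 →
      (B' = moveAt i s' B ↔ b' = moveAt i s b) := by
    intro s s' hs
    constructor
    · intro hB
      funext r x
      have := congrFun (congrFun hB ⟨e + r.1, by omega⟩) x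
      rw [h'.eq r _ rfl, moveAt_apply, h.eq r _ rfl] at this
      rw [this, moveAt_apply]
      have e₁ : (⟨e + r.1, by omega⟩ : Fin D) = s' ↔ r = s := by
        rw [Fin.ext_iff, Fin.ext_iff, hs]; simp
      simp only [e₁]
    · intro hb
      funext r x
      by_cases hr : r.1 < e
      · rw [h'.zero r hr, moveAt_of_ne i (by rw [ne_eq, Fin.ext_iff]; omega), h.zero r hr]
      · have hr' : r.1 = e + (⟨r.1 - e, by omega⟩ : Fin d).1 := by simp; omega
        rw [h'.eq _ r hr', hb, moveAt_apply, moveAt_apply, h.eq _ r hr']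
        have e₁ : r = s' ↔ (⟨r.1 - e, by omega⟩ : Fin d) = s := by
          rw [Fin.ext_iff, Fin.ext_iff, hs]; simp; omega
        simp only [e₁]
  constructor
  · rintro ⟨s', H⟩
    have hs' : e ≤ s'.1 := by
      by_contra hlt
      have h₁ := h.zero s' (by omega) (fstIdx i)
      rw [H.fst_eq] at h₁; cases h₁
    have hs : s'.1 = e + (⟨s'.1 - e, by omega⟩ : Fin d).1 := by simp; omega
    have hht : ht B i s'.1 = ht b i (s'.1 - e) := by
      rw [← h.ht_add i (t := s'.1 - e) (by omega)]; congr 1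
    refine ⟨⟨s'.1 - e, by omega⟩, ?_, ?_, (hmove _ _ hs).1 H.eq_move, ?_, ?_⟩
    · rw [← h.eq _ _ hs]; exact H.fst_eq
    · rw [← h.eq _ _ hs]; exact H.snd_eq
    · intro t ht₁
      simp only at ht₁ ⊢
      rw [← hht, ← h.ht_add i (by omega)]
      exact H.le _ (by omega)
    · intro t ht₁ ht₂
      simp only at ht₁ ⊢
      rw [← hht, ← h.ht_add i (by omega)]
      exact H.lt _ (by omega) (by omega)
  · rintro ⟨s, H⟩
    have hs : (⟨e + s.1, by omega⟩ : Fin D).1 = e + s.1 := rfl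
    refine ⟨⟨e + s.1, by omega⟩, ?_, ?_, (hmove _ _ hs).2 H.eq_move, ?_, ?_⟩
    · rw [h.eq _ _ hs]; exact H.fst_eq
    · rw [h.eq _ _ hs]; exact H.snd_eq
    · intro t ht₁
      simp only at ht₁ ⊢
      rw [h.ht_add i s.2.le]
      by_cases hte : t ≤ e
      · rw [h.ht_lt i hte, ← ht_zero b i]
        exact H.le 0 (Nat.zero_le _)
      · have := H.le (t - e) (by omega)
        rwa [← h.ht_add i (by omega), show e + (t - e) = t by omega] at this
    · intro t ht₁ ht₂
      simp only at ht₁ ⊢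
      rw [h.ht_add i s.2.le]
      have := H.lt (t - e) (by omega) (by omega)
      rwa [← h.ht_add i (by omega), show e + (t - e) = t by omega] at this

/-- A tableau is read with `μ.rowLen 0` factors, a matrix with m. The extra columns lie to the right
of the shape, are empty, and come first in right-to-left reading. -/
theorem isPad_matT (T : Tableau n μ) (hm : μ.rowLen 0 ≤ m) :
    IsPad (m - μ.rowLen 0) (tau (matT (μ.rowLen 0) T)) (tau (matT m T)) where
  len := by omega
  zero s hs x := by
    rw [tau, ← Bool.not_eq_true, matT_eq_true_iff]
    rintro ⟨i, hi, _⟩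
    have := lt_of_mem_of_rowLen_le hi le_rfl
    simp at this; omega
  eq s s' hs := by
    funext x
    have : s'.rev.1 = s.rev.1 := by simp; omega
    rw [tau, tau, Bool.eq_iff_iff, matT_eq_true_iff, matT_eq_true_iff, this]

theorem tabCrystal_f_iff (hm : μ.rowLen 0 ≤ m) (i : Fin (n - 1)) (T T' : Tableau n μ) :
    (tabCrystal n μ).f i T = some T' ↔ colR n m i (matT m T) (matT m T') := by
  rw [tabCrystal_eq, pullback_f_iff _ (isStable_tab μ).inj, tensorPow_f_iff]
  exact ((isPad_matT T hm).lower_iff (isPad_matT T' hm) i).symm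

theorem tabCrystal_e_iff (hm : μ.rowLen 0 ≤ m) (i : Fin (n - 1)) (T T' : Tableau n μ) :
    (tabCrystal n μ).e i T = some T' ↔ colR n m i (matT m T') (matT m T) := by
  rw [← (isCrystal_tab n μ).f_iff_e, tabCrystal_f_iff hm]

theorem tabCrystal_wt (hm : μ.rowLen 0 ≤ m) (T : Tableau n μ) :
    (tabCrystal n μ).wt T = colWt (matT m T) := by
  funext x
  change (tensorPow (vecCrystal n) (μ.rowLen 0)).wt (tau (matT (μ.rowLen 0) T)) x = _
  rw [tensorPow_wt, ← (isPad_matT T hm).cnt_add x le_rfl, ← (isPad_matT T hm).len]; rfl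

end GLCrystal

namespace GLCrystal

variable {N n m k : ℕ}

/-! ## Matrices with a fixed number of ones -/

theorem ones_eq_sum (M : Mat n m) : (ones M : ℤ) = ∑ x : Fin n × Fin m, bz (M x.1 x.2) :=
  (Finset.sum_boole _ _).symm

theorem ones_eq_sum_rowWt (M : Mat n m) : (ones M : ℤ) = ∑ x, rowWt M x := by
  rw [ones_eq_sum, Fintype.sum_prod_type_right]
  simp only [rowWt, cnt_eq_sum]

theorem ones_eq_sum_colWt (M : Mat n m) : (ones M : ℤ) = ∑ r, colWt M r := by
  rw [ones_eq_sum, Fintype.sum_prod_type]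
  refine Finset.sum_congr rfl fun r _ => ?_
  rw [colWt, cnt_tau_full, cnt_eq_sum]; rfl

theorem ones_of_conn_row {M X : Mat n m} (h : Conn (rowR n m) M X) : ones X = ones M := by
  have := (doubleCrystal n m).wc_conn h
  have h₁ := ones_eq_sum_colWt M
  rw [this, ← ones_eq_sum_colWt] at h₁
  exact_mod_cast h₁.symm

theorem ones_of_conn_col {M X : Mat n m} (h : Conn (colR n m) M X) : ones X = ones M := by
  have := (doubleCrystal n m).wr_conn h
  have h₁ := ones_eq_sum_rowWt M
  rw [this, ← ones_eq_sum_rowWt] at h₁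
  exact_mod_cast h₁.symm

theorem isStable_row (N n m : ℕ) :
    IsStable (tensorPow (vecCrystal m) n) (fun (M : LambdaB N n m) i => M.1 i) where
  inj M M' h := Subtype.ext h
  e_mem i M x h := by
    rw [tensorPow_e_iff] at h
    exact ⟨⟨x, (ones_of_conn_row (Conn.single (r := rowR n m) h).symm).trans M.2⟩, rfl⟩
  f_mem i M x h := by
    rw [tensorPow_f_iff] at h
    exact ⟨⟨x, (ones_of_conn_row (Conn.single (r := rowR n m) h)).trans M.2⟩, rfl⟩

theorem isStable_col (N n m : ℕ) :
    IsStable (tensorPow (vecCrystal n) m) (fun M : LambdaB N n m => tau M.1) where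
  inj M M' h := Subtype.ext (tau_injective h)
  e_mem i M x h := by
    obtain ⟨X, rfl⟩ := tau_surjective x
    rw [tensorPow_e_iff] at h
    exact ⟨⟨X, (ones_of_conn_col (Conn.single (r := colR n m) h).symm).trans M.2⟩, rfl⟩
  f_mem i M x h := by
    obtain ⟨X, rfl⟩ := tau_surjective x
    rw [tensorPow_f_iff] at h
    exact ⟨⟨X, (ones_of_conn_col (Conn.single (r := colR n m) h)).trans M.2⟩, rfl⟩

theorem colCrystal_eq (N n m : ℕ) : colCrystal N n m =
    pullback (tensorPow (vecCrystal n) m) (fun M : LambdaB N n m => tau M.1) := rfl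

theorem isCrystal_row (N n m : ℕ) : IsCrystal (rowCrystal N n m) :=
  (isStable_row N n m).isCrystal (isCrystal_tensorPow _ _)

theorem isCrystal_col (N n m : ℕ) : IsCrystal (colCrystal N n m) :=
  (isStable_col N n m).isCrystal (isCrystal_tensorPow _ _)

theorem rowCrystal_e_iff (i : Fin (m - 1)) (M M' : LambdaB N n m) :
    (rowCrystal N n m).e i M = some M' ↔ rowR n m i M'.1 M.1 := by
  rw [rowCrystal, pullback_e_iff _ (isStable_row N n m).inj, tensorPow_e_iff]; rfl

theorem colCrystal_e_iff (i : Fin (n - 1)) (M M' : LambdaB N n m) :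
    (colCrystal N n m).e i M = some M' ↔ colR n m i M'.1 M.1 := by
  rw [colCrystal_eq, pullback_e_iff _ (isStable_col N n m).inj, tensorPow_e_iff]; rfl

theorem colCrystal_f_iff (i : Fin (n - 1)) (M M' : LambdaB N n m) :
    (colCrystal N n m).f i M = some M' ↔ colR n m i M.1 M'.1 := by
  rw [(isCrystal_col N n m).f_iff_e, colCrystal_e_iff]

/-! ### The outer map is the partial Schützenberger involution -/

theorem uniqueHighest_partial (d : ℕ) {p q : Fin n} (hpq : p < q) :
    UniqueHighest (tensorPow (vecCrystal n) d) p.1 q.1 := by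
  have hpq' : p.1 < q.1 := hpq
  have := uniqueHighest_tensorPow_res (d := d) (k := n) (p := p.1) (K := q.1 - p.1 + 1) (by omega)
  rwa [show p.1 + (q.1 - p.1 + 1) - 1 = q.1 by omega] at this

/-- Rows p, …, q of M are a window of columns of `tau M`. In this window the involution is
`schutzMat ∘ rot`, which is the outer map. -/
theorem isSchutzenberger_outer (m : ℕ) {p q : Fin n} (hpq : p < q) :
    IsSchutzenberger (tensorPow (vecCrystal n) m) p.1 q.1
      (fun b : Mat m n => tau (sOuter p q (tau (rot b)))) := by
  have hpq' : p.1 < q.1 := hpq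
  have hK : p.1 + (q.1 - p.1 + 1) ≤ n := by omega
  have h := isSchutzenberger_ins (d := m) hK (Nat.succ_pos _)
    (isSchutzenberger_tau_schutzMat (q.1 - p.1 + 1) m)
  rw [show p.1 + (q.1 - p.1 + 1) - 1 = q.1 by omega] at h
  convert h using 1
  funext b
  obtain ⟨M, rfl⟩ := tau_surjective b
  rw [tau_rot_tau]
  have hsub : res hK (tau M) = tau (fun j : Fin (q.1 - p.1 + 1) => M ⟨p.1 + j.1, by omega⟩) := rfl
  rw [hsub, tau_rot_tau]
  -- Rotation reverses the order of the rows and reverses each row, and the latter is ξ of the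
  -- 0/1-vector.
  have hrot : rot (fun j : Fin (q.1 - p.1 + 1) => M ⟨p.1 + j.1, by omega⟩) =
      fun j : Fin (q.1 - p.1 + 1) => xi (vecCrystal m) (M ⟨q.1 - j.1, by omega⟩) := by
    funext j x
    rw [xi_vec, rot]
    have hj : (⟨p.1 + j.rev.1, by omega⟩ : Fin n) = ⟨q.1 - j.1, by omega⟩ :=
      Fin.ext (by simp only [Fin.val_rev]; omega)
    exact congrArg (fun r => M r x.rev) hj
  rw [hrot]
  funext s x
  simp only [tau, sOuter, tensorOuter, ins, xi_tensorPow]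
  by_cases hx : p ≤ x ∧ x ≤ q
  · have hx' : p.1 ≤ x.1 ∧ x.1 < p.1 + (q.1 - p.1 + 1) := by
      have := Fin.le_def.1 hx.1; have := Fin.le_def.1 hx.2; omega
    rw [dif_pos hx, dif_pos hx']
  · have hx' : ¬ (p.1 ≤ x.1 ∧ x.1 < p.1 + (q.1 - p.1 + 1)) := by
      rw [Fin.le_def, Fin.le_def] at hx; omega
    rw [dif_neg hx, dif_neg hx']

theorem uniqueHighest_col {p q : Fin n} (hpq : p < q) :
    UniqueHighest (colCrystal N n m) p.1 q.1 :=
  (isStable_col N n m).uniqueHighest (uniqueHighest_partial m hpq)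

theorem exists_schutzenberger_col {p q : Fin n} (hpq : p < q) :
    ∃ ξ, (∀ M : LambdaB N n m, (ξ M).1 = sOuter p q M.1) ∧
      IsSchutzenberger (colCrystal N n m) p.1 q.1 ξ := by
  obtain ⟨ξ, h₁, h₂⟩ := (isStable_col N n m).exists_schutzenberger (isCrystal_tensorPow _ _)
    (isSchutzenberger_outer m hpq)
  refine ⟨ξ, fun M => tau_injective ?_, h₂⟩
  exact (h₁ M).trans
    (congrArg (fun X : Mat n m => tau (sOuter p q X)) (tau_rot_tau (M.1 : Mat n m)))

theorem last_le {p q : Fin n} (_ : p < q) : q.1 ≤ n - 1 := by omega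

theorem isSchutzenberger_sInner {p q : Fin n} (hpq : p < q) :
    IsSchutzenberger (colCrystal N n m) p.1 q.1 (sInner p q) := by
  obtain ⟨ξ, _, h⟩ := exists_schutzenberger_col (N := N) (m := m) hpq
  rw [sInner, partialXi_eq (isCrystal_col N n m) (uniqueHighest_col hpq) (last_le hpq) h]
  exact h

theorem sOuter_eq_sInner {p q : Fin n} (hpq : p < q) (M : LambdaB N n m) :
    sOuter p q M.1 = (sInner p q M).1 := by
  obtain ⟨ξ, h₁, h⟩ := exists_schutzenberger_col (N := N) (m := m) hpq
  rw [sInner, partialXi_eq (isCrystal_col N n m) (uniqueHighest_col hpq) (last_le hpq) h, h₁]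

theorem sInner_sInner {p q : Fin n} (hpq : p < q) (M : LambdaB N n m) :
    sInner p q (sInner p q M) = M :=
  (isSchutzenberger_sInner hpq).involutive (isCrystal_col N n m) (uniqueHighest_col hpq)
    (last_le hpq) M

theorem exists_schutzenberger_tab (μ : YoungDiagram) {p q : Fin n} (hpq : p < q) :
    ∃ ξ, IsSchutzenberger (tabCrystal n μ) p.1 q.1 ξ := by
  obtain ⟨ξ, _, h⟩ := (isStable_tab (n := n) μ).exists_schutzenberger (isCrystal_tensorPow _ _)
    (isSchutzenberger_outer (μ.rowLen 0) hpq)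
  exact ⟨ξ, h⟩

theorem existsUnique_schutzenberger_tab (μ : YoungDiagram) {p q : Fin n} (hpq : p < q) :
    ∃! ξ, IsSchutzenberger (tabCrystal n μ) p.1 q.1 ξ :=
  existsUnique_schutzenberger (isCrystal_tab n μ)
    ((isStable_tab μ).uniqueHighest (uniqueHighest_partial _ hpq)) (last_le hpq)
    (exists_schutzenberger_tab μ hpq)

theorem isSchutzenberger_partialXi_tab (μ : YoungDiagram) {p q : Fin n} (hpq : p < q) :
    IsSchutzenberger (tabCrystal n μ) p.1 q.1 (partialXi (tabCrystal n μ) p.1 q.1) := by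
  have hex := exists_schutzenberger_tab μ hpq
  rw [partialXi, dif_pos hex]
  exact hex.choose_spec

/-! ### The action of the cactus group -/

theorem tensorOuter_congr {B : Type*} (C : CrystalData k B) {p q : Fin n} {b c : Fin n → B}
    (h : ∀ r, p ≤ r → r ≤ q → b r = c r) {r : Fin n} (hr : p ≤ r ∧ r ≤ q) :
    tensorOuter C p q b r = tensorOuter C p q c r := by
  have hpq : p.1 ≤ q.1 := (Fin.le_def.1 hr.1).trans (Fin.le_def.1 hr.2)
  have hbc : (fun j : Fin (q.1 - p.1 + 1) => xi C (b ⟨q.1 - j.1, by omega⟩)) =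
      fun j : Fin (q.1 - p.1 + 1) => xi C (c ⟨q.1 - j.1, by omega⟩) := by
    funext j
    rw [h ⟨q.1 - j.1, by omega⟩ (by rw [Fin.le_def]; simp only; omega)
      (by rw [Fin.le_def]; simp only; omega)]
  simp only [tensorOuter, dif_pos hr]
  rw [hbc]

theorem tensorOuter_of_not {B : Type*} (C : CrystalData k B) {p q : Fin n} (b : Fin n → B)
    {r : Fin n} (hr : ¬ (p ≤ r ∧ r ≤ q)) : tensorOuter C p q b r = b r :=
  dif_neg hr

theorem tensorOuter_comm {B : Type*} (C : CrystalData k B) {p q p' q' : Fin n} (h : q < p')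
    (b : Fin n → B) :
    tensorOuter C p q (tensorOuter C p' q' b) = tensorOuter C p' q' (tensorOuter C p q b) := by
  funext r
  by_cases h₁ : p ≤ r ∧ r ≤ q
  · have h₂ : ¬ (p' ≤ r ∧ r ≤ q') := fun hr => absurd (h₁.2.trans_lt h) (not_lt.2 hr.1)
    rw [tensorOuter_of_not C _ h₂]
    refine tensorOuter_congr C (fun s hs₁ hs₂ => ?_) h₁
    exact tensorOuter_of_not C _ fun hr => absurd (hs₂.trans_lt h) (not_lt.2 hr.1)
  · rw [tensorOuter_of_not C _ h₁]
    by_cases h₂ : p' ≤ r ∧ r ≤ q'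
    · refine tensorOuter_congr C (fun s hs₁ hs₂ => ?_) h₂
      exact (tensorOuter_of_not C _ fun hr => absurd (hr.2.trans_lt h) (not_lt.2 hs₁)).symm
    · rw [tensorOuter_of_not C _ h₂, tensorOuter_of_not C _ h₂, tensorOuter_of_not C _ h₁]

/-- Proved on the outer side: each outer map reads and changes only its own interval of rows, and
the intervals are disjoint. -/
theorem sInner_comm {p q p' q' : Fin n} (hpq : p < q) (hpq' : p' < q') (h : q < p')
    (M : LambdaB N n m) :
    sInner p q (sInner p' q' M) = sInner p' q' (sInner p q M) := by
  apply Subtype.ext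
  rw [← sOuter_eq_sInner hpq, ← sOuter_eq_sInner hpq', ← sOuter_eq_sInner hpq',
    ← sOuter_eq_sInner hpq]
  exact tensorOuter_comm (vecCrystal m) h _

/-- The conjugate of the inner involution by the outer one is a Schützenberger involution for the
reflected interval, hence the one by uniqueness. -/
theorem sInner_nested {p q p' q' p'' q'' : Fin n} (hpq : p < q) (hpq' : p' < q') (hpq'' : p'' < q'')
    (h₁ : p ≤ p') (h₂ : q' ≤ q) (h₃ : p'.1 + q''.1 = p.1 + q.1) (h₄ : q'.1 + p''.1 = p.1 + q.1)
    (M : LambdaB N n m) :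
    sInner p q (sInner p' q' M) = sInner p'' q'' (sInner p q M) := by
  have hconj := (isSchutzenberger_sInner (N := N) (m := m) hpq).conj (isCrystal_col N n m)
    (uniqueHighest_col hpq) (last_le hpq) (isSchutzenberger_sInner hpq') h₁ h₂ h₃ h₄ hpq'.le
  have := (isSchutzenberger_sInner (N := N) (m := m) hpq'').unique (isCrystal_col N n m)
    (uniqueHighest_col hpq'') (last_le hpq'') hconj
  rw [congrFun this (sInner p q M), sInner_sInner hpq]

/-- The permutation of `Λ^N B_{n,m}` given by a generator of the cactus group. -/
noncomputable def cactusPerm (N : ℕ) {n : ℕ} (m : ℕ) (a : CactusGen n) :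
    Equiv.Perm (LambdaB N n m) :=
  Function.Involutive.toPerm (sInner a.1.1 a.1.2) (sInner_sInner a.2)

theorem lift_cactusPerm (r : FreeGroup (CactusGen n)) (hr : r ∈ {r | CactusRel n r}) :
    FreeGroup.lift (cactusPerm N m) r = 1 := by
  have hr' : CactusRel n r := hr
  cases hr' with
  | invol a =>
    ext1 M
    rw [map_mul, FreeGroup.lift_apply_of]
    exact sInner_sInner a.2 M
  | nested a b c h₁ h₂ h₃ h₄ =>
    rw [map_mul, map_inv, mul_inv_eq_one, map_mul, map_mul, FreeGroup.lift_apply_of,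
      FreeGroup.lift_apply_of, FreeGroup.lift_apply_of]
    ext1 M
    exact sInner_nested a.2 b.2 c.2 h₁ h₂ h₃ h₄ M
  | disjoint a b h =>
    rw [map_mul, map_inv, mul_inv_eq_one, map_mul, map_mul, FreeGroup.lift_apply_of,
      FreeGroup.lift_apply_of]
    ext1 M
    exact sInner_comm a.2 b.2 h M

/-- The inner action of the cactus group. -/
noncomputable def cactusAction (N n m : ℕ) : CactusGroup n →* Equiv.Perm (LambdaB N n m) :=
  PresentedGroup.toGroup lift_cactusPerm

theorem cactusAction_cactusS {p q : Fin n} (h : p < q) (M : LambdaB N n m) :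
    cactusAction N n m (cactusS p q h) M = sInner p q M :=
  congrArg (fun g : Equiv.Perm (LambdaB N n m) => g M)
    (PresentedGroup.toGroup.of lift_cactusPerm (x := (⟨(p, q), h⟩ : CactusGen n)))

end GLCrystal

namespace GLCrystal

variable {N n m k : ℕ}

/-! ## Crystal skew Howe duality -/

/-- A map of crystals that commutes with all structure maps. -/
structure IsStrictMorphism {A B : Type*} (D : CrystalData k B) (C : CrystalData k A) (r : B → A) :
    Prop where
  wt : ∀ b, C.wt (r b) = D.wt b
  eps : ∀ i b, C.eps i (r b) = D.eps i b
  phi : ∀ i b, C.phi i (r b) = D.phi i b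
  e : ∀ i b, C.e i (r b) = (D.e i b).map r
  f : ∀ i b, C.f i (r b) = (D.f i b).map r

theorem IsStrictMorphism.connected {A B : Type*} {D : CrystalData k B} {C : CrystalData k A}
    {r : B → A} (h : IsStrictMorphism D C r) {p q : ℕ} {b c : B} (hbc : Connected D p q b c) :
    Connected C p q (r b) (r c) := by
  induction hbc with
  | refl x => exact .refl _
  | symm x y _ ih => exact ih.symm
  | trans x y z _ _ ih₁ ih₂ => exact ih₁.trans _ _ _ ih₂
  | rel x y hxy =>
    obtain ⟨i, h₁, h₂, h₃⟩ := hxy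
    exact .rel _ _ ⟨i, h₁, h₂, by rw [h.f, h₃]; rfl⟩

/-- A finite set covered by strict morphisms from crystals is a crystal. -/
theorem isCrystal_of_cover {A : Type*} [Finite A] {C : CrystalData k A} {ι : Type*}
    {B : ι → Type*} {D : ∀ s, CrystalData k (B s)} {r : ∀ s, B s → A}
    (hD : ∀ s, IsCrystal (D s)) (hr : ∀ s, IsStrictMorphism (D s) C (r s))
    (hcov : ∀ a, ∃ s b, r s b = a) : IsCrystal C where
  finite := inferInstance
  f_iff_e i a c := by
    constructor
    · obtain ⟨s, b, rfl⟩ := hcov a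
      rw [(hr s).f, Option.map_eq_some_iff]
      rintro ⟨b', hb', rfl⟩
      rw [(hr s).e, ((hD s).f_iff_e i b b').1 hb']; rfl
    · obtain ⟨s, b, rfl⟩ := hcov c
      rw [(hr s).e, Option.map_eq_some_iff]
      rintro ⟨b', hb', rfl⟩
      rw [(hr s).f, ((hD s).f_iff_e i b' b).2 hb']; rfl
  wt_e i a c := by
    obtain ⟨s, b, rfl⟩ := hcov a
    rw [(hr s).e, Option.map_eq_some_iff]
    rintro ⟨b', hb', rfl⟩
    rw [(hr s).wt, (hr s).wt, (hD s).wt_e i b b' hb']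
  wt_f i a c := by
    obtain ⟨s, b, rfl⟩ := hcov a
    rw [(hr s).f, Option.map_eq_some_iff]
    rintro ⟨b', hb', rfl⟩
    rw [(hr s).wt, (hr s).wt, (hD s).wt_f i b b' hb']
  eps_max i a := by
    obtain ⟨s, b, rfl⟩ := hcov a
    simp only [iterate_bind_map_ne_none_iff ((hr s).e i), (hr s).eps]
    exact (hD s).eps_max i b
  phi_max i a := by
    obtain ⟨s, b, rfl⟩ := hcov a
    simp only [iterate_bind_map_ne_none_iff ((hr s).f i), (hr s).phi]
    exact (hD s).phi_max i b
  phi_sub_eps i a := by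
    obtain ⟨s, b, rfl⟩ := hcov a
    rw [(hr s).phi, (hr s).eps, (hr s).wt]
    exact (hD s).phi_sub_eps i b

theorem IsSchutzenberger.of_cover {A : Type*} {C : CrystalData k A} {ι : Type*}
    {B : ι → Type*} {D : ∀ s, CrystalData k (B s)} {r : ∀ s, B s → A}
    (hr : ∀ s, IsStrictMorphism (D s) C (r s)) (hcov : ∀ a, ∃ s b, r s b = a) {p q : ℕ}
    {ζ : ∀ s, B s → B s} {ξ : A → A} (hξ : ∀ s b, ξ (r s b) = r s (ζ s b))
    (hζ : ∀ s, IsSchutzenberger (D s) p q (ζ s)) : IsSchutzenberger C p q ξ where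
  connected a := by
    obtain ⟨s, b, rfl⟩ := hcov a
    rw [hξ]
    exact (hr s).connected ((hζ s).connected b)
  e_comm i j h₁ h₂ h₃ a := by
    obtain ⟨s, b, rfl⟩ := hcov a
    rw [hξ, (hr s).e, (hζ s).e_comm i j h₁ h₂ h₃, (hr s).f, Option.map_map, Option.map_map]
    exact congrArg (fun g => ((D s).f j b).map g) (funext fun c => (hξ s c).symm)
  f_comm i j h₁ h₂ h₃ a := by
    obtain ⟨s, b, rfl⟩ := hcov a
    rw [hξ, (hr s).f, (hζ s).f_comm i j h₁ h₂ h₃, (hr s).e, Option.map_map, Option.map_map]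
    exact congrArg (fun g => ((D s).e j b).map g) (funext fun c => (hξ s c).symm)
  wt_inside x y h₁ h₂ h₃ a := by
    obtain ⟨s, b, rfl⟩ := hcov a
    rw [hξ, (hr s).wt, (hr s).wt]
    exact (hζ s).wt_inside x y h₁ h₂ h₃ b
  wt_outside x h₁ a := by
    obtain ⟨s, b, rfl⟩ := hcov a
    rw [hξ, (hr s).wt, (hr s).wt]
    exact (hζ s).wt_outside x h₁ b

/-- The inclusion of the first factor. -/
def inFst (s : Σ μ : BoxPartition N n m, Tableau m μ.1.transpose) (T : Tableau n s.1.1) :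
    Howe N n m := ⟨s.1, T, s.2⟩

/-- The inclusion of the second factor. -/
def inSnd (s : Σ μ : BoxPartition N n m, Tableau n μ.1) (T : Tableau m s.1.1.transpose) :
    Howe N n m := ⟨s.1, s.2, T⟩

theorem isStrictMorphism_inFst (s : Σ μ : BoxPartition N n m, Tableau m μ.1.transpose) :
    IsStrictMorphism (tabCrystal n s.1.1) (howeFst N n m) (inFst s) :=
  ⟨fun _ => rfl, fun _ _ => rfl, fun _ _ => rfl, fun _ _ => rfl, fun _ _ => rfl⟩

theorem isStrictMorphism_inSnd (s : Σ μ : BoxPartition N n m, Tableau n μ.1) :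
    IsStrictMorphism (tabCrystal m s.1.1.transpose) (howeSnd N n m) (inSnd s) :=
  ⟨fun _ => rfl, fun _ _ => rfl, fun _ _ => rfl, fun _ _ => rfl, fun _ _ => rfl⟩

theorem inFst_cover (x : Howe N n m) : ∃ s T, inFst s T = x := ⟨⟨x.1, x.2.2⟩, x.2.1, rfl⟩

theorem inSnd_cover (x : Howe N n m) : ∃ s T, inSnd s T = x := ⟨⟨x.1, x.2.1⟩, x.2.2, rfl⟩

theorem isSchutzenberger_howeInner {p q : Fin n} (hpq : p < q) :
    IsSchutzenberger (howeFst N n m) p.1 q.1 (howeInner p q) :=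
  .of_cover isStrictMorphism_inFst inFst_cover (fun _ _ => rfl)
    fun s => isSchutzenberger_partialXi_tab s.1.1 hpq

/-! ### The matrices of a pair of tableaux -/

/-- The row-highest matrix given by the first tableau. -/
noncomputable def matP (x : Howe N n m) : Mat n m := matT m x.2.1

/-- The column-lowest matrix given by the second tableau. -/
noncomputable def matQ (x : Howe N n m) : Mat n m := tau (matT n x.2.2)

theorem rowLen_transpose_le (μ : BoxPartition N n m) : μ.1.transpose.rowLen 0 ≤ n := by
  rw [YoungDiagram.rowLen_transpose]; exact μ.2.1

theorem isHigh_matP (x : Howe N n m) : IsHigh (rowR n m) (matP x) := isHigh_matT _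

theorem isLow_matQ (x : Howe N n m) : IsLow (colR n m) (matQ x) :=
  isLow_col_tau_iff.2 (isHigh_matT _)

theorem colWt_tau (Z : Mat m n) (r : Fin n) : colWt (tau Z) r = rowWt Z r.rev := by
  rw [colWt, tau_tau, cnt_rot _ _ le_rfl, Nat.sub_self, cnt_zero, sub_zero]; rfl

/-- The corner of a tableau's matrix is its shape upside down: column lowering keeps the column
sums, which are the column lengths of the shape. -/
theorem loMat_matT_iff {μ : YoungDiagram} (T : Tableau n μ) (r : Fin n) (c : Fin m) :
    loMat (matT m T) r c = true ↔ (r.rev.1, c.1) ∈ μ := by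
  have D := doubleCrystal n m
  have h : rowWt (matT m T) = rowWt (loMat (matT m T)) := D.wr_conn (D.conn_lo (matT m T))
  rw [bottomLeft_iff_rowWt (M := loMat (matT m T)) (D.isHigh_lo (isHigh_matT T))
    (D.isLow_lo _), ← h, rowWt_matT, Nat.cast_lt, YoungDiagram.mem_iff_lt_colLen]

theorem hiMat_tau_matT_iff {ν : YoungDiagram} (T : Tableau m ν) (r : Fin n) (c : Fin m) :
    hiMat (tau (matT n T)) r c = true ↔ (c.1, r.rev.1) ∈ ν := by
  have D := doubleCrystal n m
  have h : colWt (tau (matT n T)) = colWt (hiMat (tau (matT n T))) :=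
    D.wc_conn (D.conn_hi (tau (matT n T)))
  rw [bottomLeft_iff_colWt (M := hiMat (tau (matT n T))) (D.isHigh_hi _)
    (D.isLow_hi (isLow_col_tau_iff.2 (isHigh_matT T))), ← h, colWt_tau, rowWt_matT, Nat.cast_lt, YoungDiagram.mem_iff_lt_colLen]

theorem loMat_matP (x : Howe N n m) : loMat (matP x) = hiMat (matQ x) := by
  funext r c
  rw [Bool.eq_iff_iff, matP, matQ, loMat_matT_iff, hiMat_tau_matT_iff, YoungDiagram.mem_transpose]
  rfl

/-- Both corners display the shape of their tableau, one of them transposed, so equal corners force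
transposed shapes. -/
theorem eq_transpose {μ ν : YoungDiagram} (hμ : μ.rowLen 0 ≤ m) (hν : ν.rowLen 0 ≤ n)
    (T : Tableau n μ) (T' : Tableau m ν) (h : loMat (matT m T) = hiMat (tau (matT n T'))) :
    ν = μ.transpose := by
  have key : ∀ i j : ℕ, i < n → j < m → ((i, j) ∈ μ ↔ (j, i) ∈ ν) := by
    intro i j hi hj
    have h₁ := loMat_matT_iff T (Fin.rev ⟨i, hi⟩) (⟨j, hj⟩ : Fin m)
    rw [h, hiMat_tau_matT_iff, Fin.rev_rev] at h₁
    exact h₁.symm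
  have lt_of_mem : ∀ {l : ℕ} {κ : YoungDiagram} (_ : Tableau l κ) {i j : ℕ}, (i, j) ∈ κ → i < l :=
    fun {l κ} T {i j} hij => ((YoungDiagram.mem_iff_lt_colLen.1 hij).trans_le
      (κ.colLen_anti 0 j (Nat.zero_le _))).trans_le (colLen_le T)
  ext ⟨j, i⟩
  rw [YoungDiagram.mem_cells, YoungDiagram.mem_cells, YoungDiagram.mem_transpose]
  constructor
  · intro hji
    exact (key i j (lt_of_mem_of_rowLen_le hji hν) (lt_of_mem T' hji)).2 hji
  · intro hij
    exact (key i j (lt_of_mem T hij) (lt_of_mem_of_rowLen_le hij hμ)).1 hij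

/-- Both hi M and the turned lo M are row-highest, hence come from tableaux, and lo (hi M) = hi (lo
M) makes the shapes transposed. -/
theorem exists_howe (M : LambdaB N n m) :
    ∃ x : Howe N n m, matP x = hiMat M.1 ∧ matQ x = loMat M.1 := by
  have D := doubleCrystal n m
  obtain ⟨μ, T, hμ, hT⟩ := exists_matT (M := hiMat M.1) (D.isHigh_hi M.1)
  obtain ⟨Z, hZ⟩ := tau_surjective (loMat (M.1 : Mat n m))
  have hlow : IsLow (colR n m) (loMat (M.1 : Mat n m)) := D.isLow_lo M.1
  rw [← hZ, isLow_col_tau_iff] at hlow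
  obtain ⟨ν, T', hν, hT'⟩ := exists_matT hlow
  have hlh : loMat (hiMat (M.1 : Mat n m)) = hiMat (loMat (M.1 : Mat n m)) := D.lo_hi M.1
  obtain rfl := eq_transpose hμ hν T T' (by rw [hT, hT', hZ, hlh])
  have hcard : μ.card = N := by
    rw [← ones_matT T hμ, hT]
    exact (ones_of_conn_row (D.conn_hi M.1)).trans M.2
  exact ⟨⟨⟨μ, colLen_le T, hμ, hcard⟩, T, T'⟩, hT, (congrArg tau hT').trans hZ⟩

theorem howe_ext_of_shape {μ : BoxPartition N n m} {S T : Tableau n μ.1}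
    {S' T' : Tableau m μ.1.transpose} (h : matT m S = matT m T) (h' : matT n S' = matT n T') :
    (⟨μ, S, S'⟩ : Howe N n m) = ⟨μ, T, T'⟩ := by
  rw [matT_injective μ.2.2.1 h, matT_injective (rowLen_transpose_le μ) h']

theorem howe_ext {x y : Howe N n m} (h₁ : matP x = matP y) (h₂ : matQ x = matQ y) : x = y := by
  obtain ⟨⟨μ, hμ⟩, T, T'⟩ := x
  obtain ⟨⟨ν, hν⟩, S, S'⟩ := y
  obtain rfl : μ = ν := shape_eq_of_rowWt hμ.2.1 hν.2.1 T S (congrArg rowWt h₁)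
  exact howe_ext_of_shape h₁ (tau_injective h₂)

theorem exists_matrix (x : Howe N n m) :
    ∃ M : LambdaB N n m, hiMat M.1 = matP x ∧ loMat M.1 = matQ x := by
  have D := doubleCrystal n m
  obtain ⟨M, h₁, h₂⟩ := D.exists_hi_lo (isHigh_matP x) (isLow_matQ x) (loMat_matP x)
  refine ⟨⟨M, ?_⟩, h₁, h₂⟩
  have h₃ : Conn (rowR n m) M (matP x) := h₁ ▸ D.conn_hi M
  exact (ones_of_conn_row h₃).symm.trans ((ones_matT x.2.1 x.1.2.2.1).trans x.1.2.2.2)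

/-- The pair of tableaux of a matrix. -/
noncomputable def toHowe (M : LambdaB N n m) : Howe N n m := (exists_howe M).choose

theorem matP_toHowe (M : LambdaB N n m) : matP (toHowe M) = hiMat M.1 :=
  (exists_howe M).choose_spec.1

theorem matQ_toHowe (M : LambdaB N n m) : matQ (toHowe M) = loMat M.1 :=
  (exists_howe M).choose_spec.2

theorem toHowe_bijective : Function.Bijective (toHowe : LambdaB N n m → Howe N n m) := by
  constructor
  · intro M M' h
    apply Subtype.ext
    refine (doubleCrystal n m).ext_hi_lo ?_ ?_
    · exact (matP_toHowe M).symm.trans ((congrArg matP h).trans (matP_toHowe M'))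
    · exact (matQ_toHowe M).symm.trans ((congrArg matQ h).trans (matQ_toHowe M'))
  · intro x
    obtain ⟨M, h₁, h₂⟩ := exists_matrix x
    exact ⟨M, howe_ext ((matP_toHowe M).trans h₁) ((matQ_toHowe M).trans h₂)⟩

/-- Crystal skew Howe duality as a bijection. -/
noncomputable def howeEquiv (N n m : ℕ) : LambdaB N n m ≃ Howe N n m :=
  Equiv.ofBijective toHowe toHowe_bijective

theorem matP_howeEquiv (M : LambdaB N n m) : matP (howeEquiv N n m M) = hiMat M.1 := matP_toHowe M

theorem matQ_howeEquiv (M : LambdaB N n m) : matQ (howeEquiv N n m M) = loMat M.1 := matQ_toHowe M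

/-! ### The isomorphism -/

theorem finite_howe (N n m : ℕ) : Finite (Howe N n m) :=
  haveI := (isCrystal_col N n m).finite
  Finite.of_equiv _ (howeEquiv N n m)

theorem isCrystal_howeFst (N n m : ℕ) : IsCrystal (howeFst N n m) :=
  haveI := finite_howe N n m
  isCrystal_of_cover (fun _ => isCrystal_tab n _) isStrictMorphism_inFst inFst_cover

theorem isCrystal_howeSnd (N n m : ℕ) : IsCrystal (howeSnd N n m) :=
  haveI := finite_howe N n m
  isCrystal_of_cover (fun _ => isCrystal_tab m _) isStrictMorphism_inSnd inSnd_cover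

theorem howeFst_e_iff (i : Fin (n - 1)) (x y : Howe N n m) :
    (howeFst N n m).e i x = some y ↔ colR n m i (matP y) (matP x) ∧ matQ y = matQ x := by
  constructor
  · intro h
    obtain ⟨T, hT, rfl⟩ := Option.map_eq_some_iff.1 h
    exact ⟨(tabCrystal_e_iff x.1.2.2.1 i _ _).1 hT, rfl⟩
  · rintro ⟨h₁, h₂⟩
    obtain ⟨⟨μ, hμ⟩, T, T'⟩ := x
    obtain ⟨⟨ν, hν⟩, S, S'⟩ := y
    obtain rfl : ν = μ := shape_eq_of_rowWt hν.2.1 hμ.2.1 S T (rowWt_of_lower h₁).symm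
    obtain rfl : S' = T' := matT_injective (rowLen_transpose_le ⟨ν, hν⟩) (tau_injective h₂)
    exact Option.map_eq_some_iff.2 ⟨S, (tabCrystal_e_iff hν.2.1 i _ _).2 h₁, rfl⟩

theorem howeSnd_e_iff (i : Fin (m - 1)) (x y : Howe N n m) :
    (howeSnd N n m).e i x = some y ↔ rowR n m i (matQ y) (matQ x) ∧ matP y = matP x := by
  constructor
  · intro h
    obtain ⟨T, hT, rfl⟩ := Option.map_eq_some_iff.1 h
    exact ⟨(tabCrystal_e_iff (rowLen_transpose_le x.1) i _ _).1 hT, rfl⟩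
  · rintro ⟨h₁, h₂⟩
    obtain ⟨⟨μ, hμ⟩, T, T'⟩ := x
    obtain ⟨⟨ν, hν⟩, S, S'⟩ := y
    obtain rfl : ν = μ := shape_eq_of_rowWt hν.2.1 hμ.2.1 S T (congrArg rowWt h₂)
    obtain rfl : S = T := matT_injective hν.2.1 h₂
    exact Option.map_eq_some_iff.2
      ⟨S', (tabCrystal_e_iff (rowLen_transpose_le ⟨ν, hν⟩) i _ _).2 h₁, rfl⟩

theorem colCrystal_wt (M : LambdaB N n m) : (colCrystal N n m).wt M = colWt M.1 :=
  funext fun x => tensorPow_wt _ x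

theorem rowCrystal_wt (M : LambdaB N n m) : (rowCrystal N n m).wt M = rowWt M.1 :=
  funext fun x => tensorPow_wt _ x

/-- A column arrow on M is a column arrow on hi M with lo M fixed, that is, an arrow on the first
tableau with the second fixed. -/
theorem isCrystalIso_howeFst (N n m : ℕ) :
    IsCrystalIso (colCrystal N n m) (howeFst N n m) (howeEquiv N n m) := by
  have D := doubleCrystal n m
  refine isCrystalIso_of_e (isCrystal_col N n m) (isCrystal_howeFst N n m) (fun M => ?_)
    fun i M => ?_
  · have h : (howeFst N n m).wt (howeEquiv N n m M) = colWt (matP (howeEquiv N n m M)) :=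
      tabCrystal_wt (howeEquiv N n m M).1.2.2.1 _
    rw [h, matP_howeEquiv, colCrystal_wt]
    exact (D.wc_conn (D.conn_hi M.1)).symm
  · ext y
    obtain ⟨M', rfl⟩ := (howeEquiv N n m).surjective y
    rw [howeFst_e_iff, matP_howeEquiv, matP_howeEquiv, matQ_howeEquiv, matQ_howeEquiv,
      Option.map_eq_some_iff]
    simp only [EmbeddingLike.apply_eq_iff_eq, exists_eq_right, colCrystal_e_iff]
    exact ⟨fun h => D.c_of_hi h.1 h.2, fun h => ⟨D.c_hi h, D.lo_eq_of_conn (.single h)⟩⟩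

theorem isCrystalIso_howeSnd (N n m : ℕ) :
    IsCrystalIso (rowCrystal N n m) (howeSnd N n m) (howeEquiv N n m) := by
  have D := doubleCrystal n m
  refine isCrystalIso_of_e (isCrystal_row N n m) (isCrystal_howeSnd N n m) (fun M => ?_)
    fun i M => ?_
  · have h : (howeSnd N n m).wt (howeEquiv N n m M) = rowWt (matQ (howeEquiv N n m M)) :=
      tabCrystal_wt (rowLen_transpose_le (howeEquiv N n m M).1) _
    rw [h, matQ_howeEquiv, rowCrystal_wt]
    exact (D.wr_conn (D.conn_lo M.1)).symm
  · ext y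
    obtain ⟨M', rfl⟩ := (howeEquiv N n m).surjective y
    rw [howeSnd_e_iff, matP_howeEquiv, matP_howeEquiv, matQ_howeEquiv, matQ_howeEquiv,
      Option.map_eq_some_iff]
    simp only [EmbeddingLike.apply_eq_iff_eq, exists_eq_right, rowCrystal_e_iff]
    exact ⟨fun h => D.r_of_lo h.1 h.2, fun h => ⟨D.r_lo h, D.hi_eq_of_conn (.single h)⟩⟩

theorem exists_isEMax (M : LambdaB N n m) :
    ∃ P : LambdaB N n m, IsEMax (rowCrystal N n m) M P ∧ P.1 = hiMat M.1 := by
  have D := doubleCrystal n m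
  have key : ∀ X : Mat n m, Relation.ReflTransGen (fun a b => ∃ i, rowR n m i b a) M.1 X →
      ∃ P : LambdaB N n m, P.1 = X ∧
        Relation.ReflTransGen (fun x y => ∃ i, (rowCrystal N n m).e i x = some y) M P := by
    intro X hX
    induction hX with
    | refl => exact ⟨M, rfl, .refl⟩
    | @tail Y Z _ h ih =>
      obtain ⟨P, rfl, hP⟩ := ih
      obtain ⟨i, h⟩ := h
      exact ⟨⟨Z, (ones_of_conn_row (Conn.single h).symm).trans P.2⟩, rfl,
        hP.tail ⟨i, (rowCrystal_e_iff i _ _).2 h⟩⟩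
  obtain ⟨P, hP, hMP⟩ := key _ (D.raise_hi M.1)
  refine ⟨P, ⟨hMP, fun i => Option.eq_none_iff_forall_ne_some.2 fun P' h => ?_⟩, hP⟩
  have h' : rowR n m i P'.1 (D.hi M.1) := hP ▸ (rowCrystal_e_iff i _ _).1 h
  exact D.isHigh_hi M.1 i _ h'

theorem exists_isFMax (M : LambdaB N n m) :
    ∃ Q : LambdaB N n m, IsFMax (colCrystal N n m) M Q ∧ Q.1 = loMat M.1 := by
  have D := doubleCrystal n m
  have key : ∀ X : Mat n m, Relation.ReflTransGen (fun a b => ∃ i, colR n m i a b) M.1 X →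
      ∃ Q : LambdaB N n m, Q.1 = X ∧
        Relation.ReflTransGen (fun x y => ∃ i, (colCrystal N n m).f i x = some y) M Q := by
    intro X hX
    induction hX with
    | refl => exact ⟨M, rfl, .refl⟩
    | @tail Y Z _ h ih =>
      obtain ⟨Q, rfl, hQ⟩ := ih
      obtain ⟨i, h⟩ := h
      exact ⟨⟨Z, (ones_of_conn_col (Conn.single h)).trans Q.2⟩, rfl,
        hQ.tail ⟨i, (colCrystal_f_iff i _ _).2 h⟩⟩
  obtain ⟨Q, hQ, hMQ⟩ := key _ (D.lower_lo M.1)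
  refine ⟨Q, ⟨hMQ, fun i => Option.eq_none_iff_forall_ne_some.2 fun Q' h => ?_⟩, hQ⟩
  have h' : colR n m i (D.lo M.1) Q'.1 := hQ ▸ (colCrystal_f_iff i _ _).1 h
  exact D.isLow_lo M.1 i _ h'

theorem isSkewHoweDuality_howeEquiv (N n m : ℕ) : IsSkewHoweDuality (howeEquiv N n m) where
  iso_fst := isCrystalIso_howeFst N n m
  iso_snd := isCrystalIso_howeSnd N n m
  exists_P M := by
    obtain ⟨P, h₁, h₂⟩ := exists_isEMax M
    refine ⟨P, h₁, fun a j => ?_⟩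
    have h₃ : P.1 = matP (howeEquiv N n m M) := h₂.trans (matP_howeEquiv M).symm
    rw [h₃]
    exact matT_eq_true_iff
  exists_Q M := by
    obtain ⟨Q, h₁, h₂⟩ := exists_isFMax M
    refine ⟨Q, h₁, fun a j => ?_⟩
    have h₃ : Q.1 = matQ (howeEquiv N n m M) := h₂.trans (matQ_howeEquiv M).symm
    rw [h₃, matQ, tau, Fin.rev_rev]
    exact matT_eq_true_iff

/-- The map on pairs of tableaux, pulled back along the isomorphism, is again a Schützenberger
involution of the column crystal, so uniqueness identifies the two. -/
theorem howeEquiv_sInner {p q : Fin n} (hpq : p < q) (M : LambdaB N n m) :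
    howeEquiv N n m (sInner p q M) = howeInner p q (howeEquiv N n m M) := by
  have h := (isSchutzenberger_sInner hpq).unique (isCrystal_col N n m) (uniqueHighest_col hpq)
    (last_le hpq) ((isSchutzenberger_howeInner hpq).of_iso (isCrystalIso_howeFst N n m))
  rw [h, Equiv.apply_symm_apply]

end GLCrystal

/-- On the `gl_n × gl_m`-crystal `Λ^N B_{n,m}` of 0/1-matrices the Schützenberger involutions involved
exist and are unique, the outer and the inner maps define actions of the cactus group `C_n`, these
actions agree, and under crystal skew Howe duality they become `b ⊗ c ↦ ξ_{p,q}(b) ⊗ c`. -/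
theorem mainTheorem1 (N n m : ℕ) :
    -- the two crystal structures
    GLCrystal.IsCrystal (GLCrystal.colCrystal N n m) ∧
    GLCrystal.IsCrystal (GLCrystal.rowCrystal N n m) ∧
    -- the Schützenberger involutions in the definitions of the two actions are well defined
    (∃! ξ, GLCrystal.IsSchutzenberger (GLCrystal.vecCrystal m) 0 (m - 1) ξ) ∧
    (∀ d : ℕ, ∃! ξ, GLCrystal.IsSchutzenberger
      (GLCrystal.tensorPow (GLCrystal.vecCrystal m) d) 0 (m - 1) ξ) ∧
    (∀ p q : Fin n, p < q →
      ∃! ξ, GLCrystal.IsSchutzenberger (GLCrystal.colCrystal N n m) p.1 q.1 ξ) ∧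
    (∀ (μ : GLCrystal.BoxPartition N n m) (p q : Fin n), p < q →
      ∃! ξ, GLCrystal.IsSchutzenberger (GLCrystal.tabCrystal n μ.1) p.1 q.1 ξ) ∧
    -- the outer and the inner map agree
    (∀ (p q : Fin n), p < q → ∀ M : GLCrystal.LambdaB N n m,
      GLCrystal.sOuter p q M.1 = (GLCrystal.sInner p q M).1) ∧
    -- both define actions of the cactus group, and these coincide
    (∃ ρo ρi : GLCrystal.CactusGroup n →* Equiv.Perm (GLCrystal.LambdaB N n m),
      (∀ (p q : Fin n) (h : p < q) (M : GLCrystal.LambdaB N n m),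
        (ρo (GLCrystal.cactusS p q h) M).1 = GLCrystal.sOuter p q M.1) ∧
      (∀ (p q : Fin n) (h : p < q) (M : GLCrystal.LambdaB N n m),
        ρi (GLCrystal.cactusS p q h) M = GLCrystal.sInner p q M) ∧
      ρo = ρi ∧
      -- compatibility with crystal skew Howe duality
      ∃ F : GLCrystal.LambdaB N n m ≃ GLCrystal.Howe N n m,
        GLCrystal.IsSkewHoweDuality F ∧
        ∀ (p q : Fin n) (h : p < q) (M : GLCrystal.LambdaB N n m),
          F (ρo (GLCrystal.cactusS p q h) M) = GLCrystal.howeInner p q (F M)) := by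
  open GLCrystal in
  refine ⟨isCrystal_col N n m, isCrystal_row N n m, existsUnique_schutzenberger_vec m,
    fun d => existsUnique_schutzenberger (isCrystal_tensorPow d m) (uniqueHighest_tensorPow d m)
      le_rfl ⟨_, isSchutzenberger_schutzMat d m⟩,
    fun p q h => existsUnique_schutzenberger (isCrystal_col N n m) (uniqueHighest_col h)
      (last_le h) ⟨_, isSchutzenberger_sInner h⟩,
    fun μ p q h => existsUnique_schutzenberger_tab μ.1 h,
    fun p q h M => sOuter_eq_sInner h M,
    -- One homomorphism serves for both actions, since the outer and inner maps agree on generators.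
    cactusAction N n m, cactusAction N n m, fun p q h M => ?_,
    fun p q h M => cactusAction_cactusS h M, rfl,
    howeEquiv N n m, isSkewHoweDuality_howeEquiv N n m, fun p q h M => ?_⟩
  · rw [cactusAction_cactusS, sOuter_eq_sInner h]
  · rw [cactusAction_cactusS, howeEquiv_sInner h]
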